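/- Let $\mathcal H$ be a separable complex Hilbert space, let $\mathcal K$ be a complex Hilbert space (inner products linear in the second argument), and let $F\colon\mathcal H\to\mathcal K$ be a rigging operator, that is, a bounded injective operator with dense range. For a self-adjoint operator $H$ on $\mathcal H$ put $R_z(H)=(H-z)^{-1}$ and $T_z(H)=FR_z(H)F^*$ for nonreal $z$, and let $\Lambda(H)$ be the set of all $\lambda\in\mathbb R$ for which the limit $T_{\lambda+i0}(H)=\lim_{y\to0^+}T_{\lambda+iy}(H)$ exists in operator norm. The Limiting Absorption Principle is said to hold for $H$ if $\mathbb R\setminus\Lambda(H)$ is a Lebesgue null set. For $\lambda\in\Lambda(H)$ let $\mathfrak h_\lambda(H)\subset\mathcal K$ be the closure of the range of $\sqrt{\operatorname{Im}T_{\lambda+i0}(H)}$ and let $\mathcal E_\lambda(H)\colon\operatorname{rng}F^*\to\mathfrak h_\lambda(H)$, $\mathcal E_\lambda(H)F^*\varphi=\sqrt{\pi^{-1}\operatorname{Im}T_{\lambda+i0}(H)}\,\varphi$. Let $\int^\oplus_{\Lambda(H)}\mathfrak h_\lambda(H)\,d\lambda$ be the space of all $f\in L_2(\Lambda(H),\mathcal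 K)$ with $f(\lambda)\in\mathfrak h_\lambda(H)$ for a.e. $\lambda$. Let $\mathcal H^{(a)}(H)$ be the absolutely continuous subspace of $H$, and let the absolutely continuous part of $H$ be the part of $H$ in $\mathcal H^{(a)}(H)$. Theorem. Let $H_0$ and $H_1$ be self-adjoint operators on $\mathcal H$ with $H_1=H_0+F^*JF$ for some bounded self-adjoint operator $J$ on $\mathcal K$, and suppose that the Limiting Absorption Principle holds for both $H_0$ and $H_1$. Put $\Lambda=\Lambda(H_0)\cap\Lambda(H_1)$. Then the following hold. 1. For $j=0,1$ there is a (unique) bounded operator $\mathcal E(H_j)\colon\mathcal H\to\int^\oplus_{\Lambda(H_j)}\mathfrak h_\lambda(H_j)\,d\lambda$ such that for every $f\in\operatorname{rng}F^*$ one has $(\mathcal E(H_j)f)(\lambda)=\mathcal E_\lambda(H_j)f$ for a.e. $\lambda\in\Lambda(H_j)$. 2. For each of the two signs and every $\lambda\in\Lambda$ there is a (unique) bounded operator $w_\pm(\lambda;H_1,H_0)\colon\mathfrak h_\lambda(H_0)\to\mathfrak h_\lambda(H_1)$, the wave matrix, such that for all $f,g\in\operatorname{rng}F^*$ $$\langle\mathcal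 E_\lambda(H_1)f,\,w_\pm(\lambda;H_1,H_0)\,\mathcal E_\lambda(H_0)g\rangle=\lim_{y\to0^+}\frac y\pi\langle R_{\lambda\pm iy}(H_1)f,\,R_{\lambda\pm iy}(H_0)g\rangle .$$ 3. For each of the two signs the wave operator $W_\pm=\int^\oplus_\Lambda w_\pm(\lambda;H_1,H_0)\,d\lambda$, transported by $\mathcal E(H_0)$ and $\mathcal E(H_1)$, is a unitary operator from $\mathcal H^{(a)}(H_0)$ onto $\mathcal H^{(a)}(H_1)$: there is a unitary $W_\pm\colon\mathcal H^{(a)}(H_0)\to\mathcal H^{(a)}(H_1)$ such that for every $f\in\mathcal H^{(a)}(H_0)$ $$(\mathcal E(H_1)W_\pm f)(\lambda)=w_\pm(\lambda;H_1,H_0)\,(\mathcal E(H_0)f)(\lambda)\qquad\text{for a.e. }\lambda\in\Lambda .$$ Moreover $W_\pm$ carries the absolutely continuous part of $H_0$ onto that of $H_1$, including the domains. In particular, the absolutely continuous parts of $H_0$ and $H_1$ are unitarily equivalent. -/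

import Mathlib

open MeasureTheory Filter Topology
open scoped ComplexStarModule InnerProductSpace

noncomputable section

namespace Scattering

/-! ### Spectral measures of unbounded self-adjoint operators -/

/-- A projection-valued Borel measure on the line. Only values on Borel sets carry information. -/
structure ProjMeasure (E : Type*) [NormedAddCommGroup E] [InnerProductSpace ℂ E]
    [CompleteSpace E] where
  proj : Set ℝ → E →L[ℂ] E
  isStarProjection : ∀ s, MeasurableSet s → IsStarProjection (proj s)
  proj_univ : proj Set.univ = 1
  proj_inter : ∀ s t, MeasurableSet s → MeasurableSet t → proj (s ∩ t) = proj s * proj t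
  hasSum : ∀ s : ℕ → Set ℝ, (∀ n, MeasurableSet (s n)) → Pairwise (Function.onFun Disjoint s) →
    ∀ f, HasSum (fun n => proj (s n) f) (proj (⋃ n, s n) f)

section ProjMeasure

variable {E : Type*} [NormedAddCommGroup E] [InnerProductSpace ℂ E] [CompleteSpace E]

theorem ProjMeasure.inner_proj (P : ProjMeasure E) {s : Set ℝ} (hs : MeasurableSet s) (f : E) :
    inner ℂ f (P.proj s f) = ((‖P.proj s f‖ ^ 2 : ℝ) : ℂ) := by
  have h := P.isStarProjection s hs
  have h1 : P.proj s (P.proj s f) = P.proj s f := by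
    have := congrArg (fun A : E →L[ℂ] E => A f) h.isIdempotentElem
    simpa using this
  have h2 : ContinuousLinearMap.adjoint (P.proj s) = P.proj s := h.isSelfAdjoint
  calc inner ℂ f (P.proj s f) = inner ℂ f (P.proj s (P.proj s f)) := by rw [h1]
    _ = inner ℂ (ContinuousLinearMap.adjoint (P.proj s) f) (P.proj s f) := by
        rw [ContinuousLinearMap.adjoint_inner_left]
    _ = _ := by rw [h2, inner_self_eq_norm_sq_to_K]; norm_cast

/-- The scalar measure `s ↦ ‖P(s) f‖² = ⟪f, P(s) f⟫`. -/
def ProjMeasure.scalar (P : ProjMeasure E) (f : E) : Measure ℝ :=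
  Measure.ofMeasurable (fun s _ => ENNReal.ofReal (‖P.proj s f‖ ^ 2))
    (by
      have h := P.hasSum (fun _ => ∅) (fun _ => MeasurableSet.empty)
        (fun _ _ _ => by simp [Function.onFun]) f
      have h0 : P.proj ∅ f = 0 := by
        simpa using tendsto_nhds_unique h.summable.tendsto_atTop_zero tendsto_const_nhds |>.symm
      simp [h0])
    (by
      intro s hs hd
      have h := P.hasSum s hs hd f
      have h1 : HasSum (fun n => ‖P.proj (s n) f‖ ^ 2) (‖P.proj (⋃ n, s n) f‖ ^ 2) := by
        have h2 := h.mapL (innerSL ℂ f)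
        simp only [innerSL_apply_apply, P.inner_proj (hs _),
          P.inner_proj (MeasurableSet.iUnion hs)] at h2
        exact_mod_cast h2
      rw [← h1.tsum_eq, ENNReal.ofReal_tsum_of_nonneg (fun _ => by positivity) h1.summable])

/-- `P` is the spectral measure of the operator `H`, that is, `H = ∫ x dP(x)`: the domain of `H` is
`{f | ∫ x² d⟪f, P f⟫ < ∞}` and `⟪f, H f⟫ = ∫ x d⟪f, P f⟫` for `f` in the domain. -/
structure ProjMeasure.IsSpectralMeasureOf (P : ProjMeasure E) (H : E →ₗ.[ℂ] E) : Prop where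
  mem_domain : ∀ f, f ∈ H.domain ↔ Integrable (fun x : ℝ => x ^ 2) (P.scalar f)
  inner_apply : ∀ f : H.domain, inner ℂ (f : E) (H f) = ((∫ x, x ∂(P.scalar f) : ℝ) : ℂ)

open Classical in
/-- The unit mass at `0`; it only serves as a default value. -/
def ProjMeasure.unitMass : ProjMeasure E where
  proj s := if (0 : ℝ) ∈ s then 1 else 0
  isStarProjection s _ := by split_ifs <;> simp
  proj_univ := by simp
  proj_inter s t _ _ := by by_cases h : (0 : ℝ) ∈ s <;> by_cases h' : (0 : ℝ) ∈ t <;> simp [h, h']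
  hasSum s _ hd f := by
    by_cases h : ∃ n, (0 : ℝ) ∈ s n
    · obtain ⟨n, hn⟩ := h
      have h1 : (0 : ℝ) ∈ ⋃ n, s n := Set.mem_iUnion.2 ⟨n, hn⟩
      have h2 : ∀ m, m ≠ n → (0 : ℝ) ∉ s m := fun m hm h' =>
        (Set.disjoint_left.1 (hd hm)) h' hn
      have := hasSum_single (f := fun m => (if (0 : ℝ) ∈ s m then (1 : E →L[ℂ] E) else 0) f) n
        (fun m hm => by simp [h2 m hm])
      simpa [h1, hn] using this
    · have h1 : (0 : ℝ) ∉ ⋃ n, s n := by simpa using h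
      have h2 : ∀ n, (0 : ℝ) ∉ s n := by simpa using h
      simp [h2, hasSum_zero]

open Classical in
/-- The spectral measure of `H`. -/
def spectralMeasure (H : E →ₗ.[ℂ] E) : ProjMeasure E :=
  if h : ∃ P : ProjMeasure E, P.IsSpectralMeasureOf H then h.choose else ProjMeasure.unitMass

/-- The absolutely continuous subspace of `H`: the vectors `f` whose scalar spectral measure
`s ↦ ‖P(s) f‖²` vanishes on all Lebesgue null sets. -/
def acSubspace (H : E →ₗ.[ℂ] E) : Submodule ℂ E where
  carrier := {f | ∀ N : Set ℝ, MeasurableSet N → volume N = 0 → (spectralMeasure H).proj N f = 0}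
  add_mem' hf hg N hN h0 := by rw [map_add, hf N hN h0, hg N hN h0, add_zero]
  zero_mem' _ _ _ := map_zero _
  smul_mem' c f hf N hN h0 := by rw [map_smul, hf N hN h0, smul_zero]

/-- The part of an operator `A` in a subspace `M`: its restriction to the vectors `x ∈ M` of the
domain for which `A x ∈ M`. -/
def partIn (A : E →ₗ.[ℂ] E) (M : Submodule ℂ E) : M →ₗ.[ℂ] M where
  domain :=
    { carrier := {x | ∃ h : (x : E) ∈ A.domain, A ⟨x, h⟩ ∈ M}
      add_mem' := by
        rintro x y ⟨hx, hx'⟩ ⟨hy, hy'⟩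
        refine ⟨A.domain.add_mem hx hy, ?_⟩
        have : A ⟨(x : E) + y, A.domain.add_mem hx hy⟩ = A ⟨x, hx⟩ + A ⟨y, hy⟩ :=
          A.map_add ⟨x, hx⟩ ⟨y, hy⟩
        exact this ▸ M.add_mem hx' hy'
      zero_mem' := ⟨A.domain.zero_mem, by
        have : A ⟨((0 : M) : E), A.domain.zero_mem⟩ = 0 := A.map_zero
        exact this ▸ M.zero_mem⟩
      smul_mem' := by
        rintro c x ⟨hx, hx'⟩
        refine ⟨A.domain.smul_mem c hx, ?_⟩
        have : A ⟨c • (x : E), A.domain.smul_mem c hx⟩ = c • A ⟨x, hx⟩ := A.map_smul c ⟨x, hx⟩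
        exact this ▸ M.smul_mem c hx' }
  toFun :=
    { toFun := fun x => ⟨A ⟨x.1, x.2.choose⟩, x.2.choose_spec⟩
      map_add' := fun x y => Subtype.ext (A.map_add ⟨x.1, x.2.choose⟩ ⟨y.1, y.2.choose⟩)
      map_smul' := fun c x => Subtype.ext (A.map_smul c ⟨x.1, x.2.choose⟩) }

/-- The absolutely continuous part of `H`. -/
def acPart (H : E →ₗ.[ℂ] E) : acSubspace H →ₗ.[ℂ] acSubspace H := partIn H (acSubspace H)

end ProjMeasure

/-- The unitary operator `U` carries `A` onto `B`: `B = U A U⁻¹`, including the domains. -/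
def Intertwines {E₀ E₁ : Type*} [NormedAddCommGroup E₀] [InnerProductSpace ℂ E₀]
    [NormedAddCommGroup E₁] [InnerProductSpace ℂ E₁] (U : E₀ ≃ₗᵢ[ℂ] E₁)
    (A : E₀ →ₗ.[ℂ] E₀) (B : E₁ →ₗ.[ℂ] E₁) : Prop :=
  ∀ x y : E₀, (x, y) ∈ A.graph ↔ (U x, U y) ∈ B.graph

/-! ### Sandwiched resolvents and the Limiting Absorption Principle -/

section Resolvent

variable {E : Type*} [NormedAddCommGroup E] [InnerProductSpace ℂ E]

/-- `R` is a bounded everywhere defined two-sided inverse of `H - z`. -/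
def IsResolventAt (H : E →ₗ.[ℂ] E) (z : ℂ) (R : E →L[ℂ] E) : Prop :=
  (∀ x, ∃ h : R x ∈ H.domain, H ⟨R x, h⟩ - z • R x = x) ∧
    ∀ x : H.domain, R (H x - z • (x : E)) = x

open Classical in
/-- The resolvent `R_z(H) = (H - z)⁻¹` (zero if `z` is in the spectrum). -/
def resolventOp (H : E →ₗ.[ℂ] E) (z : ℂ) : E →L[ℂ] E :=
  if h : ∃ R, IsResolventAt H z R then h.choose else 0

end Resolvent

variable {E K : Type*} [NormedAddCommGroup E] [InnerProductSpace ℂ E] [CompleteSpace E]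
  [NormedAddCommGroup K] [InnerProductSpace ℂ K] [CompleteSpace K]

/-- A rigging operator: bounded, injective, with dense range. -/
def IsRigging (F : E →L[ℂ] K) : Prop := Function.Injective F ∧ DenseRange F

/-- The sandwiched resolvent `T_z(H) = F R_z(H) F*`. -/
def sandwiched (H : E →ₗ.[ℂ] E) (F : E →L[ℂ] K) (z : ℂ) : K →L[ℂ] K :=
  F ∘L resolventOp H z ∘L ContinuousLinearMap.adjoint F

/-- The set `Λ(H, F)` of real `l` such that the limit `T_{l+i0}(H)` exists in operator norm. -/
def regularSet (H : E →ₗ.[ℂ] E) (F : E →L[ℂ] K) : Set ℝ :=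
  {l | ∃ T : K →L[ℂ] K,
    Tendsto (fun y : ℝ => sandwiched H F (l + y * Complex.I)) (𝓝[>] 0) (𝓝 T)}

/-- The Limiting Absorption Principle: `Λ(H, F)` is a set of full Lebesgue measure. -/
def LimitingAbsorption (H : E →ₗ.[ℂ] E) (F : E →L[ℂ] K) : Prop :=
  volume (regularSet H F)ᶜ = 0

/-- The limit `T_{l+i0}(H)`, for `l ∈ Λ(H, F)`. -/
def boundaryValue (H : E →ₗ.[ℂ] E) (F : E →L[ℂ] K) (l : ℝ) : K →L[ℂ] K :=
  limUnder (𝓝[>] (0 : ℝ)) (fun y : ℝ => sandwiched H F (l + y * Complex.I))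

/-- The operator `√(Im T_{l+i0}(H))`. -/
def sqrtIm (H : E →ₗ.[ℂ] E) (F : E →L[ℂ] K) (l : ℝ) : K →L[ℂ] K :=
  CFC.sqrt (ℑ (boundaryValue H F l) : K →L[ℂ] K)

/-- The fibre Hilbert space `h_l(H)`: the closure of the range of `√(Im T_{l+i0}(H))`. -/
def fibre (H : E →ₗ.[ℂ] E) (F : E →L[ℂ] K) (l : ℝ) : Submodule ℂ K :=
  (LinearMap.range (sqrtIm H F l : K →ₗ[ℂ] K)).topologicalClosure

/-- The evaluation operator `ℰ_l(H) = √(π⁻¹ Im T_{l+i0}(H)) (F*)⁻¹` on the range of `F*`, given by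
its value at the vector `F* φ`. -/
def evalAt (H : E →ₗ.[ℂ] E) (F : E →L[ℂ] K) (l : ℝ) (φ : K) : fibre H F l :=
  ⟨(((√Real.pi)⁻¹ : ℝ) : ℂ) • sqrtIm H F l φ,
    Submodule.smul_mem _ _ (Submodule.le_topologicalClosure _ ⟨φ, rfl⟩)⟩

/-! ### Direct integrals -/

/-- The direct integral `∫^⊕_{Λ(H,F)} h_l(H) dl`: the subspace of `L²(Λ(H,F), K)` of those `f` with
`f(l) ∈ h_l(H)` for a.e. `l`. -/
def directIntegral (H : E →ₗ.[ℂ] E) (F : E →L[ℂ] K) :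
    Submodule ℂ (Lp K 2 (volume.restrict (regularSet H F))) where
  carrier := {f | ∀ᵐ l ∂(volume.restrict (regularSet H F)), f l ∈ fibre H F l}
  add_mem' {f g} hf hg := by
    filter_upwards [hf, hg, Lp.coeFn_add f g] with l h1 h2 h3
    rw [h3]; exact Submodule.add_mem _ h1 h2
  zero_mem' := by
    filter_upwards [Lp.coeFn_zero K 2 (volume.restrict (regularSet H F))] with l h
    rw [h]; exact Submodule.zero_mem _
  smul_mem' c f hf := by
    filter_upwards [hf, Lp.coeFn_smul c f] with l h1 h2
    rw [h2]; exact Submodule.smul_mem _ _ h1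

/-- `S` is the bounded extension to the whole space of the map which sends `f` in the range of `F*`
to the section `l ↦ ℰ_l(H) f` of the direct integral. -/
def IsEvaluation (H : E →ₗ.[ℂ] E) (F : E →L[ℂ] K) (S : E →L[ℂ] directIntegral H F) : Prop :=
  ∀ φ : K, ∀ᵐ l ∂(volume.restrict (regularSet H F)),
    (S (ContinuousLinearMap.adjoint F φ) : Lp K 2 (volume.restrict (regularSet H F))) l
      = evalAt H F l φ

open Classical in
/-- The operator `ℰ(H)` from the main Hilbert space to the direct integral. -/
def evaluation (H : E →ₗ.[ℂ] E) (F : E →L[ℂ] K) : E →L[ℂ] directIntegral H F :=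
  if h : ∃ S, IsEvaluation H F S then h.choose else 0

/-- A representative of the section `ℰ(H) f` of the direct integral. -/
def evalSection (H : E →ₗ.[ℂ] E) (F : E →L[ℂ] K) (f : E) : ℝ → K :=
  (evaluation H F f : Lp K 2 (volume.restrict (regularSet H F)))

/-! ### Wave matrices and wave operators -/

/-- `w : h_l(H₀) → h_l(H₁)` is the wave matrix `w_±(l; H₁, H₀)`, the sign being `ε`:
`⟪ℰ_l(H₁) f, w ℰ_l(H₀) g⟫ = lim_{y → 0+} (y / π) ⟪R_{l ± iy}(H₁) f, R_{l ± iy}(H₀) g⟫`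
for all `f = F* φ` and `g = F* ψ`. -/
def IsWaveMatrix (ε : ℤˣ) (H₁ H₀ : E →ₗ.[ℂ] E) (F : E →L[ℂ] K) (l : ℝ)
    (w : fibre H₀ F l →L[ℂ] fibre H₁ F l) : Prop :=
  ∀ φ ψ : K, Tendsto
    (fun y : ℝ => ((y / Real.pi : ℝ) : ℂ) *
      inner ℂ (resolventOp H₁ (l + (ε : ℤ) * y * Complex.I) (ContinuousLinearMap.adjoint F φ))
        (resolventOp H₀ (l + (ε : ℤ) * y * Complex.I) (ContinuousLinearMap.adjoint F ψ)))
    (𝓝[>] 0) (𝓝 (inner ℂ (evalAt H₁ F l φ) (w (evalAt H₀ F l ψ))))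

open Classical in
/-- The wave matrix `w_±(l; H₁, H₀)`, for `l ∈ Λ(H₀, F) ∩ Λ(H₁, F)`. -/
def waveMatrix (ε : ℤˣ) (H₁ H₀ : E →ₗ.[ℂ] E) (F : E →L[ℂ] K) (l : ℝ) :
    fibre H₀ F l →L[ℂ] fibre H₁ F l :=
  if h : ∃ w, IsWaveMatrix ε H₁ H₀ F l w then h.choose else 0

/-- `W` is the wave operator `W_±(H₁, H₀; Λ)`, `Λ = Λ(H₀, F) ∩ Λ(H₁, F)`, regarded as an operator
between the absolutely continuous subspaces: under `ℰ(H₀)` and `ℰ(H₁)` it becomes the direct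
integral `∫^⊕_Λ w_±(l; H₁, H₀) dl`. -/
def IsWaveOperator (ε : ℤˣ) (H₁ H₀ : E →ₗ.[ℂ] E) (F : E →L[ℂ] K)
    (W : acSubspace H₀ → acSubspace H₁) : Prop :=
  ∀ f : acSubspace H₀, ∀ᵐ l ∂(volume.restrict (regularSet H₀ F ∩ regularSet H₁ F)),
    ∃ h : evalSection H₀ F f l ∈ fibre H₀ F l,
      evalSection H₁ F (W f) l = waveMatrix ε H₁ H₀ F l ⟨evalSection H₀ F f l, h⟩

end Scattering

end

noncomputable section

namespace Scattering

/-! ### Resolvents of self-adjoint operators -/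

section SelfAdjointResolvent

variable {E : Type*} [NormedAddCommGroup E] [InnerProductSpace ℂ E]

variable [CompleteSpace E] {H : E →ₗ.[ℂ] E}

/-! The resolvent identity gives `Im T_z = Im z • (R_z F*)* (R_z F*)`, and the diagonal matrix
elements of this operator are Poisson integrals of the spectral measures of the vectors `F* φ`. By
Fatou's theorem (`ae_tendsto_poisson`) the number `‖ℰ_l(H) F* φ‖²` is therefore, for a.e. `l`, the
density of the absolutely continuous part of that measure (`ae_norm_evalAt_sq`). Hence `ℰ(H)`
extends to a contraction, is isometric on the absolutely continuous subspace, turns spectral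
projections into multiplication by indicators, and maps that subspace onto the whole direct integral
(`setLIntegral_evalSection`, `evalSection_proj`, `exists_mem_acSubspace_evalSection_eq`).

The perturbation enters through `R_z(H₀) F* = R_z(H₁) F* A_z` with `A_z = 1 + J T_z(H₀)`. At the
real axis this yields `Im T(H₀) = A* (Im T(H₁)) A` (`imaginaryPart_boundaryValue_eq`) and `(1 - J
T(H₁)) A = 1` (`transition_comp_transition`). So `ℰ_l(H₀) F* ψ ↦ ℰ_l(H₁) F* A ψ` is a well-defined
isometry of fibres, inverted by the same map with the two operators exchanged, and it is the wave
matrix (`waveMatrix_evalAt`). Applying it fibrewise and using surjectivity of `ℰ(H₁)` gives the wave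
operator. That operator preserves the scalar spectral measures; these determine the domain and the
quadratic form, so it carries one absolutely continuous part onto the other
(`intertwines_of_scalar_eq`).

The spectral measure is characterised only by domain and quadratic form. Its existence comes from
the continuous functional calculus of `R_i(H)`, and the uniqueness of the scalar measures
(`scalar_eq`) is what ties an arbitrary choice of it to the resolvent. -/

theorem inner_symm_of_isSelfAdjoint (hH : IsSelfAdjoint H) (x y : H.domain) :
    inner ℂ (H x) (y : E) = inner ℂ (x : E) (H y) := by
  have h := LinearPMap.adjoint_isFormalAdjoint hH.dense_domain
  rw [LinearPMap.isSelfAdjoint_def.1 hH] at h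
  exact h x y

/-- The maximality half of self-adjointness: the hypothesis puts `(y, w)` in the graph of the
adjoint, which is the graph of `H`. -/
theorem exists_apply_eq_of_isSelfAdjoint (hH : IsSelfAdjoint H) {y w : E}
    (h : ∀ x : H.domain, inner ℂ w (x : E) = inner ℂ y (H x)) :
    ∃ hy : y ∈ H.domain, H ⟨y, hy⟩ = w := by
  have h1 := LinearPMap.mem_adjoint_domain_of_exists (T := H) y ⟨w, h⟩
  have h2 := LinearPMap.adjoint_apply_eq hH.dense_domain ⟨y, h1⟩ h
  have : (y, w) ∈ (LinearPMap.adjoint H).graph :=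
    (LinearPMap.mem_graph_iff _).2 ⟨⟨y, h1⟩, rfl, h2⟩
  rw [LinearPMap.isSelfAdjoint_def.1 hH, LinearPMap.mem_graph_iff] at this
  obtain ⟨⟨y', hy'⟩, rfl, h5⟩ := this
  exact ⟨hy', h5⟩

/-- Since `⟪x, H x⟫` is real, the imaginary part of `⟪x, (H - z) x⟫` is `-Im z ‖x‖²`; Cauchy–Schwarz
bounds it. -/
theorem abs_im_mul_norm_le (hH : IsSelfAdjoint H) (z : ℂ) (x : H.domain) :
    |z.im| * ‖(x : E)‖ ≤ ‖H x - z • (x : E)‖ := by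
  have h1 : (inner ℂ (x : E) (H x)).im = 0 := by
    have := inner_symm_of_isSelfAdjoint hH x x
    rw [← inner_conj_symm] at this
    simpa using Complex.conj_eq_iff_im.1 this
  have h2 : (inner ℂ (x : E) (H x - z • (x : E))).im = - (z.im * ‖(x : E)‖ ^ 2) := by
    rw [inner_sub_right, inner_smul_right, inner_self_eq_norm_sq_to_K, Complex.sub_im, h1]
    simp only [Complex.coe_algebraMap, ← Complex.ofReal_pow]
    simp [Complex.mul_im, -Complex.ofReal_pow]
  have h3 : |z.im| * ‖(x : E)‖ ^ 2 ≤ ‖(x : E)‖ * ‖H x - z • (x : E)‖ := by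
    refine le_trans ?_ (norm_inner_le_norm (𝕜 := ℂ) _ _)
    refine le_trans (le_of_eq ?_) (Complex.abs_im_le_norm _)
    rw [h2, abs_neg, abs_mul, abs_of_nonneg (sq_nonneg ‖(x : E)‖)]
  rcases (norm_nonneg (x : E)).eq_or_lt with h | h
  · rw [← h]; simp
  · nlinarith

/-- On the graph of `H`, which is complete because `H` is closed, `H - z` is a bounded operator. The
lower bound makes it antilipschitz for the graph norm. -/
theorem isClosed_range_sub_smul (hH : IsSelfAdjoint H) {z : ℂ} (hz : z.im ≠ 0) :
    IsClosed (LinearMap.range (H.toFun - z • H.domain.subtype) : Set E) := by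
  have hc : IsClosed (H.graph : Set (E × E)) := hH.isClosed
  have : CompleteSpace H.graph := hc.completeSpace_coe
  let T : H.graph →L[ℂ] E :=
    (ContinuousLinearMap.snd ℂ E E - z • ContinuousLinearMap.fst ℂ E E) ∘L H.graph.subtypeL
  have hb : ∀ p : H.graph, ‖p‖ ≤ Real.toNNReal (|z.im|⁻¹ + (1 + ‖z‖ * |z.im|⁻¹)) * ‖T p‖ := by
    rintro ⟨p, hp⟩
    obtain ⟨x, hx, hx'⟩ := (LinearPMap.mem_graph_iff _).1 hp
    have hT : T ⟨p, hp⟩ = H x - z • (x : E) := by simp [T, hx, hx']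
    have h1 := abs_im_mul_norm_le hH z x
    have h0 : 0 < |z.im| := abs_pos.2 hz
    have h2 : ‖(x : E)‖ ≤ |z.im|⁻¹ * ‖H x - z • (x : E)‖ := by
      rwa [← div_eq_inv_mul, le_div_iff₀' h0]
    have h3 : ‖H x‖ ≤ ‖H x - z • (x : E)‖ + ‖z‖ * ‖(x : E)‖ := by
      rw [← norm_smul]
      simpa using norm_add_le (H x - z • (x : E)) (z • (x : E))
    rw [hT, Real.coe_toNNReal _ (by positivity), Submodule.coe_norm, Prod.norm_def, ← hx, ← hx']
    have h4 : ‖z‖ * ‖(x : E)‖ ≤ ‖z‖ * (|z.im|⁻¹ * ‖H x - z • (x : E)‖) := by gcongr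
    have h5 : 0 ≤ |z.im|⁻¹ * ‖H x - z • (x : E)‖ := by positivity
    have h6 : 0 ≤ ‖z‖ * (|z.im|⁻¹ * ‖H x - z • (x : E)‖) := by positivity
    refine max_le ?_ ?_ <;> nlinarith [norm_nonneg (H x - z • (x : E))]
  have h := (T.antilipschitz_of_bound hb).isClosed_range T.uniformContinuous
  convert h using 1
  ext y
  constructor
  · rintro ⟨x, rfl⟩
    exact ⟨⟨((x : E), H x), H.mem_graph x⟩, by simp [T]⟩
  · rintro ⟨⟨p, hp⟩, rfl⟩
    obtain ⟨x, hx, hx'⟩ := (LinearPMap.mem_graph_iff _).1 hp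
    exact ⟨x, by simp [T, hx, ← hx']⟩

/-- A vector orthogonal to the range is an eigenvector candidate for `conj z` lying in the domain,
and the lower bound at `conj z` forces it to vanish. -/
theorem range_sub_smul_eq_top (hH : IsSelfAdjoint H) {z : ℂ} (hz : z.im ≠ 0) :
    LinearMap.range (H.toFun - z • H.domain.subtype) = ⊤ := by
  rw [← (isClosed_range_sub_smul hH hz).submodule_topologicalClosure_eq,
    Submodule.topologicalClosure_eq_top_iff, Submodule.eq_bot_iff]
  intro v hv
  have h : ∀ x : H.domain, inner ℂ ((starRingEnd ℂ z) • v) (x : E) = inner ℂ v (H x) := by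
    intro x
    have h1 := Submodule.inner_left_of_mem_orthogonal
      (LinearMap.mem_range_self (H.toFun - z • H.domain.subtype) x) hv
    have h2 : inner ℂ v (H x - z • (x : E)) = 0 := h1
    rw [inner_sub_right, inner_smul_right, sub_eq_zero] at h2
    rw [inner_smul_left, h2, Complex.conj_conj]
  obtain ⟨hv', h1⟩ := exists_apply_eq_of_isSelfAdjoint hH h
  have h2 := abs_im_mul_norm_le hH (starRingEnd ℂ z) ⟨v, hv'⟩
  rw [h1, sub_self, norm_zero, Complex.conj_im, abs_neg] at h2
  have h0 : 0 < |z.im| := abs_pos.2 hz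
  exact norm_eq_zero.1 (le_antisymm (nonpos_of_mul_nonpos_right h2 h0) (norm_nonneg _))

theorem exists_isResolventAt (hH : IsSelfAdjoint H) {z : ℂ} (hz : z.im ≠ 0) :
    ∃ R, IsResolventAt H z R := by
  have h0 : 0 < |z.im| := abs_pos.2 hz
  let L : H.domain →ₗ[ℂ] E := H.toFun - z • H.domain.subtype
  have hL : ∀ x, L x = H x - z • (x : E) := fun x => rfl
  have hinj : Function.Injective L := by
    rw [injective_iff_map_eq_zero]
    intro x hx
    have := abs_im_mul_norm_le hH z x
    rw [← hL, hx, norm_zero] at this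
    exact Subtype.ext (norm_eq_zero.1 (le_antisymm (nonpos_of_mul_nonpos_right this h0)
      (norm_nonneg _)))
  let e := LinearEquiv.ofBijective L ⟨hinj, LinearMap.range_eq_top.1 (range_sub_smul_eq_top hH hz)⟩
  have he : ∀ y, H (e.symm y) - z • (e.symm y : E) = y := fun y => e.apply_symm_apply y
  refine ⟨(H.domain.subtype ∘ₗ e.symm.toLinearMap).mkContinuous |z.im|⁻¹ fun y => ?_, ?_, ?_⟩
  · have := abs_im_mul_norm_le hH z (e.symm y)
    rw [he] at this
    rwa [← div_eq_inv_mul, le_div_iff₀' h0]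
  · exact fun y => ⟨(e.symm y).2, he y⟩
  · intro x
    exact congrArg Subtype.val (e.symm_apply_apply x)

theorem isResolventAt_resolventOp (hH : IsSelfAdjoint H) {z : ℂ} (hz : z.im ≠ 0) :
    IsResolventAt H z (resolventOp H z) := by
  have h := exists_isResolventAt hH hz
  rw [resolventOp, dif_pos h]
  exact h.choose_spec

theorem adjoint_resolventOp (hH : IsSelfAdjoint H) {z : ℂ} (hz : z.im ≠ 0) :
    ContinuousLinearMap.adjoint (resolventOp H z) = resolventOp H (starRingEnd ℂ z) := by
  have hz' : (starRingEnd ℂ z).im ≠ 0 := by simpa using hz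
  symm
  rw [ContinuousLinearMap.eq_adjoint_iff]
  intro x y
  obtain ⟨hx, hx'⟩ := (isResolventAt_resolventOp hH hz').1 x
  obtain ⟨hy, hy'⟩ := (isResolventAt_resolventOp hH hz).1 y
  conv_lhs => rw [← hy']
  conv_rhs => rw [← hx']
  rw [inner_sub_left, inner_sub_right, inner_smul_left, inner_smul_right, Complex.conj_conj,
    inner_symm_of_isSelfAdjoint hH ⟨_, hx⟩ ⟨_, hy⟩]

/-- The second resolvent identity `R_w(H + V) = R_z(H) + R_w(H + V) (w - z - V) R_z(H)`; for `V = 0`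
it is the first one. -/
theorem resolventOp_vadd {H H' : E →ₗ.[ℂ] E} (hH : IsSelfAdjoint H) (hH' : IsSelfAdjoint H')
    {V : E →L[ℂ] E} (h : H' = (V : E →ₗ[ℂ] E) +ᵥ H) {z w : ℂ} (hz : z.im ≠ 0) (hw : w.im ≠ 0) :
    resolventOp H' w = resolventOp H z +
      resolventOp H' w * ((w - z) • 1 - V) * resolventOp H z := by
  ext x
  obtain ⟨hx, hx'⟩ := (isResolventAt_resolventOp hH hz).1 x
  have hd : resolventOp H z x ∈ H'.domain := by rw [h]; exact hx
  have h1 := (isResolventAt_resolventOp hH' hw).2 ⟨_, hd⟩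
  have h2 : H' ⟨_, hd⟩ = V (resolventOp H z x) + H ⟨_, hx⟩ := by
    subst h; rfl
  rw [h2, ← sub_add_cancel (H ⟨_, hx⟩) (z • (resolventOp H z x)), hx'] at h1
  simp only [map_sub, map_add, map_smul] at h1
  change _ = resolventOp H z x +
    resolventOp H' w ((w - z) • resolventOp H z x - V (resolventOp H z x))
  simp only [map_sub, map_smul]
  linear_combination (norm := module) h1

omit [CompleteSpace E] in
theorem zero_vadd_linearPMap (H : E →ₗ.[ℂ] E) : H = ((0 : E →L[ℂ] E) : E →ₗ[ℂ] E) +ᵥ H := by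
  rw [ContinuousLinearMap.toLinearMap_zero, zero_vadd]

theorem resolventOp_sub (hH : IsSelfAdjoint H) {z w : ℂ} (hz : z.im ≠ 0) (hw : w.im ≠ 0) :
    resolventOp H w - resolventOp H z = (w - z) • (resolventOp H w * resolventOp H z) := by
  have := resolventOp_vadd hH hH (zero_vadd_linearPMap H) hz hw
  rw [sub_zero, mul_smul_comm, mul_one, smul_mul_assoc] at this
  exact sub_eq_of_eq_add' this

theorem resolventOp_commute (hH : IsSelfAdjoint H) {z w : ℂ} (hz : z.im ≠ 0) (hw : w.im ≠ 0) :
    Commute (resolventOp H z) (resolventOp H w) := by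
  rcases eq_or_ne w z with rfl | h
  · exact Commute.refl _
  · have h1 := resolventOp_sub hH hz hw
    have h2 := resolventOp_sub hH hw hz
    rw [← neg_sub, h1, ← neg_sub w z, neg_smul, neg_inj] at h2
    exact (smul_right_injective _ (sub_ne_zero.2 h) h2).symm

/-- The first resolvent identity between `z` and `conj z`. It is the source both of the positivity
of `Im T_z` and of the shape of the spectrum of `R_i`. -/
theorem resolventOp_sub_adjoint (hH : IsSelfAdjoint H) {z : ℂ} (hz : z.im ≠ 0) :
    resolventOp H z - ContinuousLinearMap.adjoint (resolventOp H z) =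
      (2 * z.im * Complex.I) •
        (ContinuousLinearMap.adjoint (resolventOp H z) * resolventOp H z) := by
  have hz' : (starRingEnd ℂ z).im ≠ 0 := by simpa using hz
  rw [adjoint_resolventOp hH hz, resolventOp_sub hH hz' hz, (resolventOp_commute hH hz hz').eq]
  congr 1
  apply Complex.ext <;> simp
  ring

end SelfAdjointResolvent

/-! ### The measures of a representation of continuous functions -/

theorem norm_sq_eq_integral {α G : Type*} [MeasurableSpace α] {μ : Measure α}
    [NormedAddCommGroup G] [InnerProductSpace ℂ G] (u : Lp G 2 μ) :
    ‖u‖ ^ 2 = ∫ a, ‖u a‖ ^ 2 ∂μ := by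
  have h : inner ℂ u u = ∫ a, inner ℂ (u a) (u a) ∂μ := L2.inner_def u u
  simp only [inner_self_eq_norm_sq_to_K, Complex.coe_algebraMap, ← Complex.ofReal_pow] at h
  rw [integral_complex_ofReal] at h
  exact_mod_cast h

section Representation

variable {E : Type*} [NormedAddCommGroup E] [InnerProductSpace ℂ E] [CompleteSpace E]
  {X : Type*} [MetricSpace X]

theorem inner_rep_left (Φ : C(X, ℂ) →⋆ₐ[ℂ] (E →L[ℂ] E)) (g : C(X, ℂ)) (f h : E) :
    inner ℂ (Φ g f) h = inner ℂ f (Φ (star g) h) := by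
  rw [map_star, ContinuousLinearMap.star_eq_adjoint, ContinuousLinearMap.adjoint_inner_right]

/-- The inclusion of real in complex continuous functions. -/
def ofRealMap : C(X, ℝ) →ₗ[ℝ] C(X, ℂ) where
  toFun g := ⟨fun x => (g x : ℂ), by fun_prop⟩
  map_add' g h := by ext; simp
  map_smul' c g := by ext; simp

@[simp] theorem ofRealMap_apply (g : C(X, ℝ)) (x : X) : ofRealMap g x = (g x : ℂ) := rfl

theorem star_ofRealMap (g : C(X, ℝ)) : star (ofRealMap g) = ofRealMap g := by
  ext; simp

theorem im_inner_rep_ofRealMap (Φ : C(X, ℂ) →⋆ₐ[ℂ] (E →L[ℂ] E)) (f : E) (g : C(X, ℝ)) :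
    (inner ℂ f (Φ (ofRealMap g) f)).im = 0 := by
  rw [← Complex.conj_eq_iff_im, inner_conj_symm, inner_rep_left, star_ofRealMap]

theorem rep_mul_apply (Φ : C(X, ℂ) →⋆ₐ[ℂ] (E →L[ℂ] E)) (g h : C(X, ℂ)) (f : E) :
    Φ (g * h) f = Φ g (Φ h f) := by
  rw [map_mul]; rfl

/-- The positive functional `g ↦ ⟪f, Φ(g) f⟫`. -/
def repFunctional (Φ : C(X, ℂ) →⋆ₐ[ℂ] (E →L[ℂ] E)) (f : E) :
    CompactlySupportedContinuousMap X ℝ →ₚ[ℝ] ℝ :=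
  PositiveLinearMap.mk₀
    { toFun := fun g => (inner ℂ f (Φ (ofRealMap (g : C(X, ℝ))) f)).re
      map_add' := fun g h => by
        have : ((g + h : CompactlySupportedContinuousMap X ℝ) : C(X, ℝ)) =
          (g : C(X, ℝ)) + (h : C(X, ℝ)) := rfl
        rw [this, map_add, map_add]
        simp
      map_smul' := fun c g => by
        have : ((c • g : CompactlySupportedContinuousMap X ℝ) : C(X, ℝ)) = c • (g : C(X, ℝ)) := rfl
        have h2 : ofRealMap (c • (g : C(X, ℝ))) = (c : ℂ) • ofRealMap (g : C(X, ℝ)) := by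
          ext; simp
        rw [this, h2, map_smul]
        simp }
    (fun g hg => by
      -- Positivity: with `r = √g` the value of the functional at `g` is `‖Φ(r) f‖²`.
      let r : C(X, ℝ) := ⟨fun x => Real.sqrt (g x), by fun_prop⟩
      have h : ofRealMap (g : C(X, ℝ)) = ofRealMap r * ofRealMap r := by
        ext x
        have h0 : 0 ≤ g x := hg x
        simp only [ofRealMap_apply, ContinuousMap.mul_apply, ← Complex.ofReal_mul]
        exact congrArg _ (Real.mul_self_sqrt h0).symm
      change 0 ≤ (inner ℂ f (Φ (ofRealMap (g : C(X, ℝ))) f)).re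
      rw [h, rep_mul_apply, ← star_ofRealMap r, ← inner_rep_left, star_ofRealMap]
      exact inner_self_nonneg (𝕜 := ℂ))

variable [CompactSpace X] [MeasurableSpace X] [BorelSpace X]

/-- The measure `ν` with `⟪f, Φ(g) f⟫ = ∫ g dν`. -/
def repMeasure (Φ : C(X, ℂ) →⋆ₐ[ℂ] (E →L[ℂ] E)) (f : E) : Measure X :=
  RealRMK.rieszMeasure (repFunctional Φ f)

instance (Φ : C(X, ℂ) →⋆ₐ[ℂ] (E →L[ℂ] E)) (f : E) : (repMeasure Φ f).Regular :=
  RealRMK.regular_rieszMeasure _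

instance (Φ : C(X, ℂ) →⋆ₐ[ℂ] (E →L[ℂ] E)) (f : E) : IsFiniteMeasure (repMeasure Φ f) := by
  infer_instance

theorem continuousMap_integrable (μ : Measure X) [IsFiniteMeasure μ] {G : Type*}
    [NormedAddCommGroup G] (g : C(X, G)) : Integrable g μ :=
  g.continuous.integrable_of_hasCompactSupport (HasCompactSupport.of_compactSpace _)

theorem integral_repMeasure_ofReal (Φ : C(X, ℂ) →⋆ₐ[ℂ] (E →L[ℂ] E)) (f : E) (g : C(X, ℝ)) :
    ((∫ x, g x ∂(repMeasure Φ f) : ℝ) : ℂ) = inner ℂ f (Φ (ofRealMap g) f) := by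
  have h := RealRMK.integral_rieszMeasure (repFunctional Φ f)
    (CompactlySupportedContinuousMap.continuousMapEquiv g)
  have h' : ∫ x, g x ∂(repMeasure Φ f) = (inner ℂ f (Φ (ofRealMap g) f)).re := h
  apply Complex.ext
  · rw [Complex.ofReal_re, h']
  · rw [Complex.ofReal_im, im_inner_rep_ofRealMap]

theorem integral_repMeasure (Φ : C(X, ℂ) →⋆ₐ[ℂ] (E →L[ℂ] E)) (f : E) (g : C(X, ℂ)) :
    ∫ x, g x ∂(repMeasure Φ f) = inner ℂ f (Φ g f) := by
  let a : C(X, ℝ) := ⟨fun x => (g x).re, by fun_prop⟩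
  let b : C(X, ℝ) := ⟨fun x => (g x).im, by fun_prop⟩
  have hg : g = ofRealMap a + Complex.I • ofRealMap b := by
    ext x
    simp [a, b, mul_comm Complex.I]
  have h1 := integral_repMeasure_ofReal Φ f a
  have h2 := integral_repMeasure_ofReal Φ f b
  have h3 : inner ℂ f (Φ g f) = inner ℂ f (Φ (ofRealMap a) f) +
      Complex.I * inner ℂ f (Φ (ofRealMap b) f) := by
    conv_lhs => rw [hg]
    rw [map_add, map_smul, ← inner_smul_right, ← inner_add_right]
    rfl
  rw [h3, ← h1, ← h2, ← integral_re_add_im (continuousMap_integrable _ g)]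
  simp [a, b, mul_comm Complex.I]

/-- The integral formula at `star g * g`. It makes `g ↦ Φ(g) f` isometric for the `L²` norm, hence
extendable to all square integrable functions. -/
theorem norm_sq_rep_apply (Φ : C(X, ℂ) →⋆ₐ[ℂ] (E →L[ℂ] E)) (f : E) (g : C(X, ℂ)) :
    ‖Φ g f‖ ^ 2 = ∫ x, ‖g x‖ ^ 2 ∂(repMeasure Φ f) := by
  have h := integral_repMeasure Φ f (star g * g)
  rw [rep_mul_apply, ← inner_rep_left, inner_self_eq_norm_sq_to_K] at h
  have : ∀ x, (star g * g) x = ((‖g x‖ ^ 2 : ℝ) : ℂ) := fun x => by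
    simp [← Complex.normSq_eq_conj_mul_self, Complex.normSq_eq_norm_sq]
  simp_rw [this] at h
  rw [integral_complex_ofReal] at h
  exact Complex.ofReal_injective (by rw [Complex.ofReal_pow]; exact h.symm)

/-- The map `g ↦ Φ(g) f` extended to square integrable functions. -/
def repLp (Φ : C(X, ℂ) →⋆ₐ[ℂ] (E →L[ℂ] E)) (f : E) : Lp ℂ 2 (repMeasure Φ f) →L[ℂ] E :=
  LinearMap.extendOfNorm
    { toFun := fun g : C(X, ℂ) => Φ g f
      map_add' := fun g h => by rw [map_add]; rfl
      map_smul' := fun c g => by rw [map_smul]; rfl }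
    (ContinuousMap.toLp 2 (repMeasure Φ f) ℂ : C(X, ℂ) →L[ℂ] Lp ℂ 2 (repMeasure Φ f)).toLinearMap

theorem norm_toLp_eq_norm_rep_apply (Φ : C(X, ℂ) →⋆ₐ[ℂ] (E →L[ℂ] E)) (f : E) (g : C(X, ℂ)) :
    ‖ContinuousMap.toLp 2 (repMeasure Φ f) ℂ g‖ = ‖Φ g f‖ := by
  rw [← sq_eq_sq₀ (norm_nonneg _) (norm_nonneg _), norm_sq_rep_apply, norm_sq_eq_integral]
  refine integral_congr_ae ?_
  filter_upwards [ContinuousMap.coeFn_toLp (𝕜 := ℂ) (p := 2) (repMeasure Φ f) g] with x hx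
  rw [hx]

theorem denseRange_toLp (μ : Measure X) [IsFiniteMeasure μ] :
    DenseRange (ContinuousMap.toLp 2 μ ℂ : C(X, ℂ) →L[ℂ] Lp ℂ 2 μ) :=
  ContinuousMap.toLp_denseRange ℂ μ ℂ (by norm_num)

theorem repLp_toLp (Φ : C(X, ℂ) →⋆ₐ[ℂ] (E →L[ℂ] E)) (f : E) (g : C(X, ℂ)) :
    repLp Φ f (ContinuousMap.toLp 2 (repMeasure Φ f) ℂ g) = Φ g f :=
  LinearMap.extendOfNorm_eq (f := { toFun := fun g : C(X, ℂ) => Φ g f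
                                    map_add' := fun g h => by rw [map_add]; rfl
                                    map_smul' := fun c g => by rw [map_smul]; rfl })
    (e := (ContinuousMap.toLp 2 (repMeasure Φ f) ℂ :
      C(X, ℂ) →L[ℂ] Lp ℂ 2 (repMeasure Φ f)).toLinearMap) (denseRange_toLp _)
    ⟨1, fun x => by rw [one_mul]; exact (norm_toLp_eq_norm_rep_apply Φ f x).ge⟩ g

theorem norm_repLp (Φ : C(X, ℂ) →⋆ₐ[ℂ] (E →L[ℂ] E)) (f : E) (u : Lp ℂ 2 (repMeasure Φ f)) :
    ‖repLp Φ f u‖ = ‖u‖ := by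
  refine (denseRange_toLp (repMeasure Φ f)).induction_on u
    (isClosed_eq (by fun_prop) (by fun_prop)) fun g => ?_
  rw [repLp_toLp, norm_toLp_eq_norm_rep_apply]

end Representation

/-! ### Square integrable functions of a representation -/

section RepFun

variable {E : Type*} [NormedAddCommGroup E] [InnerProductSpace ℂ E] [CompleteSpace E]
  {X : Type*} [MetricSpace X] [CompactSpace X] [MeasurableSpace X] [BorelSpace X]

theorem memLp_continuousMap (μ : Measure X) [IsFiniteMeasure μ] (g : C(X, ℂ)) : MemLp g 2 μ :=
  ContinuousMap.memLp (p := 2) μ ℂ g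

open Classical in
/-- The vector `k(A) f`, for `k` square integrable with respect to the measure of `f`. -/
def repFun (Φ : C(X, ℂ) →⋆ₐ[ℂ] (E →L[ℂ] E)) (k : X → ℂ) (f : E) : E :=
  if h : MemLp k 2 (repMeasure Φ f) then repLp Φ f h.toLp else 0

variable {Φ : C(X, ℂ) →⋆ₐ[ℂ] (E →L[ℂ] E)} {f h : E} {k k' : X → ℂ}

theorem repFun_of_memLp (hk : MemLp k 2 (repMeasure Φ f)) : repFun Φ k f = repLp Φ f hk.toLp :=
  dif_pos hk

theorem repFun_continuousMap (Φ : C(X, ℂ) →⋆ₐ[ℂ] (E →L[ℂ] E)) (g : C(X, ℂ)) (f : E) :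
    repFun Φ g f = Φ g f := by
  rw [repFun_of_memLp (memLp_continuousMap _ g), ← repLp_toLp]
  congr 1

theorem enorm_repFun_sub (hk : MemLp k 2 (repMeasure Φ f)) (hk' : MemLp k' 2 (repMeasure Φ f)) :
    ‖repFun Φ k f - repFun Φ k' f‖ₑ = eLpNorm (fun x => k x - k' x) 2 (repMeasure Φ f) := by
  rw [repFun_of_memLp hk, repFun_of_memLp hk', ← map_sub, ← MemLp.toLp_sub, ← ofReal_norm,
    norm_repLp, Lp.norm_toLp, ENNReal.ofReal_toReal (hk.sub hk').eLpNorm_ne_top]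
  rfl

theorem enorm_repFun (hk : MemLp k 2 (repMeasure Φ f)) :
    ‖repFun Φ k f‖ₑ = eLpNorm k 2 (repMeasure Φ f) := by
  rw [repFun_of_memLp hk, ← ofReal_norm, norm_repLp, Lp.norm_toLp,
    ENNReal.ofReal_toReal hk.eLpNorm_ne_top]

theorem eLpNorm_two_sq {α G : Type*} [MeasurableSpace α] [NormedAddCommGroup G] (u : α → G)
    (μ : Measure α) : eLpNorm u 2 μ ^ 2 = ∫⁻ x, ‖u x‖ₑ ^ 2 ∂μ := by
  have := eLpNorm_nnreal_pow_eq_lintegral (p := 2) (f := u) (μ := μ) (by norm_num)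
  norm_num at this
  exact_mod_cast this

theorem enorm_repFun_sq (hk : MemLp k 2 (repMeasure Φ f)) :
    ‖repFun Φ k f‖ₑ ^ 2 = ∫⁻ x, ‖k x‖ₑ ^ 2 ∂(repMeasure Φ f) := by
  rw [enorm_repFun hk, eLpNorm_two_sq]

theorem inner_repFun (hk : MemLp k 2 (repMeasure Φ f)) (hk' : MemLp k' 2 (repMeasure Φ f)) :
    inner ℂ (repFun Φ k f) (repFun Φ k' f) =
      ∫ x, (starRingEnd ℂ) (k x) * k' x ∂(repMeasure Φ f) := by
  let V : Lp ℂ 2 (repMeasure Φ f) →ₗᵢ[ℂ] E := ⟨(repLp Φ f).toLinearMap, norm_repLp Φ f⟩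
  have h := V.inner_map_map hk.toLp hk'.toLp
  rw [repFun_of_memLp hk, repFun_of_memLp hk']
  refine h.trans ?_
  rw [L2.inner_def]
  refine integral_congr_ae ?_
  filter_upwards [hk.coeFn_toLp, hk'.coeFn_toLp] with x hx hx'
  rw [hx, hx', RCLike.inner_apply, mul_comm]

theorem exists_seq_continuousMap (μ : Measure X) [IsFiniteMeasure μ] (hk : MemLp k 2 μ) :
    ∃ g : ℕ → C(X, ℂ), Tendsto (fun n => eLpNorm (fun x => g n x - k x) 2 μ) atTop (𝓝 0) := by
  have h : ∀ n : ℕ, ∃ g : C(X, ℂ), eLpNorm (fun x => g x - k x) 2 μ ≤ ((n : ENNReal) + 1)⁻¹ := by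
    intro n
    obtain ⟨g, hg, -⟩ := hk.exists_boundedContinuous_eLpNorm_sub_le (by norm_num)
      (ε := ((n : ENNReal) + 1)⁻¹) (by simp)
    refine ⟨g.toContinuousMap, ?_⟩
    rw [← eLpNorm_neg] at hg
    convert hg using 2
    ext x
    simp
  choose g hg using h
  refine ⟨g, tendsto_of_tendsto_of_tendsto_of_le_of_le tendsto_const_nhds ?_ (fun _ => zero_le)
    hg⟩
  have := (tendsto_add_atTop_iff_nat 1).2 ENNReal.tendsto_inv_nat_nhds_zero
  exact_mod_cast this

theorem tendsto_repFun {k₀ : ℕ → X → ℂ} (hk₀ : ∀ n, MemLp (k₀ n) 2 (repMeasure Φ f))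
    (hk : MemLp k 2 (repMeasure Φ f))
    (h : Tendsto (fun n => eLpNorm (fun x => k₀ n x - k x) 2 (repMeasure Φ f)) atTop (𝓝 0)) :
    Tendsto (fun n => repFun Φ (k₀ n) f) atTop (𝓝 (repFun Φ k f)) := by
  rw [tendsto_iff_edist_tendsto_0]
  simpa only [edist_eq_enorm_sub, enorm_repFun_sub (hk₀ _) hk] using h

/-- The dominating measure `μ` allows one sequence of continuous functions to serve several vectors
at once: take for `μ` the sum of their measures. Linearity and symmetry pass from `Φ(g)` to `k` in
this way. -/
theorem tendsto_rep_apply {g : ℕ → C(X, ℂ)} {μ : Measure X} (hμ : repMeasure Φ f ≤ μ)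
    (hk : MemLp k 2 (repMeasure Φ f))
    (h : Tendsto (fun n => eLpNorm (fun x => g n x - k x) 2 μ) atTop (𝓝 0)) :
    Tendsto (fun n => Φ (g n) f) atTop (𝓝 (repFun Φ k f)) := by
  have := tendsto_repFun (fun n => memLp_continuousMap _ (g n)) hk
    (tendsto_of_tendsto_of_tendsto_of_le_of_le tendsto_const_nhds h (fun _ => zero_le)
      fun _ => eLpNorm_mono_measure _ hμ)
  simpa only [repFun_continuousMap] using this

theorem memLp_mul_continuousMap {μ : Measure X} [IsFiniteMeasure μ] (g : C(X, ℂ))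
    (hk : MemLp k 2 μ) : MemLp (fun x => g x * k x) 2 μ :=
  hk.of_le_mul (c := ‖g‖) (g.continuous.aestronglyMeasurable.mul hk.1)
    (ae_of_all _ fun x => by rw [norm_mul]; gcongr; exact g.norm_coe_le_norm x)

/-- For continuous `k` this is multiplicativity of `Φ`; multiplication by the bounded function `g`
respects `L²` approximation of `k`. -/
theorem rep_apply_repFun (g : C(X, ℂ)) (hk : MemLp k 2 (repMeasure Φ f)) :
    Φ g (repFun Φ k f) = repFun Φ (fun x => g x * k x) f := by
  obtain ⟨g₀, hg₀⟩ := exists_seq_continuousMap (repMeasure Φ f) hk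
  have h1 := ((Φ g).continuous.tendsto _).comp (tendsto_rep_apply le_rfl hk hg₀)
  have h2 : Tendsto (fun n => eLpNorm (fun x => (g * g₀ n) x - g x * k x) 2 (repMeasure Φ f))
      atTop (𝓝 0) := by
    have h3 : Tendsto (fun n => (‖g‖₊ : ENNReal) *
        eLpNorm (fun x => g₀ n x - k x) 2 (repMeasure Φ f)) atTop (𝓝 0) := by
      simpa using ENNReal.Tendsto.const_mul hg₀ (Or.inr ENNReal.coe_ne_top) (a := (‖g‖₊ : ENNReal))
    refine tendsto_of_tendsto_of_tendsto_of_le_of_le tendsto_const_nhds h3 (fun _ => zero_le)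
      fun n => ?_
    refine (eLpNorm_le_nnreal_smul_eLpNorm_of_ae_le_mul (c := ‖g‖₊)
      (ae_of_all _ fun x => ?_) 2).trans (le_of_eq rfl)
    rw [ContinuousMap.mul_apply, ← mul_sub, nnnorm_mul]
    gcongr
    exact g.norm_coe_le_norm x
  have h4 := tendsto_rep_apply le_rfl (memLp_mul_continuousMap g hk) h2
  simp only [rep_mul_apply] at h4
  exact tendsto_nhds_unique h1 h4

/-- Pairing `k(A) f` with `Φ(g) k(A) f` gives `∫ g |k|²`, and a finite Borel measure is determined
by the integrals of continuous functions. -/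
theorem repMeasure_repFun (hk : MemLp k 2 (repMeasure Φ f)) (hm : Measurable k) :
    repMeasure Φ (repFun Φ k f) = (repMeasure Φ f).withDensity (fun x => ‖k x‖ₑ ^ 2) := by
  have hfin : ∫⁻ x, ‖k x‖ₑ ^ 2 ∂(repMeasure Φ f) ≠ ⊤ := by
    rw [← enorm_repFun_sq hk]
    exact ENNReal.pow_ne_top enorm_ne_top
  have : IsFiniteMeasure ((repMeasure Φ f).withDensity (fun x => ‖k x‖ₑ ^ 2)) :=
    isFiniteMeasure_withDensity hfin
  refine ext_of_forall_integral_eq_of_IsFiniteMeasure fun g => ?_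
  apply Complex.ofReal_injective
  rw [← integral_complex_ofReal, ← integral_complex_ofReal]
  have h1 := integral_repMeasure Φ (repFun Φ k f) (ofRealMap g.toContinuousMap)
  rw [rep_apply_repFun _ hk, inner_repFun hk (memLp_mul_continuousMap _ hk)] at h1
  refine h1.trans ?_
  have h2 := integral_withDensity_eq_integral_toReal_smul (μ := repMeasure Φ f)
    (f := fun x => ‖k x‖ₑ ^ 2) (by fun_prop)
    (ae_of_all _ fun x => ENNReal.pow_lt_top enorm_lt_top) (fun x => ((g x : ℝ) : ℂ))
  rw [h2]
  refine integral_congr_ae (ae_of_all _ fun x => ?_)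
  simp only [ofRealMap_apply, ENNReal.toReal_pow, toReal_enorm]
  rw [Complex.real_smul, mul_left_comm, ← Complex.normSq_eq_conj_mul_self,
    Complex.normSq_eq_norm_sq, mul_comm]
  rfl

/-- By the density formula, `‖u‖` in `L²` of the measure of `k(A) f` equals `‖u k‖` in `L²` of the
measure of `f`. Continuous approximants of `k'` in the first space therefore give approximants of
`k' k` in the second. -/
theorem repFun_repFun (hk : MemLp k 2 (repMeasure Φ f)) (hm : Measurable k)
    (hk' : MemLp k' 2 (repMeasure Φ (repFun Φ k f))) (hm' : Measurable k') :
    repFun Φ k' (repFun Φ k f) = repFun Φ (fun x => k' x * k x) f := by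
  have key : ∀ u : X → ℂ, Measurable u → (eLpNorm u 2 (repMeasure Φ (repFun Φ k f))) =
      eLpNorm (fun x => u x * k x) 2 (repMeasure Φ f) := by
    intro u hu
    refine (ENNReal.pow_right_strictMono two_ne_zero).injective ?_
    rw [eLpNorm_two_sq, eLpNorm_two_sq, repMeasure_repFun hk hm,
      lintegral_withDensity_eq_lintegral_mul _ (by fun_prop) (by fun_prop)]
    refine lintegral_congr fun x => ?_
    rw [Pi.mul_apply, enorm_mul, mul_pow, mul_comm]
  have hkk : MemLp (fun x => k' x * k x) 2 (repMeasure Φ f) :=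
    ⟨(hm'.mul hm).aestronglyMeasurable, by rw [← key k' hm']; exact hk'.2⟩
  obtain ⟨g, hg⟩ := exists_seq_continuousMap _ hk'
  have h1 := tendsto_rep_apply le_rfl hk' hg
  simp only [rep_apply_repFun _ hk] at h1
  refine tendsto_nhds_unique h1 (tendsto_repFun (fun n => memLp_mul_continuousMap _ hk) hkk ?_)
  convert hg using 2 with n
  refine Eq.trans ?_ (key _ ((g n).continuous.measurable.sub hm')).symm
  congr 1
  ext x
  simp only [Pi.sub_apply]
  ring

omit [MetricSpace X] [CompactSpace X] [BorelSpace X] in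
theorem memLp_of_norm_le_one (μ : Measure X) [IsFiniteMeasure μ] (hm : Measurable k)
    (hb : ∀ x, ‖k x‖ ≤ 1) : MemLp k 2 μ :=
  MemLp.of_bound hm.aestronglyMeasurable 1 (ae_of_all _ hb)

/-- The bound on `k` ensures square integrability for the measures of all three vectors, so one
approximating sequence works for their sum. -/
theorem repFun_add (hm : Measurable k) (hb : ∀ x, ‖k x‖ ≤ 1) (f h : E) :
    repFun Φ k (f + h) = repFun Φ k f + repFun Φ k h := by
  obtain ⟨g, hg⟩ := exists_seq_continuousMap
    (repMeasure Φ f + repMeasure Φ h + repMeasure Φ (f + h)) (memLp_of_norm_le_one _ hm hb)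
  have h1 := tendsto_rep_apply (f := f) (by rw [add_assoc]; exact Measure.le_add_right le_rfl)
    (memLp_of_norm_le_one _ hm hb) hg
  have h2 := tendsto_rep_apply (f := h)
    (Measure.le_add_right (Measure.le_add_left le_rfl))
    (memLp_of_norm_le_one _ hm hb) hg
  have h3 := tendsto_rep_apply (f := f + h) (Measure.le_add_left le_rfl)
    (memLp_of_norm_le_one _ hm hb) hg
  simp only [map_add] at h3
  exact tendsto_nhds_unique h3 (h1.add h2)

theorem repFun_smul (hm : Measurable k) (hb : ∀ x, ‖k x‖ ≤ 1) (c : ℂ) (f : E) :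
    repFun Φ k (c • f) = c • repFun Φ k f := by
  obtain ⟨g, hg⟩ := exists_seq_continuousMap
    (repMeasure Φ f + repMeasure Φ (c • f)) (memLp_of_norm_le_one _ hm hb)
  have h1 := tendsto_rep_apply (f := f) (Measure.le_add_right le_rfl)
    (memLp_of_norm_le_one _ hm hb) hg
  have h2 := tendsto_rep_apply (f := c • f) (Measure.le_add_left le_rfl)
    (memLp_of_norm_le_one _ hm hb) hg
  simp only [map_smul] at h2
  exact tendsto_nhds_unique h2 (h1.const_smul c)

theorem inner_repFun_right (hm : Measurable k) (hb : ∀ x, ‖k x‖ ≤ 1) (f h : E) :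
    inner ℂ h (repFun Φ k f) = inner ℂ (repFun Φ (fun x => (starRingEnd ℂ) (k x)) h) f := by
  obtain ⟨g, hg⟩ := exists_seq_continuousMap
    (repMeasure Φ f + repMeasure Φ h) (memLp_of_norm_le_one _ hm hb)
  have h1 := tendsto_rep_apply (f := f) (Measure.le_add_right le_rfl)
    (memLp_of_norm_le_one _ hm hb) hg
  have hg' : Tendsto (fun n => eLpNorm (fun x => (star (g n)) x - (starRingEnd ℂ) (k x)) 2
      (repMeasure Φ f + repMeasure Φ h)) atTop (𝓝 0) := by
    convert hg using 2 with n
    refine eLpNorm_congr_norm_ae (ae_of_all _ fun x => ?_)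
    rw [ContinuousMap.star_apply, ← starRingEnd_apply, ← map_sub, RCLike.norm_conj]
  have h2 := tendsto_rep_apply (f := h) (Measure.le_add_left le_rfl)
    (memLp_of_norm_le_one _ (Complex.continuous_conj.measurable.comp hm)
      (fun x => (RCLike.norm_conj (k x)).trans_le (hb x))) hg'
  have h3 := (h2.inner (𝕜 := ℂ) (tendsto_const_nhds (x := f)))
  simp only [inner_rep_left, star_star] at h3
  exact tendsto_nhds_unique ((tendsto_const_nhds (x := h)).inner h1) h3

end RepFun

/-! ### Scalar measures of a projection-valued measure -/

section ScalarMeasure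

variable {E : Type*} [NormedAddCommGroup E] [InnerProductSpace ℂ E] [CompleteSpace E]

theorem ProjMeasure.scalar_apply (P : ProjMeasure E) (f : E) {s : Set ℝ} (hs : MeasurableSet s) :
    P.scalar f s = ‖P.proj s f‖ₑ ^ 2 := by
  rw [ProjMeasure.scalar, Measure.ofMeasurable_apply s hs, ENNReal.ofReal_pow (norm_nonneg _),
    ofReal_norm]

theorem ProjMeasure.scalar_univ (P : ProjMeasure E) (f : E) :
    P.scalar f Set.univ = ‖f‖ₑ ^ 2 := by
  rw [P.scalar_apply f MeasurableSet.univ, P.proj_univ]; rfl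

instance (P : ProjMeasure E) (f : E) : IsFiniteMeasure (P.scalar f) :=
  ⟨by rw [P.scalar_univ]; exact ENNReal.pow_lt_top enorm_lt_top⟩

end ScalarMeasure

/-! ### Spectral projections of a representation -/

section RepProj

variable {E : Type*} [NormedAddCommGroup E] [InnerProductSpace ℂ E] [CompleteSpace E]
  {X : Type*} [MetricSpace X] [CompactSpace X] [MeasurableSpace X] [BorelSpace X]
  {Φ : C(X, ℂ) →⋆ₐ[ℂ] (E →L[ℂ] E)} {f : E} {k k' : X → ℂ} {s t : Set X}

theorem repFun_congr_ae (h : k =ᵐ[repMeasure Φ f] k') : repFun Φ k f = repFun Φ k' f := by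
  by_cases hk : MemLp k 2 (repMeasure Φ f)
  · have hk' := (memLp_congr_ae h).1 hk
    rw [repFun_of_memLp hk, repFun_of_memLp hk', MemLp.toLp_congr hk hk' h]
  · have hk' := (memLp_congr_ae h).not.1 hk
    rw [repFun, repFun, dif_neg hk, dif_neg hk']

omit [MetricSpace X] [CompactSpace X] [BorelSpace X] in
theorem measurable_indicator_one (hs : MeasurableSet s) :
    Measurable (s.indicator (1 : X → ℂ)) := measurable_one.indicator hs

omit [MetricSpace X] [CompactSpace X] [MeasurableSpace X] [BorelSpace X] in
theorem norm_indicator_one_le (s : Set X) (x : X) : ‖s.indicator (1 : X → ℂ) x‖ ≤ 1 := by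
  by_cases h : x ∈ s <;> simp [h]

theorem enorm_repFun_indicator_sq (Φ : C(X, ℂ) →⋆ₐ[ℂ] (E →L[ℂ] E)) (hs : MeasurableSet s) (f : E) :
    ‖repFun Φ (s.indicator 1) f‖ₑ ^ 2 = repMeasure Φ f s := by
  rw [enorm_repFun_sq (memLp_of_norm_le_one _ (measurable_indicator_one hs)
    (norm_indicator_one_le s)), ← lintegral_indicator_one hs]
  refine lintegral_congr fun x => ?_
  by_cases h : x ∈ s <;> simp [h]

theorem repFun_one (Φ : C(X, ℂ) →⋆ₐ[ℂ] (E →L[ℂ] E)) (f : E) : repFun Φ 1 f = f := by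
  have := repFun_continuousMap Φ 1 f
  rw [map_one] at this
  exact this

theorem repFun_indicator_repFun_indicator (Φ : C(X, ℂ) →⋆ₐ[ℂ] (E →L[ℂ] E)) (hs : MeasurableSet s)
    (ht : MeasurableSet t) (f : E) :
    repFun Φ (s.indicator 1) (repFun Φ (t.indicator 1) f) = repFun Φ ((s ∩ t).indicator 1) f := by
  rw [repFun_repFun (memLp_of_norm_le_one _ (measurable_indicator_one ht)
    (norm_indicator_one_le t)) (measurable_indicator_one ht)
    (memLp_of_norm_le_one _ (measurable_indicator_one hs)
    (norm_indicator_one_le s)) (measurable_indicator_one hs), Set.inter_indicator_one]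
  rfl

theorem inner_repFun_indicator (Φ : C(X, ℂ) →⋆ₐ[ℂ] (E →L[ℂ] E)) (hs : MeasurableSet s)
    (f h : E) : inner ℂ h (repFun Φ (s.indicator 1) f) =
      inner ℂ (repFun Φ (s.indicator 1) h) f := by
  rw [inner_repFun_right (measurable_indicator_one hs) (norm_indicator_one_le s)]
  congr 2
  ext x
  by_cases h : x ∈ s <;> simp [h]

/-- The spectral projection attached to a measurable set by a representation. -/
def repProj (Φ : C(X, ℂ) →⋆ₐ[ℂ] (E →L[ℂ] E)) (hs : MeasurableSet s) : E →L[ℂ] E :=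
  LinearMap.mkContinuous
    { toFun := repFun Φ (s.indicator 1)
      map_add' := repFun_add (measurable_indicator_one hs) (norm_indicator_one_le s)
      map_smul' := repFun_smul (measurable_indicator_one hs) (norm_indicator_one_le s) } 1
    fun f => by
      have h := repFun_one Φ f
      rw [one_mul, ← ENNReal.ofReal_le_ofReal_iff (norm_nonneg _), ofReal_norm, ofReal_norm,
        ← ENNReal.pow_le_pow_left_iff two_ne_zero]
      -- Writing `f` as the indicator of the whole space applied to `f` turns both squared norms
      -- into values of one measure.
      conv_rhs => rw [← h, ← Set.indicator_univ (1 : X → ℂ)]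
      refine (enorm_repFun_indicator_sq Φ hs f).trans_le ?_
      rw [enorm_repFun_indicator_sq Φ MeasurableSet.univ]
      exact measure_mono (Set.subset_univ s)

theorem repProj_apply (Φ : C(X, ℂ) →⋆ₐ[ℂ] (E →L[ℂ] E)) (hs : MeasurableSet s) (f : E) :
    repProj Φ hs f = repFun Φ (s.indicator 1) f := rfl

theorem repFun_indicator_add_diff (Φ : C(X, ℂ) →⋆ₐ[ℂ] (E →L[ℂ] E)) (hs : MeasurableSet s)
    (ht : MeasurableSet t) (hst : s ⊆ t) (f : E) :
    repFun Φ (t.indicator 1) f - repFun Φ (s.indicator 1) f =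
      repFun Φ ((t \ s).indicator 1) f := by
  have h1 := fun {s : Set X} (hs : MeasurableSet s) => memLp_of_norm_le_one (repMeasure Φ f)
    (measurable_indicator_one hs) (norm_indicator_one_le s)
  rw [repFun_of_memLp (h1 hs), repFun_of_memLp (h1 ht), repFun_of_memLp (h1 (ht.diff hs)),
    ← map_sub, ← MemLp.toLp_sub]
  congr 2
  ext x
  by_cases hx : x ∈ s
  · simp [hx, hst hx]
  · by_cases hx' : x ∈ t <;> simp [hx, hx']

/-- Finite sums collapse to indicators of finite unions. The squared norm of the remainder is the
measure of what is left, which tends to zero by continuity from above. -/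
theorem hasSum_repFun_indicator (Φ : C(X, ℂ) →⋆ₐ[ℂ] (E →L[ℂ] E)) {s : ℕ → Set X}
    (hs : ∀ n, MeasurableSet (s n)) (hd : Pairwise (Function.onFun Disjoint s)) (f : E) :
    HasSum (fun n => repFun Φ ((s n).indicator 1) f) (repFun Φ ((⋃ n, s n).indicator 1) f) := by
  have hfin : ∀ S : Finset ℕ, ∑ n ∈ S, repFun Φ ((s n).indicator 1) f =
      repFun Φ ((⋃ n ∈ S, s n).indicator 1) f := by
    intro S
    induction S using Finset.induction_on with
    | empty =>
      have := repFun_continuousMap Φ 0 f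
      rw [map_zero] at this
      simpa using! this.symm
    | insert n S hn ih =>
      have hm : MeasurableSet (⋃ n ∈ S, s n) := S.measurableSet_biUnion fun n _ => hs n
      rw [Finset.sum_insert hn, ih, Finset.set_biUnion_insert]
      have := repFun_indicator_add_diff Φ hm ((hs n).union hm) Set.subset_union_right f
      rw [Set.union_sdiff_cancel_right] at this
      · rw [← this, sub_add_cancel]
      · refine Set.disjoint_iff.1 ?_
        exact Set.disjoint_iUnion₂_right.2 fun m hm => hd (by rintro rfl; exact hn hm)
  have hU : MeasurableSet (⋃ n, s n) := MeasurableSet.iUnion hs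
  rw [HasSum]
  simp only [SummationFilter.unconditional_filter, hfin]
  rw [tendsto_iff_edist_tendsto_0]
  have h1 : ∀ S : Finset ℕ, edist (repFun Φ ((⋃ n ∈ S, s n).indicator 1) f)
      (repFun Φ ((⋃ n, s n).indicator 1) f) =
        (repMeasure Φ f ((⋃ n, s n) \ ⋃ n ∈ S, s n)) ^ (1 / 2 : ℝ) := by
    intro S
    have hm : MeasurableSet (⋃ n ∈ S, s n) := S.measurableSet_biUnion fun n _ => hs n
    rw [edist_comm, edist_eq_enorm_sub, repFun_indicator_add_diff Φ hm hU
      (Set.iUnion₂_subset fun n _ => Set.subset_iUnion s n),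
      ← enorm_repFun_indicator_sq Φ (hU.diff hm), ← ENNReal.rpow_natCast, ← ENNReal.rpow_mul]
    norm_num
  simp only [h1]
  have h2 : Tendsto (fun S : Finset ℕ => repMeasure Φ f ((⋃ n, s n) \ ⋃ n ∈ S, s n)) atTop
      (𝓝 0) := by
    have := tendsto_measure_iInter_atTop (μ := repMeasure Φ f)
      (s := fun S : Finset ℕ => (⋃ n, s n) \ ⋃ n ∈ S, s n)
      (fun S => (hU.diff (S.measurableSet_biUnion fun n _ => hs n)).nullMeasurableSet)
      (fun S T hST => Set.sdiff_subset_sdiff_right (Set.biUnion_subset_biUnion_left hST))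
      ⟨∅, measure_ne_top _ _⟩
    have h3 : ⋂ S : Finset ℕ, ((⋃ n, s n) \ ⋃ n ∈ S, s n) = ∅ := by
      ext x
      simp only [Set.mem_iInter, Set.mem_sdiff, Set.mem_iUnion, Set.mem_empty_iff_false, iff_false,
        not_forall]
      by_cases hx : ∃ n, x ∈ s n
      · obtain ⟨n, hn⟩ := hx
        exact ⟨{n}, fun h => h.2 ⟨n, by simp, hn⟩⟩
      · exact ⟨∅, fun h => hx h.1⟩
    rwa [h3, measure_empty] at this
  have := (ENNReal.continuous_rpow_const (y := (1 / 2 : ℝ))).tendsto 0 |>.comp h2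
  simpa using! this

open Classical in
/-- The projection-valued measure on the line obtained from a representation of the continuous
functions on `X` and a measurable coordinate on `X`. -/
def repProjMeasure (Φ : C(X, ℂ) →⋆ₐ[ℂ] (E →L[ℂ] E)) {c : X → ℝ} (hc : Measurable c) :
    ProjMeasure E where
  proj s := if hs : MeasurableSet s then repProj Φ (hc hs) else 0
  isStarProjection s hs := by
    rw [dif_pos hs]
    refine ⟨?_, ?_⟩
    · ext f
      have := repFun_indicator_repFun_indicator Φ (hc hs) (hc hs) f
      rwa [Set.inter_self] at this
    · rw [IsSelfAdjoint, ContinuousLinearMap.star_eq_adjoint]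
      symm
      rw [ContinuousLinearMap.eq_adjoint_iff]
      exact fun f h => (inner_repFun_indicator Φ (hc hs) h f).symm
  proj_univ := by
    rw [dif_pos MeasurableSet.univ]
    ext f
    rw [repProj_apply, Set.preimage_univ, Set.indicator_univ, repFun_one]
    rfl
  proj_inter s t hs ht := by
    rw [dif_pos hs, dif_pos ht, dif_pos (hs.inter ht)]
    ext f
    exact (repFun_indicator_repFun_indicator Φ (hc hs) (hc ht) f).symm
  hasSum s hs hd f := by
    rw [dif_pos (MeasurableSet.iUnion hs)]
    simp only [dif_pos (hs _), repProj_apply, Set.preimage_iUnion]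
    exact hasSum_repFun_indicator Φ (fun n => hc (hs n))
      (fun i j hij => (hd hij).preimage c) f

theorem repProjMeasure_proj (Φ : C(X, ℂ) →⋆ₐ[ℂ] (E →L[ℂ] E)) {c : X → ℝ} (hc : Measurable c)
    {s : Set ℝ} (hs : MeasurableSet s) (f : E) :
    (repProjMeasure Φ hc).proj s f = repFun Φ ((c ⁻¹' s).indicator 1) f := by
  simp only [repProjMeasure, dif_pos hs, repProj_apply]

theorem repProjMeasure_scalar (Φ : C(X, ℂ) →⋆ₐ[ℂ] (E →L[ℂ] E)) {c : X → ℝ} (hc : Measurable c)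
    (f : E) : (repProjMeasure Φ hc).scalar f = (repMeasure Φ f).map c := by
  ext s hs
  rw [ProjMeasure.scalar_apply _ _ hs, repProjMeasure_proj Φ hc hs,
    enorm_repFun_indicator_sq Φ (hc hs), Measure.map_apply hc hs]

end RepProj

/-! ### The spectral theorem -/

section SpectralTheorem

variable {E : Type*} [NormedAddCommGroup E] [InnerProductSpace ℂ E] [CompleteSpace E]
  {H : E →ₗ.[ℂ] E}

theorem isStarNormal_resolventOp (hH : IsSelfAdjoint H) {z : ℂ} (hz : z.im ≠ 0) :
    IsStarNormal (resolventOp H z) := by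
  refine ⟨?_⟩
  rw [ContinuousLinearMap.star_eq_adjoint, adjoint_resolventOp hH hz]
  exact resolventOp_commute hH (by simpa using hz) hz

/-- The spectrum of the resolvent at `i`. -/
abbrev resSpec (H : E →ₗ.[ℂ] E) : Set ℂ := spectrum ℂ (resolventOp H Complex.I)

instance (H : E →ₗ.[ℂ] E) : CompactSpace (resSpec H) := spectrum.instCompactSpace _

/-- The continuous functional calculus of the resolvent at `i`. -/
def resolventCalculus (hH : IsSelfAdjoint H) :
    C(resSpec H, ℂ) →⋆ₐ[ℂ] (E →L[ℂ] E) :=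
  cfcHom (isStarNormal_resolventOp hH (z := Complex.I) (by simp))

/-- The identity function on the spectrum of the resolvent at `i`. -/
def specId (H : E →ₗ.[ℂ] E) : C(resSpec H, ℂ) :=
  ⟨fun w => w, by fun_prop⟩

theorem resolventCalculus_specId (hH : IsSelfAdjoint H) :
    resolventCalculus hH (specId H) = resolventOp H Complex.I :=
  cfcHom_id _

/-- The relation `R - R* = 2i R* R` passes to functions on the spectrum because the functional
calculus is injective. Thus the spectrum lies on the circle formed by the points `1 / (x - i)`, `x`
real, together with `0`, the image of infinity. -/
theorem im_eq_norm_sq_of_mem_spectrum (hH : IsSelfAdjoint H)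
    (w : resSpec H) : (w : ℂ).im = ‖(w : ℂ)‖ ^ 2 := by
  have h := resolventOp_sub_adjoint hH (z := Complex.I) (by simp)
  have h1 : resolventCalculus hH (specId H - star (specId H) -
      (2 * Complex.I) • (star (specId H) * specId H)) = 0 := by
    rw [map_sub, map_sub, map_smul, map_mul, map_star, resolventCalculus_specId,
      ContinuousLinearMap.star_eq_adjoint, h]
    simp
  have h2 := (cfcHom_injective (isStarNormal_resolventOp hH (z := Complex.I) (by simp)))
    (h1.trans (map_zero (resolventCalculus hH)).symm)
  have h3 := congrArg (fun g : C(resSpec H, ℂ) => g w) h2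
  simp only [specId, ContinuousMap.sub_apply, ContinuousMap.coe_mk, ContinuousMap.star_apply,
    ContinuousMap.smul_apply, ContinuousMap.mul_apply, ContinuousMap.zero_apply, smul_eq_mul,
    RCLike.star_def, ← Complex.normSq_eq_conj_mul_self] at h3
  have h4 := congrArg Complex.im h3
  simp only [Complex.sub_im, Complex.conj_im, Complex.mul_im, Complex.ofReal_re,
    Complex.ofReal_im, Complex.zero_im] at h4
  rw [← Complex.normSq_eq_norm_sq]
  simp at h4
  linarith

/-- The spectral variable of `H` as a function on the spectrum of its resolvent at `i`. -/
def specCoord (H : E →ₗ.[ℂ] E) (w : resSpec H) : ℝ :=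
  ((w : ℂ)⁻¹).re

omit [CompleteSpace E] in
theorem measurable_specCoord (H : E →ₗ.[ℂ] E) : Measurable (specCoord H) :=
  Complex.measurable_re.comp (measurable_inv.comp measurable_subtype_coe)

omit [CompleteSpace E] in
theorem specCoord_mul_norm_sq (w : resSpec H) :
    specCoord H w * ‖(w : ℂ)‖ ^ 2 = (w : ℂ).re := by
  rw [specCoord, Complex.inv_re, ← Complex.normSq_eq_norm_sq]
  rcases eq_or_ne (w : ℂ) 0 with h | h
  · simp [h]
  · exact div_mul_cancel₀ _ (Complex.normSq_eq_zero.not.2 h)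

theorem inv_coe_eq (hH : IsSelfAdjoint H) (w : resSpec H)
    (h : (w : ℂ) ≠ 0) : (w : ℂ)⁻¹ = specCoord H w - Complex.I := by
  apply Complex.ext
  · simp [specCoord]
  · rw [Complex.inv_im, im_eq_norm_sq_of_mem_spectrum hH, Complex.normSq_eq_norm_sq]
    have : ‖(w : ℂ)‖ ^ 2 ≠ 0 := by simpa using h
    simp [this]

/-- The spectral measure of `H` constructed from its resolvent. -/
def resolventProjMeasure (hH : IsSelfAdjoint H) : ProjMeasure E :=
  repProjMeasure (resolventCalculus hH) (measurable_specCoord H)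

/-- The indicator of `{0}` produces vectors in the kernel of `R_i`, which is trivial. So the junk
value of `specCoord` at `0` carries no mass. -/
theorem ae_coe_ne_zero (hH : IsSelfAdjoint H) (f : E) :
    ∀ᵐ w : resSpec H ∂(repMeasure (resolventCalculus hH) f), (w : ℂ) ≠ 0 := by
  let s : Set (resSpec H) := {w | (w : ℂ) = 0}
  have hs : MeasurableSet s := measurable_subtype_coe (measurableSet_singleton 0)
  have h1 := rep_apply_repFun (Φ := resolventCalculus hH) (specId H)
    (memLp_of_norm_le_one (repMeasure (resolventCalculus hH) f)
    (measurable_indicator_one hs) (norm_indicator_one_le s))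
  have h2 : (fun x => specId H x * s.indicator (1 : resSpec H → ℂ) x) =
      ((0 : C(resSpec H, ℂ)) : resSpec H → ℂ) := by
    ext x
    by_cases hx : x ∈ s
    · have : (x : ℂ) = 0 := hx
      simp [specId, this]
    · simp [hx]
  rw [h2, repFun_continuousMap, map_zero, resolventCalculus_specId,
    zero_apply] at h1
  obtain ⟨hd, h3⟩ := (isResolventAt_resolventOp hH (z := Complex.I) (by simp)).1
    (repFun (resolventCalculus hH) (s.indicator 1) f)
  have h4 : (⟨_, hd⟩ : H.domain) = 0 := Subtype.ext h1
  rw [h4, LinearPMap.map_zero, h1] at h3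
  have h5 := enorm_repFun_indicator_sq (resolventCalculus hH) hs f
  rw [← h3] at h5
  rw [ae_iff]
  simpa using h5.symm

/-- The function `w / (1 - (z - i) w)` equals `1 / (x - z)` for `w = 1 / (x - i)` and, unlike `x`
itself, is continuous at `w = 0`. It represents `R_z` because `R_z (1 - (z - i) R_i) = R_i`. -/
theorem resolventOp_eq_resolventCalculus (hH : IsSelfAdjoint H) {z : ℂ} (hz : z.im ≠ 0) :
    ∃ g : C(resSpec H, ℂ), resolventOp H z = resolventCalculus hH g ∧
      ∀ w : resSpec H, (w : ℂ) ≠ 0 → g w = ((specCoord H w : ℂ) - z)⁻¹ := by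
  have hne : ∀ w : resSpec H, (1 - (z - Complex.I) * (w : ℂ)) ≠ 0 := by
    intro w hw
    have h0 : (w : ℂ) ≠ 0 := by rintro h; simp [h] at hw
    have h1 : (w : ℂ)⁻¹ - (z - Complex.I) = 0 := by
      have := congrArg (fun u => (w : ℂ)⁻¹ * u) hw
      simp only [mul_sub, mul_one, mul_zero] at this
      rw [← this]
      field_simp
    rw [inv_coe_eq hH w h0] at h1
    have := congrArg Complex.im h1
    simp at this
    exact hz this
  let d : C(resSpec H, ℂ) :=
    ⟨fun w => 1 - (z - Complex.I) * (w : ℂ), by fun_prop⟩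
  let d' : C(resSpec H, ℂ) :=
    ⟨fun w => (1 - (z - Complex.I) * (w : ℂ))⁻¹, by
      refine Continuous.inv₀ (by fun_prop) hne⟩
  have hdd : d * d' = 1 := by
    ext w
    exact mul_inv_cancel₀ (hne w)
  have hd : d = 1 - (z - Complex.I) • specId H := by
    ext w
    simp [d, specId]
  have h1 : resolventOp H z * resolventCalculus hH d = resolventOp H Complex.I := by
    have := resolventOp_sub hH (z := Complex.I) (by simp) hz
    rw [hd, map_sub, map_one, map_smul, resolventCalculus_specId, mul_sub, mul_one,
      mul_smul_comm, ← this, sub_sub_cancel]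
  refine ⟨specId H * d', ?_, fun w hw => ?_⟩
  · rw [map_mul, resolventCalculus_specId, ← h1, mul_assoc, ← map_mul, hdd, map_one, mul_one]
  · change (w : ℂ) * (1 - (z - Complex.I) * (w : ℂ))⁻¹ = _
    have h3 : (specCoord H w : ℂ) - z = (w : ℂ)⁻¹ - (z - Complex.I) := by
      rw [inv_coe_eq hH w hw]; ring
    have h4 := hne w
    rw [h3, ← inv_inv (w : ℂ), ← mul_inv, inv_inv]
    congr 1
    field_simp

theorem inner_resolventOp_eq_integral (hH : IsSelfAdjoint H) {z : ℂ} (hz : z.im ≠ 0) (f : E) :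
    inner ℂ f (resolventOp H z f) =
      ∫ x : ℝ, ((x : ℂ) - z)⁻¹ ∂((resolventProjMeasure hH).scalar f) := by
  obtain ⟨g, hg, hg'⟩ := resolventOp_eq_resolventCalculus hH hz
  rw [resolventProjMeasure, repProjMeasure_scalar, hg, ← integral_repMeasure,
    integral_map (measurable_specCoord H).aemeasurable (by
      refine Measurable.aestronglyMeasurable (by fun_prop))]
  refine integral_congr_ae ?_
  filter_upwards [ae_coe_ne_zero hH f] with w hw using hg' w hw

theorem lintegral_resolventProjMeasure_scalar (hH : IsSelfAdjoint H) (h : E) {u : ℝ → ENNReal}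
    (hu : Measurable u) :
    ∫⁻ x, u x ∂((resolventProjMeasure hH).scalar (resolventOp H Complex.I h)) =
      ∫⁻ w, ‖(w : ℂ)‖ₑ ^ 2 * u (specCoord H w) ∂(repMeasure (resolventCalculus hH) h) := by
  have hm : Measurable (specId H) := (specId H).continuous.measurable
  rw [resolventProjMeasure, repProjMeasure_scalar, lintegral_map hu (measurable_specCoord H),
    ← resolventCalculus_specId hH, ← repFun_continuousMap,
    repMeasure_repFun (memLp_continuousMap _ _) hm,
    lintegral_withDensity_eq_lintegral_mul _ (by fun_prop)
      (g := fun w => u (specCoord H w)) (hu.comp (measurable_specCoord H))]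
  rfl

theorem mem_domain_iff_exists_resolventOp (hH : IsSelfAdjoint H) {z : ℂ} (hz : z.im ≠ 0) (f : E) :
    f ∈ H.domain ↔ ∃ h, resolventOp H z h = f := by
  have hR := isResolventAt_resolventOp hH hz
  refine ⟨fun hf => ⟨_, hR.2 ⟨f, hf⟩⟩, ?_⟩
  rintro ⟨h, rfl⟩
  exact (hR.1 h).choose

/-- A vector of the domain has the form `R_i h`, so its measure has density `|w|²` relative to that
of `h`, and `|x w| ≤ 1`. Conversely, integrability of `x²` puts `w⁻¹` in `L²` of the measure of `f`,
and `R_i` sends `w⁻¹(A) f` to `f`. -/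
theorem resolventProjMeasure_isSpectralMeasureOf (hH : IsSelfAdjoint H) :
    (resolventProjMeasure hH).IsSpectralMeasureOf H := by
  have hI : (Complex.I).im ≠ 0 := by simp
  refine ⟨fun f => ⟨fun hf => ?_, fun hf => ?_⟩, ?_⟩
  · obtain ⟨h, rfl⟩ := (mem_domain_iff_exists_resolventOp hH hI f).1 hf
    refine ⟨by fun_prop, ?_⟩
    rw [hasFiniteIntegral_iff_enorm, lintegral_resolventProjMeasure_scalar hH h (by fun_prop)]
    refine lt_of_le_of_lt (lintegral_mono (g := fun _ => 1) fun w => ?_) (by simp)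
    rw [← enorm_norm, ← enorm_pow, ← enorm_mul]
    rw [← ofReal_norm, ENNReal.ofReal_le_one, norm_mul, norm_pow, norm_pow, norm_norm, ← mul_pow]
    refine pow_le_one₀ (by positivity) ?_
    rcases eq_or_ne (w : ℂ) 0 with h0 | h0
    · simp [h0]
    · have : ‖specCoord H w‖ ≤ ‖(w : ℂ)⁻¹‖ := Complex.abs_re_le_norm _
      calc _ ≤ ‖(w : ℂ)‖ * ‖(w : ℂ)⁻¹‖ := by gcongr
        _ = 1 := by rw [norm_inv, mul_inv_cancel₀ (norm_ne_zero_iff.2 h0)]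
  · have hm : Measurable fun w : resSpec H => (w : ℂ)⁻¹ := by fun_prop
    have hL : MemLp (fun w : resSpec H => (w : ℂ)⁻¹) 2 (repMeasure (resolventCalculus hH) f) := by
      refine (memLp_two_iff_integrable_sq_norm hm.aestronglyMeasurable).2 ?_
      rw [resolventProjMeasure, repProjMeasure_scalar, integrable_map_measure (by fun_prop)
        (measurable_specCoord H).aemeasurable] at hf
      refine (hf.add (integrable_const (1 : ℝ))).congr ?_
      filter_upwards [ae_coe_ne_zero hH f] with w hw
      rw [inv_coe_eq hH w hw, ← Complex.normSq_eq_norm_sq, Complex.normSq_apply]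
      simp
      ring
    refine (mem_domain_iff_exists_resolventOp hH hI f).2
      ⟨repFun (resolventCalculus hH) (fun w => (w : ℂ)⁻¹) f, ?_⟩
    rw [← resolventCalculus_specId hH, rep_apply_repFun _ hL]
    refine (repFun_congr_ae ?_).trans (repFun_one (resolventCalculus hH) f)
    filter_upwards [ae_coe_ne_zero hH f] with w hw
    exact mul_inv_cancel₀ hw
  · rintro ⟨f, hf⟩
    obtain ⟨h, rfl⟩ := (mem_domain_iff_exists_resolventOp hH hI f).1 hf
    obtain ⟨hd, hd'⟩ := (isResolventAt_resolventOp hH hI).1 h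
    have hm : Measurable (specId H) := (specId H).continuous.measurable
    have h1 : H ⟨_, hf⟩ = h + Complex.I • resolventOp H Complex.I h := by
      rw [← sub_eq_iff_eq_add]; exact hd'
    -- As `H R_i = 1 + i R_i`, the integrand is `conj w + i |w|²`, which is `Re w` because `|w|² =
    -- Im w` on the spectrum. It also equals `x |w|²`, the integrand on the other side.
    have h2 : inner ℂ (resolventOp H Complex.I h) (H ⟨_, hf⟩) =
        ∫ w : resSpec H, (((w : ℂ).re : ℝ) : ℂ) ∂(repMeasure (resolventCalculus hH) h) := by
      rw [h1, ← resolventCalculus_specId hH, inner_rep_left, map_add, map_smul, ← rep_mul_apply,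
        inner_add_right, inner_smul_right, ← integral_repMeasure, ← integral_repMeasure,
        ← integral_const_mul, ← integral_add (continuousMap_integrable _ _)
        ((continuousMap_integrable _ _).const_mul _)]
      refine integral_congr_ae (ae_of_all _ fun w => ?_)
      have := im_eq_norm_sq_of_mem_spectrum hH w
      rw [← Complex.normSq_eq_norm_sq] at this
      apply Complex.ext
      · simp [specId]
        ring
      · simp only [specId, ContinuousMap.star_apply, ContinuousMap.mul_apply,
          ContinuousMap.coe_mk, RCLike.star_def, ← Complex.normSq_eq_conj_mul_self]
        simp [← this]
    rw [h2, integral_complex_ofReal]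
    change _ = ((∫ x, x ∂((resolventProjMeasure hH).scalar (resolventOp H Complex.I h)) : ℝ) : ℂ)
    rw [resolventProjMeasure, repProjMeasure_scalar,
      integral_map (measurable_specCoord H).aemeasurable (by fun_prop),
      ← resolventCalculus_specId hH, ← repFun_continuousMap,
      repMeasure_repFun (memLp_continuousMap _ _) hm,
      integral_withDensity_eq_integral_toReal_smul (by fun_prop)
        (ae_of_all _ fun x => ENNReal.pow_lt_top enorm_lt_top)]
    congr 1
    refine integral_congr_ae (ae_of_all _ fun w => ?_)
    simp only [ENNReal.toReal_pow, toReal_enorm, smul_eq_mul]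
    rw [mul_comm]
    exact (specCoord_mul_norm_sq w).symm

end SpectralTheorem

/-! ### Uniqueness of the spectral measure -/

section Uniqueness

variable {E : Type*} [NormedAddCommGroup E] [InnerProductSpace ℂ E] [CompleteSpace E]
  {H : E →ₗ.[ℂ] E} {P Q : ProjMeasure E} {s t : Set ℝ}

theorem ProjMeasure.proj_proj (P : ProjMeasure E) (hs : MeasurableSet s) (ht : MeasurableSet t)
    (f : E) : P.proj s (P.proj t f) = P.proj (s ∩ t) f := by
  rw [P.proj_inter s t hs ht]; rfl

theorem ProjMeasure.inner_proj_left (P : ProjMeasure E) (hs : MeasurableSet s) (f g : E) :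
    inner ℂ (P.proj s f) g = inner ℂ f (P.proj s g) := by
  have h : ContinuousLinearMap.adjoint (P.proj s) = P.proj s :=
    (P.isStarProjection s hs).isSelfAdjoint
  conv_rhs => rw [← h, ContinuousLinearMap.adjoint_inner_right]

/-- Additivity of the scalar measures gives equality of quadratic forms, and on a complex space an
operator with zero quadratic form is zero. -/
theorem ProjMeasure.proj_add_proj_compl (P : ProjMeasure E) (hs : MeasurableSet s) (f : E) :
    P.proj s f + P.proj sᶜ f = f := by
  have h : (P.proj s + P.proj sᶜ - 1 : E →L[ℂ] E) = 0 := by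
    rw [← ContinuousLinearMap.coe_inj, ContinuousLinearMap.toLinearMap_zero,
      ← inner_map_self_eq_zero]
    intro x
    have h1 : inner ℂ x ((P.proj s + P.proj sᶜ - 1 : E →L[ℂ] E) x) = 0 := by
      change inner ℂ x (P.proj s x + P.proj sᶜ x - x) = 0
      have h2 := measure_add_measure_compl (μ := P.scalar x) hs
      rw [P.scalar_apply x hs, P.scalar_apply x hs.compl, P.scalar_univ] at h2
      have h3 := congrArg ENNReal.toReal h2
      rw [ENNReal.toReal_add (by finiteness) (by finiteness)] at h3
      simp only [ENNReal.toReal_pow, toReal_enorm] at h3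
      rw [inner_sub_right, inner_add_right, P.inner_proj hs, P.inner_proj hs.compl,
        inner_self_eq_norm_sq_to_K, ← Complex.ofReal_add, h3, Complex.ofReal_pow]
      exact sub_self _
    rw [← inner_conj_symm]
    exact (congrArg _ h1).trans (map_zero _)
  have h1 := congrArg (fun A : E →L[ℂ] E => A f) h
  exact sub_eq_zero.1 h1

theorem ProjMeasure.scalar_proj (P : ProjMeasure E) (hs : MeasurableSet s) (f : E) :
    P.scalar (P.proj s f) = (P.scalar f).restrict s := by
  ext t ht
  rw [Measure.restrict_apply ht, P.scalar_apply _ ht, P.scalar_apply _ (ht.inter hs),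
    P.proj_proj ht hs]

namespace ProjMeasure.IsSpectralMeasureOf

theorem proj_mem_domain (hP : P.IsSpectralMeasureOf H) (hs : MeasurableSet s) {f : E}
    (hf : f ∈ H.domain) : P.proj s f ∈ H.domain := by
  rw [hP.mem_domain, P.scalar_proj hs]
  exact ((hP.mem_domain f).1 hf).restrict

theorem integrable_id (hP : P.IsSpectralMeasureOf H) {f : E} (hf : f ∈ H.domain) :
    Integrable (fun x : ℝ => x) (P.scalar f) := by
  have h := (hP.mem_domain f).1 hf
  refine (h.add (integrable_const (1 : ℝ))).mono' (by fun_prop) (ae_of_all _ fun x => ?_)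
  rw [Real.norm_eq_abs, abs_le]
  constructor <;> simp only [Pi.add_apply] <;> nlinarith [sq_nonneg (x - 1), sq_nonneg (x + 1)]

theorem inner_apply_eq (hP : P.IsSpectralMeasureOf H) {f : E} (hf : f ∈ H.domain) :
    inner ℂ f (H ⟨f, hf⟩) = ((∫ x, x ∂(P.scalar f) : ℝ) : ℂ) := hP.inner_apply ⟨f, hf⟩

theorem inner_proj_proj_compl (hP : P.IsSpectralMeasureOf H) (hs : MeasurableSet s) {f g : E}
    (hf : f ∈ H.domain) (hg : g ∈ H.domain) :
    inner ℂ (P.proj s g) (H ⟨_, hP.proj_mem_domain hs.compl hf⟩) = 0 := by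
  have key : ∀ (f : E) (hf : f ∈ H.domain),
      inner ℂ (P.proj s g) (H ⟨_, hP.proj_mem_domain hs.compl hf⟩) +
        inner ℂ (P.proj sᶜ f) (H ⟨_, hP.proj_mem_domain hs hg⟩) = 0 := by
    intro f hf
    have hp := hP.proj_mem_domain hs hg
    have hc := hP.proj_mem_domain hs.compl hf
    have hu : P.proj s (P.proj s g + P.proj sᶜ f) = P.proj s g := by
      rw [map_add, P.proj_proj hs hs, P.proj_proj hs hs.compl, Set.inter_self,
        Set.inter_compl_self]
      have := P.proj_proj MeasurableSet.empty MeasurableSet.empty f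
      have h0 := P.scalar_apply f MeasurableSet.empty
      rw [measure_empty] at h0
      have h1 : P.proj ∅ f = 0 := by simpa using h0.symm
      rw [h1, add_zero]
    have hu' : P.proj sᶜ (P.proj s g + P.proj sᶜ f) = P.proj sᶜ f := by
      have := P.proj_add_proj_compl hs (P.proj s g + P.proj sᶜ f)
      rw [hu] at this
      exact add_left_cancel this
    have h1 := hP.inner_apply_eq (H.domain.add_mem hp hc)
    have h2 := hP.inner_apply_eq hp
    have h3 := hP.inner_apply_eq hc
    have h4 : H ⟨_, H.domain.add_mem hp hc⟩ = H ⟨_, hp⟩ + H ⟨_, hc⟩ := H.map_add ⟨_, hp⟩ ⟨_, hc⟩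
    have h5 := integral_add_compl (μ := P.scalar (P.proj s g + P.proj sᶜ f)) hs
      (hP.integrable_id (H.domain.add_mem hp hc))
    rw [← P.scalar_proj hs, ← P.scalar_proj hs.compl, hu, hu'] at h5
    rw [← h5, Complex.ofReal_add, ← h2, ← h3, h4, inner_add_left, inner_add_right,
      inner_add_right] at h1
    linear_combination h1
  have h1 := key f hf
  have h2 := key (Complex.I • f) (H.domain.smul_mem _ hf)
  have h3 : H ⟨_, hP.proj_mem_domain hs.compl (H.domain.smul_mem Complex.I hf)⟩ =
      Complex.I • H ⟨_, hP.proj_mem_domain hs.compl hf⟩ := by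
    rw [← H.map_smul]
    congr 1
    exact Subtype.ext (map_smul _ _ _)
  rw [h3, map_smul, inner_smul_left, inner_smul_right, Complex.conj_I] at h2
  have h4 : Complex.I * (2 * inner ℂ (P.proj s g) (H ⟨_, hP.proj_mem_domain hs.compl hf⟩)) = 0 := by
    linear_combination h2 + Complex.I * h1
  simpa using h4

theorem apply_proj (hH : IsSelfAdjoint H) (hP : P.IsSpectralMeasureOf H) (hs : MeasurableSet s)
    {f : E} (hf : f ∈ H.domain) :
    H ⟨_, hP.proj_mem_domain hs hf⟩ = P.proj s (H ⟨f, hf⟩) := by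
  refine hH.dense_domain.eq_of_inner_right ℂ fun g hg => ?_
  have h1 := hP.inner_proj_proj_compl hs hf hg
  have h2 := hP.inner_proj_proj_compl hs.compl hf hg
  simp only [compl_compl] at h2
  have h3 : H ⟨f, hf⟩ = H ⟨_, hP.proj_mem_domain hs hf⟩ + H ⟨_, hP.proj_mem_domain hs.compl hf⟩ := by
    rw [← H.map_add]
    congr 1
    exact Subtype.ext (P.proj_add_proj_compl hs f).symm
  rw [← P.inner_proj_left hs, h3, inner_add_right, h1, add_zero]
  conv_lhs => rw [← P.proj_add_proj_compl hs g]
  rw [inner_add_left, h2, add_zero]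

theorem resolventOp_proj (hH : IsSelfAdjoint H) (hP : P.IsSpectralMeasureOf H)
    (hs : MeasurableSet s) {z : ℂ} (hz : z.im ≠ 0) (f : E) :
    resolventOp H z (P.proj s f) = P.proj s (resolventOp H z f) := by
  have hR := isResolventAt_resolventOp hH hz
  obtain ⟨hd, hd'⟩ := hR.1 f
  have h1 := hR.2 ⟨_, hP.proj_mem_domain hs hd⟩
  rw [hP.apply_proj hH hs hd, ← map_smul, ← map_sub, hd'] at h1
  exact h1

theorem proj_commute_resolventProjMeasure (hH : IsSelfAdjoint H) (hP : P.IsSpectralMeasureOf H)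
    (hs : MeasurableSet s) (ht : MeasurableSet t) (f : E) :
    P.proj s ((resolventProjMeasure hH).proj t f) =
      (resolventProjMeasure hH).proj t (P.proj s f) := by
  have hI : (Complex.I).im ≠ 0 := by simp
  have hc : ∀ {z : ℂ}, z.im ≠ 0 → Commute (resolventOp H z) (P.proj s) := fun hz => by
    ext f; exact hP.resolventOp_proj hH hs hz f
  have hΦ : ∀ g f, P.proj s (resolventCalculus hH g f) = resolventCalculus hH g (P.proj s f) := by
    intro g f
    have h := Commute.cfcHom (isStarNormal_resolventOp hH hI) (hc hI) (by
      rw [ContinuousLinearMap.star_eq_adjoint, adjoint_resolventOp hH hI]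
      exact hc (by simp)) g
    exact congrArg (fun A : E →L[ℂ] E => A f) h.symm
  have hm := measurable_indicator_one (measurable_specCoord H ht)
  have hb := norm_indicator_one_le (specCoord H ⁻¹' t)
  rw [resolventProjMeasure, repProjMeasure_proj _ _ ht, repProjMeasure_proj _ _ ht]
  obtain ⟨g, hg⟩ := exists_seq_continuousMap (repMeasure (resolventCalculus hH) f +
    repMeasure (resolventCalculus hH) (P.proj s f)) (memLp_of_norm_le_one _ hm hb)
  have h1 := tendsto_rep_apply (f := f) (Measure.le_add_right le_rfl)
    (memLp_of_norm_le_one _ hm hb) hg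
  have h2 := tendsto_rep_apply (f := P.proj s f) (Measure.le_add_left le_rfl)
    (memLp_of_norm_le_one _ hm hb) hg
  simp only [← hΦ] at h2
  exact tendsto_nhds_unique (((P.proj s).continuous.tendsto _).comp h1) h2

theorem re_inner_le (hP : P.IsSpectralMeasureOf H) {a : ℝ} {f : E} (hf : f ∈ H.domain)
    (h : P.proj (Set.Iic a) f = f) : (inner ℂ f (H ⟨f, hf⟩)).re ≤ a * ‖f‖ ^ 2 := by
  have h1 := P.scalar_proj (measurableSet_Iic (a := a)) f
  rw [h] at h1
  have h2 : ∫ x, x ∂(P.scalar f) ≤ ∫ x, a ∂(P.scalar f) := by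
    refine integral_mono_ae (hP.integrable_id hf) (integrable_const a) ?_
    rw [h1]
    exact ae_restrict_mem measurableSet_Iic
  rw [hP.inner_apply_eq hf, Complex.ofReal_re]
  refine h2.trans (le_of_eq ?_)
  simp [measureReal_def, P.scalar_univ, mul_comm]

theorem le_re_inner (hP : P.IsSpectralMeasureOf H) {b : ℝ} {f : E} (hf : f ∈ H.domain)
    (h : P.proj (Set.Ici b) f = f) : b * ‖f‖ ^ 2 ≤ (inner ℂ f (H ⟨f, hf⟩)).re := by
  have h1 := P.scalar_proj (measurableSet_Ici (a := b)) f
  rw [h] at h1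
  have h2 : ∫ x, b ∂(P.scalar f) ≤ ∫ x, x ∂(P.scalar f) := by
    refine integral_mono_ae (integrable_const b) (hP.integrable_id hf) ?_
    rw [h1]
    exact ae_restrict_mem measurableSet_Ici
  rw [hP.inner_apply_eq hf, Complex.ofReal_re]
  refine le_trans (le_of_eq ?_) h2
  simp [measureReal_def, P.scalar_univ, mul_comm]

theorem proj_Iic_proj_Ici (hH : IsSelfAdjoint H) (hP : P.IsSpectralMeasureOf H)
    (hQ : Q.IsSpectralMeasureOf H)
    (hPQ : ∀ s t, MeasurableSet s → MeasurableSet t → ∀ f,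
      P.proj s (Q.proj t f) = Q.proj t (P.proj s f)) {a b : ℝ} (hab : a < b) (f : E) :
    P.proj (Set.Iic a) (Q.proj (Set.Ici b) f) = 0 := by
  have hIic := measurableSet_Iic (a := a)
  have hIci := measurableSet_Ici (a := b)
  refine congrFun (Continuous.ext_on (f := fun f => P.proj (Set.Iic a) (Q.proj (Set.Ici b) f))
    (g := fun _ => 0) hH.dense_domain (by fun_prop) continuous_const fun g hg => ?_) f
  have hd := hP.proj_mem_domain hIic (hQ.proj_mem_domain hIci hg)
  have h1 : P.proj (Set.Iic a) (P.proj (Set.Iic a) (Q.proj (Set.Ici b) g)) =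
      P.proj (Set.Iic a) (Q.proj (Set.Ici b) g) := by
    rw [P.proj_proj hIic hIic, Set.inter_self]
  have h2 : Q.proj (Set.Ici b) (P.proj (Set.Iic a) (Q.proj (Set.Ici b) g)) =
      P.proj (Set.Iic a) (Q.proj (Set.Ici b) g) := by
    rw [← hPQ _ _ hIic hIci, Q.proj_proj hIci hIci, Set.inter_self]
  have h3 := (hQ.le_re_inner hd h2).trans (hP.re_inner_le hd h1)
  have h4 : ‖P.proj (Set.Iic a) (Q.proj (Set.Ici b) g)‖ ^ 2 = 0 := by
    nlinarith [sq_nonneg ‖P.proj (Set.Iic a) (Q.proj (Set.Ici b) g)‖]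
  simpa using h4

theorem proj_Iic_proj_Ioi (hH : IsSelfAdjoint H) (hP : P.IsSpectralMeasureOf H)
    (hQ : Q.IsSpectralMeasureOf H)
    (hPQ : ∀ s t, MeasurableSet s → MeasurableSet t → ∀ f,
      P.proj s (Q.proj t f) = Q.proj t (P.proj s f)) (a : ℝ) (f : E) :
    P.proj (Set.Iic a) (Q.proj (Set.Ioi a) f) = 0 := by
  rw [hPQ _ _ measurableSet_Iic measurableSet_Ioi]
  have h : Q.scalar (P.proj (Set.Iic a) f) (Set.Ioi a) = 0 := by
    obtain ⟨u, -, hu, hu'⟩ := exists_seq_strictAnti_tendsto a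
    have h1 : Set.Ioi a ⊆ ⋃ n, Set.Ici (u n) := by
      intro x hx
      obtain ⟨n, hn⟩ := (hu'.eventually (gt_mem_nhds hx)).exists
      exact Set.mem_iUnion.2 ⟨n, hn.le⟩
    refine measure_mono_null h1 (measure_iUnion_null fun n => ?_)
    rw [Q.scalar_apply _ measurableSet_Ici, ← hPQ _ _ measurableSet_Iic measurableSet_Ici,
      hP.proj_Iic_proj_Ici hH hQ hPQ (hu n)]
    simp
  rw [Q.scalar_apply _ measurableSet_Ioi] at h
  simpa using h

theorem scalar_eq (hH : IsSelfAdjoint H) (hP : P.IsSpectralMeasureOf H) (f : E) :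
    P.scalar f = (resolventProjMeasure hH).scalar f := by
  set Q := resolventProjMeasure hH with hQdef
  have hQ : Q.IsSpectralMeasureOf H := resolventProjMeasure_isSpectralMeasureOf hH
  have hPQ : ∀ s t, MeasurableSet s → MeasurableSet t → ∀ f,
    P.proj s (Q.proj t f) = Q.proj t (P.proj s f) :=
    fun s t hs ht f => hP.proj_commute_resolventProjMeasure hH hs ht f
  refine Measure.ext_of_Iic _ _ fun a => ?_
  have hIic := measurableSet_Iic (a := a)
  have h1 := hP.proj_Iic_proj_Ioi hH hQ hPQ a f
  have h2 := hQ.proj_Iic_proj_Ioi hH hP (fun s t hs ht f => (hPQ t s ht hs f).symm) a f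
  rw [← Set.compl_Iic] at h1 h2
  have h3 := congrArg (P.proj (Set.Iic a)) (Q.proj_add_proj_compl hIic f)
  have h4 := congrArg (Q.proj (Set.Iic a)) (P.proj_add_proj_compl hIic f)
  rw [map_add, h1, add_zero] at h3
  rw [map_add, h2, add_zero, ← hPQ _ _ hIic hIic, h3] at h4
  rw [P.scalar_apply f hIic, Q.scalar_apply f hIic, h4]

end ProjMeasure.IsSpectralMeasureOf

theorem spectralMeasure_isSpectralMeasureOf (hH : IsSelfAdjoint H) :
    (spectralMeasure H).IsSpectralMeasureOf H := by
  have h : ∃ P : ProjMeasure E, P.IsSpectralMeasureOf H :=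
    ⟨_, resolventProjMeasure_isSpectralMeasureOf hH⟩
  rw [spectralMeasure, dif_pos h]
  exact h.choose_spec

theorem inner_resolventOp_eq_integral_spectralMeasure (hH : IsSelfAdjoint H) {z : ℂ}
    (hz : z.im ≠ 0) (f : E) :
    inner ℂ f (resolventOp H z f) = ∫ x : ℝ, ((x : ℂ) - z)⁻¹ ∂((spectralMeasure H).scalar f) := by
  rw [(spectralMeasure_isSpectralMeasureOf hH).scalar_eq hH, inner_resolventOp_eq_integral hH hz]

end Uniqueness

/-! ### Boundary values of Poisson integrals -/

section Poisson

/-- The Poisson kernel at height one. -/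
def cauchyDensity (u : ℝ) : ℝ := (Real.pi * (1 + u ^ 2))⁻¹

/-- The half-width of the superlevel sets of `cauchyDensity`. -/
def cauchyWidth (t : ℝ) : ℝ := Real.sqrt ((Real.pi * t)⁻¹ - 1)

theorem cauchyDensity_pos (u : ℝ) : 0 < cauchyDensity u := by
  unfold cauchyDensity; positivity

theorem measurable_cauchyDensity : Measurable cauchyDensity := by
  unfold cauchyDensity; fun_prop

theorem le_cauchyDensity_iff {t u : ℝ} (ht : 0 < t) :
    t ≤ cauchyDensity u ↔ u ^ 2 ≤ (Real.pi * t)⁻¹ - 1 := by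
  have hpi := Real.pi_pos
  rw [cauchyDensity, le_inv_comm₀ ht (by positivity), le_sub_iff_add_le, add_comm,
    mul_inv, ← div_eq_inv_mul, le_div_iff₀' hpi]

theorem superlevel_cauchyDensity {t y l : ℝ} (ht : 0 < t) (ht' : t < Real.pi⁻¹) (hy : 0 < y) :
    {x | t ≤ cauchyDensity ((x - l) / y)} = Metric.closedBall l (y * cauchyWidth t) := by
  have hpi := Real.pi_pos
  have h0 : 0 ≤ (Real.pi * t)⁻¹ - 1 := by
    rw [sub_nonneg, one_le_inv₀ (by positivity)]
    rw [lt_inv_comm₀ ht hpi] at ht'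
    have := mul_lt_mul_of_pos_right ht' ht
    rw [inv_mul_cancel₀ ht.ne'] at this
    exact this.le
  ext x
  rw [Set.mem_ofPred_eq, le_cauchyDensity_iff ht, Metric.mem_closedBall, Real.dist_eq, cauchyWidth,
    ← div_le_iff₀' hy, Real.le_sqrt (by positivity) h0, ← abs_of_pos hy, ← abs_div, sq_abs,
    abs_of_pos hy]

theorem superlevel_cauchyDensity_eq_empty {t y l : ℝ} (ht : Real.pi⁻¹ < t) :
    {x | t ≤ cauchyDensity ((x - l) / y)} = ∅ := by
  have hpi := Real.pi_pos
  have h0 : 0 < t := lt_trans (by positivity) ht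
  ext x
  simp only [Set.mem_ofPred_eq, le_cauchyDensity_iff h0, Set.mem_empty_iff_false, iff_false, not_le]
  refine lt_of_lt_of_le ?_ (sq_nonneg _)
  rw [sub_neg, inv_lt_one₀ (by positivity)]
  rw [inv_lt_iff_one_lt_mul₀ hpi, mul_comm] at ht
  exact ht

theorem cauchyWidth_pos {t : ℝ} (ht : 0 < t) (ht' : t < Real.pi⁻¹) : 0 < cauchyWidth t := by
  have hpi := Real.pi_pos
  rw [cauchyWidth, Real.sqrt_pos, sub_pos, one_lt_inv₀ (by positivity)]
  rwa [lt_inv_comm₀ ht hpi, lt_inv_comm₀ hpi ht, ← one_div, lt_div_iff₀ hpi, mul_comm] at ht'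

theorem cauchyWidth_eq_zero {t : ℝ} (ht : Real.pi⁻¹ < t) : cauchyWidth t = 0 := by
  have hpi := Real.pi_pos
  have h0 : 0 < t := lt_trans (by positivity) ht
  rw [cauchyWidth, Real.sqrt_eq_zero', sub_nonpos]
  refine inv_le_one_of_one_le₀ ?_
  rw [inv_lt_iff_one_lt_mul₀ hpi, mul_comm] at ht
  exact ht.le

theorem lintegral_cauchyDensity_comp (μ : Measure ℝ) (l y : ℝ) :
    ∫⁻ x, ENNReal.ofReal (cauchyDensity ((x - l) / y)) ∂μ =
      ∫⁻ t in Set.Ioi 0, μ {x | t ≤ cauchyDensity ((x - l) / y)} :=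
  lintegral_eq_lintegral_meas_le μ (ae_of_all _ fun _ => (cauchyDensity_pos _).le)
    (measurable_cauchyDensity.comp (by fun_prop)).aemeasurable

theorem ae_ne_inv_pi : ∀ᵐ t : ℝ ∂(volume.restrict (Set.Ioi 0)), 0 < t ∧ t ≠ Real.pi⁻¹ := by
  filter_upwards [ae_restrict_mem measurableSet_Ioi,
    ae_restrict_of_ae (Measure.ae_ne volume Real.pi⁻¹)] with t h1 h2 using ⟨h1, h2⟩

theorem lintegral_cauchyWidth :
    ∫⁻ t in Set.Ioi 0, ENNReal.ofReal (2 * cauchyWidth t) = 1 := by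
  have h1 := lintegral_cauchyDensity_comp volume 0 1
  have h2 : ∫⁻ x, ENNReal.ofReal (cauchyDensity ((x - 0) / 1)) = 1 := by
    simp only [sub_zero, div_one]
    have h3 : Integrable cauchyDensity := by
      refine (integrable_inv_one_add_sq.const_mul Real.pi⁻¹).congr (ae_of_all _ fun x => ?_)
      exact (mul_inv _ _).symm
    rw [← ofReal_integral_eq_lintegral_ofReal h3 (ae_of_all _ fun _ => (cauchyDensity_pos _).le)]
    simp only [cauchyDensity, mul_inv, integral_const_mul, integral_univ_inv_one_add_sq]
    rw [inv_mul_cancel₀ Real.pi_ne_zero, ENNReal.ofReal_one]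
  rw [← h2, h1]
  refine lintegral_congr_ae ?_
  filter_upwards [ae_ne_inv_pi] with t ⟨ht, hne⟩
  rcases lt_or_gt_of_ne hne with h | h
  · rw [superlevel_cauchyDensity ht h one_pos, Real.volume_closedBall, one_mul]
  · rw [superlevel_cauchyDensity_eq_empty h, cauchyWidth_eq_zero h]
    simp

theorem exists_bound_measure_closedBall {μ : Measure ℝ} [IsFiniteMeasure μ] {l : ℝ} {k : ENNReal}
    (hk : k < ⊤) (h : Tendsto (fun r => μ (Metric.closedBall l r) /
      volume (Metric.closedBall l r)) (𝓝[>] 0) (𝓝 k)) :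
    ∃ C : ENNReal, C ≠ ⊤ ∧ ∀ r, 0 < r → μ (Metric.closedBall l r) ≤ C * ENNReal.ofReal (2 * r) := by
  have h1 : ∀ᶠ r in 𝓝[>] (0 : ℝ), μ (Metric.closedBall l r) /
      volume (Metric.closedBall l r) < k + 1 :=
    h.eventually (gt_mem_nhds (ENNReal.lt_add_right hk.ne one_ne_zero))
  obtain ⟨δ, hδ, h2⟩ := mem_nhdsGT_iff_exists_Ioo_subset.1 h1
  have hδ' : (0 : ℝ) < δ := hδ
  have hne : ENNReal.ofReal (2 * δ) ≠ 0 := by simpa using hδ'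
  refine ⟨k + 1 + μ Set.univ / ENNReal.ofReal (2 * δ), ?_, fun r hr => ?_⟩
  · exact ENNReal.add_ne_top.2 ⟨ENNReal.add_ne_top.2 ⟨hk.ne, ENNReal.one_ne_top⟩,
      ENNReal.div_ne_top (measure_ne_top _ _) hne⟩
  · rw [add_mul]
    rcases lt_or_ge r δ with h3 | h3
    · refine le_trans ?_ le_self_add
      have h4 : μ (Metric.closedBall l r) / volume (Metric.closedBall l r) < k + 1 := h2 ⟨hr, h3⟩
      rw [Real.volume_closedBall] at h4
      exact (ENNReal.div_le_iff (by simpa using hr) ENNReal.ofReal_ne_top).1 h4.le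
    · refine le_trans ?_ le_add_self
      calc μ (Metric.closedBall l r) ≤ μ Set.univ := measure_mono (Set.subset_univ _)
        _ = μ Set.univ / ENNReal.ofReal (2 * δ) * ENNReal.ofReal (2 * δ) :=
            (ENNReal.div_mul_cancel hne ENNReal.ofReal_ne_top).symm
        _ ≤ _ := by gcongr

theorem tendsto_lintegral_cauchyDensity {μ : Measure ℝ} [IsFiniteMeasure μ] {l : ℝ} {k : ENNReal}
    (hk : k < ⊤) (h : Tendsto (fun r => μ (Metric.closedBall l r) /
      volume (Metric.closedBall l r)) (𝓝[>] 0) (𝓝 k)) :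
    Tendsto (fun y : ℝ => ENNReal.ofReal y⁻¹ *
      ∫⁻ x, ENNReal.ofReal (cauchyDensity ((x - l) / y)) ∂μ) (𝓝[>] 0) (𝓝 k) := by
  obtain ⟨C, hC, hC'⟩ := exists_bound_measure_closedBall hk h
  have hpos : ∀ᶠ y : ℝ in 𝓝[>] 0, 0 < y := eventually_mem_nhdsWithin
  have hlim : k = ∫⁻ t in Set.Ioi 0, ENNReal.ofReal (2 * cauchyWidth t) * k := by
    rw [lintegral_mul_const _ (by unfold cauchyWidth; fun_prop), lintegral_cauchyWidth, one_mul]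
  have hmono : ∀ y, Measurable fun t => μ {x | t ≤ cauchyDensity ((x - l) / y)} := fun y =>
    Antitone.measurable fun t t' htt => measure_mono fun x hx => htt.trans hx
  have hrw : ∀ y, ENNReal.ofReal y⁻¹ * ∫⁻ x, ENNReal.ofReal (cauchyDensity ((x - l) / y)) ∂μ =
      ∫⁻ t in Set.Ioi 0, ENNReal.ofReal y⁻¹ * μ {x | t ≤ cauchyDensity ((x - l) / y)} := fun y => by
    rw [lintegral_cauchyDensity_comp, lintegral_const_mul _ (hmono y)]
  simp only [hrw]
  rw [hlim]
  refine tendsto_lintegral_filter_of_dominated_convergence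
    (fun t => C * ENNReal.ofReal (2 * cauchyWidth t)) ?_ ?_ ?_ ?_
  · exact Eventually.of_forall fun y => (hmono y).const_mul _
  · filter_upwards [hpos] with y hy
    filter_upwards [ae_ne_inv_pi] with t ⟨ht, hne⟩
    rcases lt_or_gt_of_ne hne with h1 | h1
    · rw [superlevel_cauchyDensity ht h1 hy]
      calc _ ≤ ENNReal.ofReal y⁻¹ * (C * ENNReal.ofReal (2 * (y * cauchyWidth t))) := by
            gcongr; exact hC' _ (mul_pos hy (cauchyWidth_pos ht h1))
        _ = _ := by
            rw [mul_left_comm, ← ENNReal.ofReal_mul (by positivity)]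
            congr 2
            field_simp
    · rw [superlevel_cauchyDensity_eq_empty h1]
      simp
  · rw [lintegral_const_mul _ (by unfold cauchyWidth; fun_prop), lintegral_cauchyWidth, mul_one]
    exact hC
  · filter_upwards [ae_ne_inv_pi] with t ⟨ht, hne⟩
    rcases lt_or_gt_of_ne hne with h1 | h1
    · have hw := cauchyWidth_pos ht h1
      have h2 : Tendsto (fun y => y * cauchyWidth t) (𝓝[>] 0) (𝓝[>] 0) := by
        refine tendsto_nhdsWithin_iff.2 ⟨?_, ?_⟩
        · refine Tendsto.mono_left ?_ nhdsWithin_le_nhds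
          simpa using (continuous_id.mul continuous_const).tendsto (0 : ℝ) (f := fun y => y * cauchyWidth t)
        · filter_upwards [hpos] with y hy using mul_pos hy hw
      have h3 := ENNReal.Tendsto.const_mul (h.comp h2) (a := ENNReal.ofReal (2 * cauchyWidth t))
        (Or.inr ENNReal.ofReal_ne_top)
      refine h3.congr' ?_
      filter_upwards [hpos] with y hy
      rw [superlevel_cauchyDensity ht h1 hy, Function.comp_apply, Real.volume_closedBall,
        ENNReal.div_eq_inv_mul, ← mul_assoc, ← ENNReal.ofReal_inv_of_pos (by positivity),
        ← ENNReal.ofReal_mul (by positivity)]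
      congr 2
      field_simp
    · simp only [superlevel_cauchyDensity_eq_empty h1, cauchyWidth_eq_zero h1]
      simp

/-- Fatou's theorem for Poisson integrals of finite measures on the line. -/
theorem ae_tendsto_poisson (μ : Measure ℝ) [IsFiniteMeasure μ] :
    ∀ᵐ l : ℝ, Tendsto (fun y : ℝ => Real.pi⁻¹ * ∫ x, y / ((x - l) ^ 2 + y ^ 2) ∂μ) (𝓝[>] 0)
      (𝓝 (μ.rnDeriv volume l).toReal) := by
  filter_upwards [Besicovitch.ae_tendsto_rnDeriv μ volume, Measure.rnDeriv_lt_top μ volume]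
    with l hl hk
  refine ((ENNReal.tendsto_toReal hk.ne).comp (tendsto_lintegral_cauchyDensity hk hl)).congr' ?_
  filter_upwards [eventually_mem_nhdsWithin] with y hy
  have hy' : (0 : ℝ) < y := hy
  rw [Function.comp_apply, ENNReal.toReal_mul, ENNReal.toReal_ofReal (by positivity),
    ← integral_eq_lintegral_of_nonneg_ae (ae_of_all _ fun _ => (cauchyDensity_pos _).le)
    (measurable_cauchyDensity.comp (by fun_prop)).aestronglyMeasurable, ← integral_const_mul,
    ← integral_const_mul]
  refine integral_congr_ae (ae_of_all _ fun x => ?_)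
  simp only [cauchyDensity]
  field_simp
  ring

end Poisson

/-! ### Boundary values of sandwiched resolvents -/

section BoundaryValue

variable {E K : Type*} [NormedAddCommGroup E] [InnerProductSpace ℂ E] [CompleteSpace E]
  [NormedAddCommGroup K] [InnerProductSpace ℂ K] [CompleteSpace K]
  {H : E →ₗ.[ℂ] E} {F : E →L[ℂ] K} {l : ℝ}

theorem coe_imaginaryPart_eq (T : K →L[ℂ] K) :
    (ℑ T : K →L[ℂ] K) = (2 * Complex.I)⁻¹ • (T - ContinuousLinearMap.adjoint T) := by
  rw [imaginaryPart_apply_coe, ContinuousLinearMap.star_eq_adjoint, mul_inv, Complex.inv_I, mul_comm,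
    mul_smul]
  congr 1
  rw [← Complex.coe_smul]
  norm_num

theorem continuous_coe_imaginaryPart :
    Continuous fun T : K →L[ℂ] K => (ℑ T : K →L[ℂ] K) := by
  simp only [coe_imaginaryPart_eq, ← ContinuousLinearMap.star_eq_adjoint]
  fun_prop

theorem adjoint_sandwiched (hH : IsSelfAdjoint H) (F : E →L[ℂ] K) {z : ℂ} (hz : z.im ≠ 0) :
    ContinuousLinearMap.adjoint (sandwiched H F z) = sandwiched H F (starRingEnd ℂ z) := by
  rw [sandwiched, ContinuousLinearMap.adjoint_comp, ContinuousLinearMap.adjoint_comp,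
    adjoint_resolventOp hH hz, ContinuousLinearMap.adjoint_adjoint, sandwiched]
  rfl

theorem imaginaryPart_sandwiched (hH : IsSelfAdjoint H) (F : E →L[ℂ] K) {z : ℂ} (hz : z.im ≠ 0) :
    (ℑ (sandwiched H F z) : K →L[ℂ] K) = (z.im : ℂ) •
      (ContinuousLinearMap.adjoint (resolventOp H z ∘L ContinuousLinearMap.adjoint F) ∘L
        (resolventOp H z ∘L ContinuousLinearMap.adjoint F)) := by
  have h := resolventOp_sub_adjoint hH hz
  have h1 : sandwiched H F z - ContinuousLinearMap.adjoint (sandwiched H F z) =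
      F ∘L (resolventOp H z - ContinuousLinearMap.adjoint (resolventOp H z)) ∘L
        ContinuousLinearMap.adjoint F := by
    rw [adjoint_sandwiched hH F hz, adjoint_resolventOp hH hz]
    ext φ
    simp [sandwiched]
  rw [coe_imaginaryPart_eq, h1, h, ContinuousLinearMap.adjoint_comp,
    ContinuousLinearMap.adjoint_adjoint]
  ext φ
  simp only [ContinuousLinearMap.comp_apply, smul_apply, map_smul, smul_smul]
  congr 1
  field_simp

theorem imaginaryPart_sandwiched_nonneg (hH : IsSelfAdjoint H) (F : E →L[ℂ] K) {z : ℂ}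
    (hz : 0 < z.im) : 0 ≤ (ℑ (sandwiched H F z) : K →L[ℂ] K) := by
  rw [imaginaryPart_sandwiched hH F hz.ne', Complex.coe_smul]
  refine smul_nonneg hz.le ?_
  rw [ContinuousLinearMap.nonneg_iff_isPositive]
  exact ContinuousLinearMap.isPositive_adjoint_comp_self _

theorem tendsto_boundaryValue (hl : l ∈ regularSet H F) :
    Tendsto (fun y : ℝ => sandwiched H F (l + y * Complex.I)) (𝓝[>] 0)
      (𝓝 (boundaryValue H F l)) :=
  tendsto_nhds_limUnder hl

theorem im_add_mul_I (l y : ℝ) : ((l : ℂ) + y * Complex.I).im = y := by simp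

theorem imaginaryPart_boundaryValue_nonneg (hH : IsSelfAdjoint H) (hl : l ∈ regularSet H F) :
    0 ≤ (ℑ (boundaryValue H F l) : K →L[ℂ] K) := by
  have h := (continuous_coe_imaginaryPart.tendsto _).comp (tendsto_boundaryValue hl)
  refine CStarAlgebra.isClosed_nonneg.mem_of_tendsto h ?_
  filter_upwards [eventually_mem_nhdsWithin] with y hy
  exact imaginaryPart_sandwiched_nonneg hH F (by rw [im_add_mul_I]; exact hy)

theorem adjoint_sqrtIm (H : E →ₗ.[ℂ] E) (F : E →L[ℂ] K) (l : ℝ) :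
    ContinuousLinearMap.adjoint (sqrtIm H F l) = sqrtIm H F l :=
  (IsSelfAdjoint.of_nonneg (CFC.sqrt_nonneg _)).star_eq

theorem inner_sqrtIm (hH : IsSelfAdjoint H) (hl : l ∈ regularSet H F) (φ ψ : K) :
    inner ℂ (sqrtIm H F l φ) (sqrtIm H F l ψ) =
      inner ℂ φ ((ℑ (boundaryValue H F l) : K →L[ℂ] K) ψ) := by
  have h : sqrtIm H F l * sqrtIm H F l = (ℑ (boundaryValue H F l) : K →L[ℂ] K) :=
    CFC.sqrt_mul_sqrt_self _ (imaginaryPart_boundaryValue_nonneg hH hl)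
  rw [← h, ← ContinuousLinearMap.adjoint_inner_right, adjoint_sqrtIm]
  rfl

theorem inner_evalAt (hH : IsSelfAdjoint H) (hl : l ∈ regularSet H F) (φ ψ : K) :
    inner ℂ (evalAt H F l φ) (evalAt H F l ψ) =
      ((Real.pi⁻¹ : ℝ) : ℂ) * inner ℂ φ ((ℑ (boundaryValue H F l) : K →L[ℂ] K) ψ) := by
  rw [Submodule.coe_inner, evalAt, evalAt, inner_smul_left, inner_smul_right, inner_sqrtIm hH hl,
    Complex.conj_ofReal, ← mul_assoc, ← Complex.ofReal_mul, ← mul_inv,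
    Real.mul_self_sqrt Real.pi_pos.le]

theorem inner_sandwiched (H : E →ₗ.[ℂ] E) (F : E →L[ℂ] K) (z : ℂ) (φ : K) :
    inner ℂ φ (sandwiched H F z φ) = inner ℂ (ContinuousLinearMap.adjoint F φ)
      (resolventOp H z (ContinuousLinearMap.adjoint F φ)) := by
  rw [ContinuousLinearMap.adjoint_inner_left]
  rfl

theorem inner_imaginaryPart (T : K →L[ℂ] K) (φ : K) :
    inner ℂ φ ((ℑ T : K →L[ℂ] K) φ) = ((inner ℂ φ (T φ)).im : ℂ) := by
  rw [coe_imaginaryPart_eq, smul_apply, inner_smul_right, sub_apply, inner_sub_right,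
    ContinuousLinearMap.adjoint_inner_right, ← inner_conj_symm (T φ) φ, Complex.sub_conj]
  field_simp
  push_cast
  ring

theorem inner_imaginaryPart_sandwiched (hH : IsSelfAdjoint H) (F : E →L[ℂ] K) {y : ℝ} (hy : 0 < y)
    (φ : K) :
    inner ℂ φ ((ℑ (sandwiched H F (l + y * Complex.I)) : K →L[ℂ] K) φ) =
      ((∫ x, y / ((x - l) ^ 2 + y ^ 2)
        ∂((spectralMeasure H).scalar (ContinuousLinearMap.adjoint F φ)) : ℝ) : ℂ) := by
  have hz : ((l : ℂ) + y * Complex.I).im ≠ 0 := by rw [im_add_mul_I]; exact hy.ne'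
  rw [inner_imaginaryPart, inner_sandwiched, inner_resolventOp_eq_integral_spectralMeasure hH hz]
  have hne : ∀ x : ℝ, (x : ℂ) - (l + y * Complex.I) ≠ 0 := fun x h => by
    have := congrArg Complex.im h
    simp at this
    exact hy.ne' this
  have hint : Integrable (fun x : ℝ => ((x : ℂ) - (l + y * Complex.I))⁻¹)
      ((spectralMeasure H).scalar (ContinuousLinearMap.adjoint F φ)) := by
    refine Integrable.of_bound (by
      refine Measurable.aestronglyMeasurable (by fun_prop)) y⁻¹ (ae_of_all _ fun x => ?_)
    rw [norm_inv]
    refine inv_anti₀ hy ?_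
    refine le_trans ?_ (Complex.abs_im_le_norm _)
    simp [abs_of_pos hy]
  have h := integral_im hint
  congr 1
  refine h.symm.trans (integral_congr_ae (ae_of_all _ fun x => ?_))
  simp only [RCLike.im_to_complex, Complex.inv_im, Complex.normSq_apply]
  simp
  ring

theorem ae_norm_evalAt_sq (hH : IsSelfAdjoint H) (hL : LimitingAbsorption H F) (φ : K) :
    ∀ᵐ l : ℝ, ‖evalAt H F l φ‖ ^ 2 = (((spectralMeasure H).scalar
      (ContinuousLinearMap.adjoint F φ)).rnDeriv volume l).toReal := by
  have hL' : ∀ᵐ l : ℝ, l ∈ regularSet H F := hL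
  filter_upwards [hL', ae_tendsto_poisson
    ((spectralMeasure H).scalar (ContinuousLinearMap.adjoint F φ))] with l hl hp
  have h1 := (continuous_coe_imaginaryPart.tendsto _).comp (tendsto_boundaryValue hl)
  have h2 : Tendsto (fun y : ℝ => ((Real.pi⁻¹ : ℝ) : ℂ) *
      inner ℂ φ ((ℑ (sandwiched H F (l + y * Complex.I)) : K →L[ℂ] K) φ)) (𝓝[>] 0)
      (𝓝 (((Real.pi⁻¹ : ℝ) : ℂ) * inner ℂ φ ((ℑ (boundaryValue H F l) : K →L[ℂ] K) φ))) :=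
    (tendsto_const_nhds.inner (((ContinuousLinearMap.apply ℂ K φ).continuous.tendsto _).comp
      h1)).const_mul _
  rw [← inner_evalAt hH hl, inner_self_eq_norm_sq_to_K] at h2
  have h3 := (Complex.continuous_ofReal.tendsto _).comp hp
  have h4 := h2.congr' (f₂ := fun y : ℝ => ((Real.pi⁻¹ * ∫ x, y / ((x - l) ^ 2 + y ^ 2)
        ∂((spectralMeasure H).scalar (ContinuousLinearMap.adjoint F φ)) : ℝ) : ℂ)) (by
    filter_upwards [eventually_mem_nhdsWithin] with y hy
    rw [inner_imaginaryPart_sandwiched hH F hy, Complex.ofReal_mul])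
  have h5 := tendsto_nhds_unique h4 h3
  exact Complex.ofReal_injective (by rw [Complex.ofReal_pow]; exact h5)

end BoundaryValue

/-! ### Measurability of the boundary values -/

section Measurability

variable {E K : Type*} [NormedAddCommGroup E] [InnerProductSpace ℂ E] [CompleteSpace E]
  [NormedAddCommGroup K] [InnerProductSpace ℂ K] [CompleteSpace K]
  {H : E →ₗ.[ℂ] E} {F : E →L[ℂ] K} {l : ℝ}

theorem norm_resolventOp_le (hH : IsSelfAdjoint H) {z : ℂ} (hz : z.im ≠ 0) :
    ‖resolventOp H z‖ ≤ |z.im|⁻¹ := by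
  refine ContinuousLinearMap.opNorm_le_bound _ (by positivity) fun x => ?_
  obtain ⟨hd, hd'⟩ := (isResolventAt_resolventOp hH hz).1 x
  have h := abs_im_mul_norm_le hH z ⟨_, hd⟩
  rw [hd'] at h
  rwa [← div_eq_inv_mul, le_div_iff₀' (abs_pos.2 hz)]

theorem continuous_resolventOp (hH : IsSelfAdjoint H) {y : ℝ} (hy : 0 < y) :
    Continuous fun l : ℝ => resolventOp H (l + y * Complex.I) := by
  refine LipschitzWith.continuous (K := Real.toNNReal (y⁻¹ * y⁻¹))
    (LipschitzWith.of_dist_le_mul fun l l' => ?_)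
  have h1 : ∀ l : ℝ, ((l : ℂ) + y * Complex.I).im ≠ 0 := fun l => by
    rw [im_add_mul_I]; exact hy.ne'
  have h2 : ∀ l : ℝ, ‖resolventOp H (l + y * Complex.I)‖ ≤ y⁻¹ := fun l => by
    have := norm_resolventOp_le hH (h1 l)
    rwa [im_add_mul_I, abs_of_pos hy] at this
  rw [dist_eq_norm, resolventOp_sub hH (h1 l') (h1 l), norm_smul, Real.coe_toNNReal _ (by positivity),
    mul_comm]
  have h3 : ‖(l : ℂ) + y * Complex.I - (l' + y * Complex.I)‖ = dist l l' := by
    rw [add_sub_add_right_eq_sub, ← Complex.ofReal_sub, Complex.norm_real, Real.dist_eq,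
      Real.norm_eq_abs]
  rw [h3]
  gcongr
  exact (norm_mul_le _ _).trans (mul_le_mul (h2 l) (h2 l') (norm_nonneg _) (by positivity))

theorem continuous_sandwiched (hH : IsSelfAdjoint H) (F : E →L[ℂ] K) {y : ℝ} (hy : 0 < y) :
    Continuous fun l : ℝ => sandwiched H F (l + y * Complex.I) :=
  continuous_const.clm_comp ((continuous_resolventOp hH hy).clm_comp continuous_const)

theorem aestronglyMeasurable_of_tendsto_nhdsGT {G : Type*} [TopologicalSpace G]
    [TopologicalSpace.PseudoMetrizableSpace G] {u : ℝ → ℝ → G} {v : ℝ → G}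
    (hu : ∀ y, 0 < y → Continuous (u y))
    (h : ∀ᵐ l : ℝ, Tendsto (fun y => u y l) (𝓝[>] 0) (𝓝 (v l))) :
    AEStronglyMeasurable v := by
  obtain ⟨y, -, hy, hy'⟩ := exists_seq_strictAnti_tendsto (0 : ℝ)
  refine aestronglyMeasurable_of_tendsto_ae atTop
    (fun n => (hu (y n) (hy n)).stronglyMeasurable.aestronglyMeasurable) ?_
  filter_upwards [h] with l hl
  exact hl.comp (tendsto_nhdsWithin_iff.2 ⟨hy', Eventually.of_forall hy⟩)

theorem aestronglyMeasurable_boundaryValue (hH : IsSelfAdjoint H) (hL : LimitingAbsorption H F) :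
    AEStronglyMeasurable (boundaryValue H F) := by
  have hL' : ∀ᵐ l : ℝ, l ∈ regularSet H F := hL
  refine aestronglyMeasurable_of_tendsto_nhdsGT (fun y hy => continuous_sandwiched hH F hy) ?_
  filter_upwards [hL'] with l hl using tendsto_boundaryValue hl

theorem aestronglyMeasurable_sqrtIm (hH : IsSelfAdjoint H) (hL : LimitingAbsorption H F) :
    AEStronglyMeasurable (sqrtIm H F) := by
  have hL' : ∀ᵐ l : ℝ, l ∈ regularSet H F := hL
  have hnn : ∀ (y : ℝ), 0 < y → ∀ l : ℝ,
      0 ≤ (ℑ (sandwiched H F (l + y * Complex.I)) : K →L[ℂ] K) := fun y hy l =>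
    imaginaryPart_sandwiched_nonneg hH F (by rw [im_add_mul_I]; exact hy)
  have hs := CFC.continuousOn_sqrt (A := K →L[ℂ] K)
  refine aestronglyMeasurable_of_tendsto_nhdsGT
    (u := fun y l => CFC.sqrt (ℑ (sandwiched H F (l + y * Complex.I)) : K →L[ℂ] K)) ?_ ?_
  · exact fun y hy => hs.comp_continuous
      (continuous_coe_imaginaryPart.comp (continuous_sandwiched hH F hy)) (hnn y hy)
  · filter_upwards [hL'] with l hl
    refine (hs _ (imaginaryPart_boundaryValue_nonneg hH hl)).tendsto.comp
      (tendsto_nhdsWithin_iff.2 ⟨(continuous_coe_imaginaryPart.tendsto _).comp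
        (tendsto_boundaryValue hl), ?_⟩)
    filter_upwards [eventually_mem_nhdsWithin] with y hy using hnn y hy l

end Measurability

/-! ### The absolutely continuous subspace -/

section AbsolutelyContinuous

variable {E : Type*} [NormedAddCommGroup E] [InnerProductSpace ℂ E] [CompleteSpace E]
  {H : E →ₗ.[ℂ] E}

theorem ProjMeasure.proj_eq_zero_iff (P : ProjMeasure E) {s : Set ℝ} (hs : MeasurableSet s)
    (f : E) : P.proj s f = 0 ↔ P.scalar f s = 0 := by
  rw [P.scalar_apply f hs]; simp

theorem mem_acSubspace_iff {f : E} :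
    f ∈ acSubspace H ↔ (spectralMeasure H).scalar f ≪ volume := by
  refine ⟨fun h => Measure.AbsolutelyContinuous.mk fun s hs h0 => ?_, fun h s hs h0 => ?_⟩
  · exact ((spectralMeasure H).proj_eq_zero_iff hs f).1 (h s hs h0)
  · exact ((spectralMeasure H).proj_eq_zero_iff hs f).2 (h h0)

theorem restrict_absolutelyContinuous_of_singularPart_eq_zero {α : Type*} [MeasurableSpace α]
    {μ ν : Measure α} [SigmaFinite μ] [SigmaFinite ν] {s : Set α}
    (h : μ.singularPart ν s = 0) : μ.restrict s ≪ ν := by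
  refine Measure.AbsolutelyContinuous.mk fun t ht h0 => ?_
  rw [Measure.restrict_apply ht, Measure.haveLebesgueDecomposition_add μ ν, Measure.add_apply,
    measure_mono_null Set.inter_subset_right h, zero_add]
  exact measure_mono_null Set.inter_subset_left (withDensity_absolutelyContinuous _ _ h0)

theorem exists_null_set_proj_compl_mem [TopologicalSpace.SeparableSpace E] (H : E →ₗ.[ℂ] E) :
    ∃ N : Set ℝ, MeasurableSet N ∧ volume N = 0 ∧
      ∀ f, (spectralMeasure H).proj Nᶜ f ∈ acSubspace H := by
  set P := spectralMeasure H
  let u := TopologicalSpace.denseSeq E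
  have hms : ∀ n, (P.scalar (u n)).singularPart volume ⟂ₘ volume := fun n =>
    Measure.mutuallySingular_singularPart _ _
  let N : Set ℝ := ⋃ n, (hms n).nullSetᶜ
  have hN : MeasurableSet N := MeasurableSet.iUnion fun n => (hms n).measurableSet_nullSet.compl
  refine ⟨N, hN, measure_iUnion_null fun n => (hms n).measure_compl_nullSet, fun f M hM h0 => ?_⟩
  rw [P.proj_proj hM hN.compl]
  refine congrFun (Continuous.ext_on (f := fun f => P.proj (M ∩ Nᶜ) f) (g := fun _ => 0)
    (TopologicalSpace.denseRange_denseSeq E) (by fun_prop) continuous_const ?_) f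
  rintro _ ⟨n, rfl⟩
  rw [P.proj_eq_zero_iff (hM.inter hN.compl), ← Measure.restrict_apply hM]
  refine restrict_absolutelyContinuous_of_singularPart_eq_zero ?_ h0
  refine measure_mono_null ?_ (hms n).measure_nullSet
  rw [Set.compl_subset_comm]
  exact Set.subset_iUnion (fun n => (hms n).nullSetᶜ) n

theorem setLIntegral_rnDeriv_eq {α : Type*} [MeasurableSpace α] {μ ν : Measure α}
    [IsFiniteMeasure μ] [SigmaFinite ν] {N s : Set α} (hN : MeasurableSet N) (h0 : ν N = 0)
    (h : μ.restrict Nᶜ ≪ ν) (hs : MeasurableSet s) :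
    ∫⁻ x in s, μ.rnDeriv ν x ∂ν = μ (s ∩ Nᶜ) := by
  have h1 : μ = μ.restrict N + μ.restrict Nᶜ := (Measure.restrict_add_restrict_compl hN).symm
  have h2 : μ.restrict N ⟂ₘ ν := ⟨Nᶜ, hN.compl, by simp [Measure.restrict_apply hN.compl], by
    rwa [compl_compl]⟩
  have h3 : μ.rnDeriv ν =ᵐ[ν] (μ.restrict Nᶜ).rnDeriv ν := by
    have h4 := Measure.rnDeriv_add (μ.restrict N) (μ.restrict Nᶜ) ν
    rw [← h1] at h4
    filter_upwards [h4, h2.rnDeriv_ae_eq_zero] with x hx hx'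
    rw [hx, Pi.add_apply, hx', Pi.zero_apply, zero_add]
  rw [lintegral_congr_ae (ae_restrict_of_ae h3), Measure.setLIntegral_rnDeriv h,
    Measure.restrict_apply hs]

end AbsolutelyContinuous

/-! ### The evaluation operator -/

section Evaluation

variable {E K : Type*} [NormedAddCommGroup E] [InnerProductSpace ℂ E] [CompleteSpace E]
  [NormedAddCommGroup K] [InnerProductSpace ℂ K] [CompleteSpace K]
  {H : E →ₗ.[ℂ] E} {F : E →L[ℂ] K} {l : ℝ}

theorem exists_subseq_ae_tendsto {α G : Type*} [MeasurableSpace α] [NormedAddCommGroup G]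
    {μ : Measure α} {u : ℕ → Lp G 2 μ} {v : Lp G 2 μ} (h : Tendsto u atTop (𝓝 v)) :
    ∃ ns : ℕ → ℕ, StrictMono ns ∧ ∀ᵐ x ∂μ, Tendsto (fun i => u (ns i) x) atTop (𝓝 (v x)) :=
  (tendstoInMeasure_of_tendsto_Lp h).exists_seq_tendsto_ae

theorem volume_restrict_regularSet (hL : LimitingAbsorption H F) :
    volume.restrict (regularSet H F) = volume :=
  Measure.restrict_eq_self_of_ae_mem hL

theorem ae_of_ae_restrict_regularSet (hL : LimitingAbsorption H F) {p : ℝ → Prop}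
    (h : ∀ᵐ l ∂(volume.restrict (regularSet H F)), p l) : ∀ᵐ l : ℝ, p l := by
  rwa [volume_restrict_regularSet hL] at h

theorem denseRange_adjoint (hF : Function.Injective F) :
    DenseRange (ContinuousLinearMap.adjoint F) := by
  have h : (LinearMap.range (ContinuousLinearMap.adjoint F).toLinearMap)ᗮ = ⊥ := by
    rw [Submodule.eq_bot_iff]
    intro v hv
    refine hF ?_
    rw [map_zero, ← inner_self_eq_zero (𝕜 := ℂ), ← ContinuousLinearMap.adjoint_inner_left]
    exact hv _ ⟨F v, rfl⟩
  rw [← Submodule.topologicalClosure_eq_top_iff] at h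
  exact Submodule.dense_iff_topologicalClosure_eq_top.2 h

theorem coe_evalAt (H : E →ₗ.[ℂ] E) (F : E →L[ℂ] K) (l : ℝ) (φ : K) :
    (evalAt H F l φ : K) = (((√Real.pi)⁻¹ : ℝ) : ℂ) • sqrtIm H F l φ := rfl

theorem evalAt_add (H : E →ₗ.[ℂ] E) (F : E →L[ℂ] K) (l : ℝ) (φ ψ : K) :
    evalAt H F l (φ + ψ) = evalAt H F l φ + evalAt H F l ψ := by
  ext; simp [coe_evalAt]

theorem evalAt_smul (H : E →ₗ.[ℂ] E) (F : E →L[ℂ] K) (l : ℝ) (c : ℂ) (φ : K) :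
    evalAt H F l (c • φ) = c • evalAt H F l φ := by
  ext; simp only [coe_evalAt, map_smul, Submodule.coe_smul]; rw [smul_comm]

theorem aestronglyMeasurable_evalAt (hH : IsSelfAdjoint H) (hL : LimitingAbsorption H F) (φ : K) :
    AEStronglyMeasurable (fun l => (evalAt H F l φ : K)) :=
  ((ContinuousLinearMap.apply ℂ K φ).continuous.comp_aestronglyMeasurable
    (aestronglyMeasurable_sqrtIm hH hL)).const_smul _

theorem ae_enorm_evalAt_sq (hH : IsSelfAdjoint H) (hL : LimitingAbsorption H F) (φ : K) :
    ∀ᵐ l : ℝ, ‖(evalAt H F l φ : K)‖ₑ ^ 2 = ((spectralMeasure H).scalar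
      (ContinuousLinearMap.adjoint F φ)).rnDeriv volume l := by
  filter_upwards [ae_norm_evalAt_sq hH hL φ, Measure.rnDeriv_lt_top ((spectralMeasure H).scalar
      (ContinuousLinearMap.adjoint F φ)) volume] with l h1 h2
  rw [← ENNReal.ofReal_toReal h2.ne, ← h1, ENNReal.ofReal_pow (norm_nonneg _), ofReal_norm]
  rfl

theorem eLpNorm_evalAt_le (hH : IsSelfAdjoint H) (hL : LimitingAbsorption H F) (φ : K) :
    eLpNorm (fun l => (evalAt H F l φ : K)) 2 volume ≤ ‖ContinuousLinearMap.adjoint F φ‖ₑ := by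
  rw [← ENNReal.pow_le_pow_left_iff two_ne_zero, eLpNorm_two_sq,
    lintegral_congr_ae (ae_enorm_evalAt_sq hH hL φ), ← (spectralMeasure H).scalar_univ]
  exact Measure.lintegral_rnDeriv_le

theorem memLp_evalAt (hH : IsSelfAdjoint H) (hL : LimitingAbsorption H F) (φ : K) :
    MemLp (fun l => (evalAt H F l φ : K)) 2 (volume.restrict (regularSet H F)) := by
  rw [volume_restrict_regularSet hL]
  exact ⟨aestronglyMeasurable_evalAt hH hL φ,
    (eLpNorm_evalAt_le hH hL φ).trans_lt enorm_lt_top⟩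

/-- The map `φ ↦ ℰ_l(H) F* φ` to square integrable sections. -/
def evalLp (hH : IsSelfAdjoint H) (hL : LimitingAbsorption H F) :
    K →ₗ[ℂ] Lp K 2 (volume.restrict (regularSet H F)) where
  toFun φ := (memLp_evalAt hH hL φ).toLp
  map_add' φ ψ := by
    rw [← MemLp.toLp_add]
    congr 1
    ext l
    rw [evalAt_add]; rfl
  map_smul' c φ := by
    rw [RingHom.id_apply, ← MemLp.toLp_const_smul]
    congr 1
    ext l
    rw [evalAt_smul]; rfl

theorem coeFn_evalLp (hH : IsSelfAdjoint H) (hL : LimitingAbsorption H F) (φ : K) :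
    evalLp hH hL φ =ᵐ[volume.restrict (regularSet H F)] fun l => (evalAt H F l φ : K) :=
  (memLp_evalAt hH hL φ).coeFn_toLp

theorem norm_evalLp_le (hH : IsSelfAdjoint H) (hL : LimitingAbsorption H F) (φ : K) :
    ‖evalLp hH hL φ‖ ≤ 1 * ‖(ContinuousLinearMap.adjoint F).toLinearMap φ‖ := by
  rw [one_mul, ← ENNReal.ofReal_le_ofReal_iff (norm_nonneg _), ofReal_norm, ofReal_norm]
  change ‖(memLp_evalAt hH hL φ).toLp‖ₑ ≤ _
  rw [Lp.enorm_toLp, volume_restrict_regularSet hL]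
  exact eLpNorm_evalAt_le hH hL φ

theorem exists_isEvaluation (hH : IsSelfAdjoint H) (hL : LimitingAbsorption H F)
    (hF : Function.Injective F) : ∃ S, IsEvaluation H F S := by
  have hd : DenseRange (ContinuousLinearMap.adjoint F).toLinearMap := denseRange_adjoint hF
  let S := (evalLp hH hL).extendOfNorm (ContinuousLinearMap.adjoint F).toLinearMap
  have hS : ∀ φ, S (ContinuousLinearMap.adjoint F φ) = evalLp hH hL φ :=
    LinearMap.extendOfNorm_eq hd ⟨1, norm_evalLp_le hH hL⟩
  have hmem : ∀ f, S f ∈ directIntegral H F := by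
    intro f
    obtain ⟨u, hu, hu'⟩ := mem_closure_iff_seq_limit.1 (hd f)
    choose φ hφ using hu
    have h1 : Tendsto (fun n => evalLp hH hL (φ n)) atTop (𝓝 (S f)) := by
      have := (S.continuous.tendsto f).comp hu'
      refine this.congr fun n => ?_
      rw [Function.comp_apply, ← hφ n]
      exact hS (φ n)
    obtain ⟨ns, -, h2⟩ := exists_subseq_ae_tendsto h1
    have h3 := ae_all_iff.2 fun n => coeFn_evalLp hH hL (φ n)
    change ∀ᵐ l ∂_, _
    filter_upwards [h2, h3] with l h4 h5
    refine (Submodule.isClosed_topologicalClosure _).mem_of_tendsto h4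
      (Eventually.of_forall fun n => ?_)
    rw [h5]
    exact (evalAt H F l (φ (ns n))).2
  refine ⟨S.codRestrict _ hmem, fun φ => ?_⟩
  rw [ContinuousLinearMap.coe_codRestrict_apply, hS]
  exact coeFn_evalLp hH hL φ

theorem isEvaluation_evaluation (hH : IsSelfAdjoint H) (hL : LimitingAbsorption H F)
    (hF : Function.Injective F) : IsEvaluation H F (evaluation H F) := by
  have h := exists_isEvaluation hH hL hF
  rw [evaluation, dif_pos h]
  exact h.choose_spec

theorem evalSection_adjoint (hH : IsSelfAdjoint H) (hL : LimitingAbsorption H F)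
    (hF : Function.Injective F) (φ : K) :
    ∀ᵐ l : ℝ, evalSection H F (ContinuousLinearMap.adjoint F φ) l = evalAt H F l φ :=
  ae_of_ae_restrict_regularSet hL (isEvaluation_evaluation hH hL hF φ)

theorem evalSection_mem_fibre (hL : LimitingAbsorption H F) (f : E) :
    ∀ᵐ l : ℝ, evalSection H F f l ∈ fibre H F l := by
  have h : ∀ᵐ l ∂(volume.restrict (regularSet H F)), evalSection H F f l ∈ fibre H F l :=
    (evaluation H F f).2
  rwa [volume_restrict_regularSet hL] at h

theorem memLp_evalSection (hL : LimitingAbsorption H F) (f : E) :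
    MemLp (evalSection H F f) 2 volume := by
  have h : MemLp (evalSection H F f) 2 (volume.restrict (regularSet H F)) := Lp.memLp _
  rwa [volume_restrict_regularSet hL] at h

theorem evalSection_add (hL : LimitingAbsorption H F) (f g : E) :
    ∀ᵐ l : ℝ, evalSection H F (f + g) l = evalSection H F f l + evalSection H F g l := by
  have h := Lp.coeFn_add (evaluation H F f : Lp K 2 (volume.restrict (regularSet H F)))
    (evaluation H F g)
  filter_upwards [ae_of_ae_restrict_regularSet hL h] with l hl
  rw [evalSection, map_add]
  exact hl

theorem evalSection_smul (hL : LimitingAbsorption H F) (c : ℂ) (f : E) :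
    ∀ᵐ l : ℝ, evalSection H F (c • f) l = c • evalSection H F f l := by
  have h := Lp.coeFn_smul c (evaluation H F f : Lp K 2 (volume.restrict (regularSet H F)))
  filter_upwards [ae_of_ae_restrict_regularSet hL h] with l hl
  rw [evalSection, map_smul]
  exact hl

theorem exists_seq_evalSection_tendsto (hH : IsSelfAdjoint H) (hL : LimitingAbsorption H F)
    (hF : Function.Injective F) (f : E) :
    ∃ φ : ℕ → K, ∀ᵐ l : ℝ, Tendsto (fun n => (evalAt H F l (φ n) : K)) atTop
      (𝓝 (evalSection H F f l)) := by
  obtain ⟨u, hu, hu'⟩ := mem_closure_iff_seq_limit.1 (denseRange_adjoint hF f)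
  choose φ hφ using hu
  have h1 := (((directIntegral H F).subtypeL ∘L evaluation H F).continuous.tendsto f).comp hu'
  obtain ⟨ns, -, h2⟩ := exists_subseq_ae_tendsto h1
  refine ⟨fun n => φ (ns n), ?_⟩
  filter_upwards [ae_of_ae_restrict_regularSet hL h2, ae_all_iff.2 fun n => evalSection_adjoint hH hL hF (φ n)] with l h3 h4
  refine h3.congr fun n => ?_
  rw [← h4, hφ]
  rfl

theorem setLIntegral_evalSection (hH : IsSelfAdjoint H) (hL : LimitingAbsorption H F)
    (hF : Function.Injective F) {N s : Set ℝ} (hN : MeasurableSet N) (h0 : volume N = 0)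
    (hN' : ∀ f, (spectralMeasure H).proj Nᶜ f ∈ acSubspace H) (hs : MeasurableSet s) (f : E) :
    ∫⁻ l in s, ‖evalSection H F f l‖ₑ ^ 2 = ‖(spectralMeasure H).proj (s ∩ Nᶜ) f‖ₑ ^ 2 := by
  let r := LpToLpRestrictCLM ℝ K ℂ (volume.restrict (regularSet H F)) 2 s
  let A : E →L[ℂ] Lp K 2 ((volume.restrict (regularSet H F)).restrict s) :=
    r ∘L (directIntegral H F).subtypeL ∘L evaluation H F
  have hA : ∀ f, ∫⁻ l in s, ‖evalSection H F f l‖ₑ ^ 2 = ‖A f‖ₑ ^ 2 := by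
    intro f
    have h1 : A f =ᵐ[(volume.restrict (regularSet H F)).restrict s] evalSection H F f :=
      LpToLpRestrictCLM_coeFn ℂ s _
    rw [Lp.enorm_def, eLpNorm_congr_ae h1, eLpNorm_two_sq, volume_restrict_regularSet hL]
  rw [hA]
  refine (denseRange_adjoint hF).induction_on f (isClosed_eq (by fun_prop) (by fun_prop)) fun φ => ?_
  have h2 : (fun l => ‖evalSection H F (ContinuousLinearMap.adjoint F φ) l‖ₑ ^ 2) =ᵐ[volume]
      ((spectralMeasure H).scalar (ContinuousLinearMap.adjoint F φ)).rnDeriv volume := by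
    filter_upwards [evalSection_adjoint hH hL hF φ, ae_enorm_evalAt_sq hH hL φ] with l h3 h4
    rw [h3, h4]
  rw [← hA, lintegral_congr_ae (ae_restrict_of_ae h2), setLIntegral_rnDeriv_eq hN h0 ?_ hs,
    ProjMeasure.scalar_apply _ _ (hs.inter hN.compl)]
  rw [← ProjMeasure.scalar_proj _ hN.compl, ← mem_acSubspace_iff]
  exact hN' _

variable [TopologicalSpace.SeparableSpace E]

theorem evalSection_proj (hH : IsSelfAdjoint H) (hL : LimitingAbsorption H F)
    (hF : Function.Injective F) {s : Set ℝ} (hs : MeasurableSet s) (f : E) :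
    ∀ᵐ l : ℝ, evalSection H F ((spectralMeasure H).proj s f) l =
      s.indicator (evalSection H F f) l := by
  obtain ⟨N, hN, h0, hN'⟩ := exists_null_set_proj_compl_mem H
  have key : ∀ t : Set ℝ, MeasurableSet t →
      ∀ᵐ l : ℝ, l ∈ tᶜ → evalSection H F ((spectralMeasure H).proj t f) l = 0 := by
    intro t ht
    have h1 := setLIntegral_evalSection hH hL hF hN h0 hN' ht.compl
      ((spectralMeasure H).proj t f)
    rw [ProjMeasure.proj_proj _ (ht.compl.inter hN.compl) ht, Set.inter_right_comm,
      Set.compl_inter_self, Set.empty_inter, ((spectralMeasure H).proj_eq_zero_iff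
      MeasurableSet.empty f).2 measure_empty, enorm_zero, zero_pow two_ne_zero] at h1
    rw [lintegral_eq_zero_iff' ((memLp_evalSection hL _).1.enorm.pow_const 2).restrict] at h1
    have h2 := (ae_restrict_iff' ht.compl).1 h1
    filter_upwards [h2] with l hl hlt
    simpa using hl hlt
  have h3 := evalSection_add hL ((spectralMeasure H).proj s f) ((spectralMeasure H).proj sᶜ f)
  rw [(spectralMeasure H).proj_add_proj_compl hs] at h3
  filter_upwards [key s hs, key sᶜ hs.compl, h3] with l h4 h5 h6
  by_cases hl : l ∈ s
  · rw [Set.indicator_of_mem hl, h6, h5 (by simpa using hl), add_zero]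
  · rw [Set.indicator_of_notMem hl, h4 hl]

theorem setLIntegral_evalSection_of_mem (hH : IsSelfAdjoint H) (hL : LimitingAbsorption H F)
    (hF : Function.Injective F) {s : Set ℝ} (hs : MeasurableSet s) {f : E}
    (hf : f ∈ acSubspace H) :
    ∫⁻ l in s, ‖evalSection H F f l‖ₑ ^ 2 = ‖(spectralMeasure H).proj s f‖ₑ ^ 2 := by
  obtain ⟨N, hN, h0, hN'⟩ := exists_null_set_proj_compl_mem H
  rw [setLIntegral_evalSection hH hL hF hN h0 hN' hs, ← ProjMeasure.proj_proj _ hs hN.compl]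
  have h1 := (spectralMeasure H).proj_add_proj_compl hN f
  rw [hf N hN h0, zero_add] at h1
  rw [h1]

theorem norm_evaluation_of_mem (hH : IsSelfAdjoint H) (hL : LimitingAbsorption H F)
    (hF : Function.Injective F) {f : E} (hf : f ∈ acSubspace H) : ‖evaluation H F f‖ = ‖f‖ := by
  have h := setLIntegral_evalSection_of_mem hH hL hF MeasurableSet.univ hf
  rw [(spectralMeasure H).proj_univ, ← eLpNorm_two_sq, Measure.restrict_univ,
    ← volume_restrict_regularSet hL] at h
  have h1 := (ENNReal.pow_right_strictMono two_ne_zero).injective h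
  have h2 := congrArg ENNReal.toReal h1
  simpa [evalSection, Lp.norm_def] using h2

end Evaluation

/-! ### Surjectivity of the evaluation operator -/

section Surjectivity

variable {E K : Type*} [NormedAddCommGroup E] [InnerProductSpace ℂ E] [CompleteSpace E]
  [NormedAddCommGroup K] [InnerProductSpace ℂ K] [CompleteSpace K]
  {H : E →ₗ.[ℂ] E} {F : E →L[ℂ] K} {l : ℝ}

theorem isClosed_acSubspace (H : E →ₗ.[ℂ] E) : IsClosed (acSubspace H : Set E) := by
  have h : (acSubspace H : Set E) = ⋂ (N : Set ℝ) (_ : MeasurableSet N) (_ : volume N = 0),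
      {f | (spectralMeasure H).proj N f = 0} := by
    ext f; simp [acSubspace]
  rw [h]
  exact isClosed_iInter fun N => isClosed_iInter fun _ => isClosed_iInter fun _ =>
    isClosed_eq (by fun_prop) continuous_const

instance completeSpace_acSubspace (H : E →ₗ.[ℂ] E) : CompleteSpace (acSubspace H) :=
  (isClosed_acSubspace H).completeSpace_coe

theorem eq_zero_of_forall_inner_evalAt {v : K} (hv : v ∈ fibre H F l) {D : Set K} (hD : Dense D)
    (h : ∀ φ ∈ D, inner ℂ (evalAt H F l φ : K) v = 0) : v = 0 := by
  have h1 : ∀ φ, inner ℂ (sqrtIm H F l φ) v = 0 := by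
    refine fun φ => congrFun (Continuous.ext_on (f := fun φ => inner ℂ (sqrtIm H F l φ) v)
      (g := fun _ => 0) hD (by fun_prop) continuous_const fun φ hφ => ?_) φ
    have h2 := h φ hφ
    rw [coe_evalAt, inner_smul_left, Complex.conj_ofReal, mul_eq_zero] at h2
    exact h2.resolve_left (by
      exact_mod_cast (inv_pos.2 (Real.sqrt_pos.2 Real.pi_pos)).ne')
  have h3 : v ∈ (LinearMap.range (sqrtIm H F l : K →ₗ[ℂ] K))ᗮ := by
    rintro _ ⟨φ, rfl⟩
    exact h1 φ
  rw [← Submodule.orthogonal_closure] at h3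
  exact inner_self_eq_zero.1 (h3 v hv)

variable [TopologicalSpace.SeparableSpace E]

theorem exists_mem_acSubspace_evalSection_eq (hH : IsSelfAdjoint H) (hL : LimitingAbsorption H F)
    (hF : IsRigging F) {g : ℝ → K} (hg : MemLp g 2 volume) (hg' : ∀ᵐ l : ℝ, g l ∈ fibre H F l) :
    ∃ f ∈ acSubspace H, evalSection H F f =ᵐ[volume] g := by
  obtain ⟨N, hN, h0, hN'⟩ := exists_null_set_proj_compl_mem H
  set μ := volume.restrict (regularSet H F)
  have hμ : μ = volume := volume_restrict_regularSet hL
  let S : E →L[ℂ] Lp K 2 μ := (directIntegral H F).subtypeL ∘L evaluation H F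
  have hS : Isometry (S ∘L (acSubspace H).subtypeL) :=
    AddMonoidHomClass.isometry_of_norm _ fun f => norm_evaluation_of_mem hH hL hF.1 f.2
  let M : Submodule ℂ (Lp K 2 μ) := LinearMap.range (S ∘L (acSubspace H).subtypeL).toLinearMap
  have hM : IsComplete (M : Set (Lp K 2 μ)) := by
    change IsComplete (Set.range (S ∘L (acSubspace H).subtypeL))
    exact hS.isUniformInducing.isComplete_range
  have : CompleteSpace M := hM.completeSpace_coe
  have hgμ : MemLp g 2 μ := by rwa [hμ]
  obtain ⟨p, ⟨f, rfl⟩, d, hd, hpd⟩ := M.exists_add_mem_mem_orthogonal hgμ.toLp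
  have h1 : ∀ᵐ l ∂μ, g l = evalSection H F f l + d l := by
    filter_upwards [hgμ.coeFn_toLp, Lp.coeFn_add (S f) d] with l h2 h3
    rw [← h2, hpd]
    exact h3
  have hint : ∀ φ, Integrable (fun l => inner ℂ (evalSection H F
      (ContinuousLinearMap.adjoint F φ) l) (d l)) μ := fun φ =>
    L2.integrable_inner (𝕜 := ℂ) (S (ContinuousLinearMap.adjoint F φ)) d
  have h4 : ∀ φ, ∀ᵐ l ∂μ, inner ℂ (evalSection H F (ContinuousLinearMap.adjoint F φ) l)
      (d l) = 0 := by
    intro φ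
    refine (hint φ).ae_eq_zero_of_forall_setIntegral_eq_zero fun s hs _ => ?_
    set x := (spectralMeasure H).proj s (ContinuousLinearMap.adjoint F φ)
    have h5 := hd _ ⟨⟨_, hN' x⟩, rfl⟩
    rw [L2.inner_def] at h5
    rw [← integral_indicator hs, ← h5]
    refine integral_congr_ae ?_
    have h6 : ∀ᵐ l ∂μ, l ∈ Nᶜ := by rw [hμ]; exact compl_mem_ae_iff.2 h0
    have h7 := evalSection_proj hH hL hF.1 hN.compl x
    have h8 := evalSection_proj hH hL hF.1 hs (ContinuousLinearMap.adjoint F φ)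
    rw [← hμ] at h7 h8
    filter_upwards [h6, h7, h8] with l h9 h10 h11
    rw [Set.indicator_of_mem h9, h11] at h10
    change _ = inner ℂ (evalSection H F ((spectralMeasure H).proj Nᶜ x) l) (d l)
    rw [h10]
    by_cases hl : l ∈ s <;> simp [hl]
  let u : ℕ → K := F ∘ TopologicalSpace.denseSeq E
  have hu : DenseRange u := hF.2.comp (TopologicalSpace.denseRange_denseSeq E) F.continuous
  refine ⟨f, f.2, ?_⟩
  filter_upwards [ae_of_ae_restrict_regularSet hL h1, hg', evalSection_mem_fibre hL (f : E),
    ae_of_ae_restrict_regularSet hL (ae_all_iff.2 fun n => h4 (u n)),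
    ae_all_iff.2 fun n => evalSection_adjoint hH hL hF.1 (u n)] with l h5 h6 h7 h8 h9
  have h10 : d l = 0 := by
    refine eq_zero_of_forall_inner_evalAt (H := H) (F := F) (l := l) ?_ hu ?_
    · have := Submodule.sub_mem _ h6 h7
      rwa [h5, add_sub_cancel_left] at this
    · rintro _ ⟨n, rfl⟩
      rw [← h9]
      exact h8 n
  rw [h5, h10, add_zero]

theorem mem_ext_evalSection (hH : IsSelfAdjoint H) (hL : LimitingAbsorption H F)
    (hF : Function.Injective F) {f g : E} (hf : f ∈ acSubspace H) (hg : g ∈ acSubspace H)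
    (h : evalSection H F f =ᵐ[volume] evalSection H F g) : f = g := by
  have h1 := norm_evaluation_of_mem hH hL hF (Submodule.sub_mem _ hf hg)
  have h2 : evaluation H F f = evaluation H F g := by
    refine Subtype.ext (Lp.ext ?_)
    change evalSection H F f =ᵐ[volume.restrict (regularSet H F)] evalSection H F g
    exact ae_restrict_of_ae h
  rw [map_sub, h2, sub_self, norm_zero] at h1
  exact sub_eq_zero.1 (norm_eq_zero.1 h1.symm)

end Surjectivity

/-! ### Wave matrices -/

section WaveMatrix

variable {E K : Type*} [NormedAddCommGroup E] [InnerProductSpace ℂ E] [CompleteSpace E]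
  [NormedAddCommGroup K] [InnerProductSpace ℂ K] [CompleteSpace K]
  {H H₀ H₁ : E →ₗ.[ℂ] E} {F : E →L[ℂ] K} {J : K →L[ℂ] K} {l : ℝ} {ε : ℤˣ}

theorem tendsto_clm_comp {ι E₁ E₂ E₃ : Type*} [NormedAddCommGroup E₁] [NormedSpace ℂ E₁]
    [NormedAddCommGroup E₂] [NormedSpace ℂ E₂] [NormedAddCommGroup E₃] [NormedSpace ℂ E₃]
    {p : Filter ι} {u : ι → E₂ →L[ℂ] E₃} {v : ι → E₁ →L[ℂ] E₂} {A : E₂ →L[ℂ] E₃}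
    {B : E₁ →L[ℂ] E₂} (hu : Tendsto u p (𝓝 A)) (hv : Tendsto v p (𝓝 B)) :
    Tendsto (fun i => u i ∘L v i) p (𝓝 (A ∘L B)) :=
  ((isBoundedBilinearMap_comp (𝕜 := ℂ)).continuous.tendsto (A, B)).comp (hu.prodMk_nhds hv)

/-- `H₁ = H₀ + F* J F`. -/
def IsPerturbation (F : E →L[ℂ] K) (J : K →L[ℂ] K) (H₁ H₀ : E →ₗ.[ℂ] E) : Prop :=
  H₁ = ((ContinuousLinearMap.adjoint F ∘L J ∘L F : E →L[ℂ] E) : E →ₗ[ℂ] E) +ᵥ H₀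

theorem IsPerturbation.symm (h : IsPerturbation F J H₁ H₀) : IsPerturbation F (-J) H₀ H₁ := by
  have h0 : (ContinuousLinearMap.adjoint F ∘L (-J) ∘L F : E →L[ℂ] E) =
      -(ContinuousLinearMap.adjoint F ∘L J ∘L F) := by
    ext x; simp
  rw [IsPerturbation, h0, h, vadd_vadd]
  simp

theorem resolventOp_comp_adjoint (hH₀ : IsSelfAdjoint H₀) (hH₁ : IsSelfAdjoint H₁)
    (h : IsPerturbation F J H₁ H₀) {z : ℂ} (hz : z.im ≠ 0) :
    resolventOp H₀ z ∘L ContinuousLinearMap.adjoint F =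
      (resolventOp H₁ z ∘L ContinuousLinearMap.adjoint F) ∘L (1 + J ∘L sandwiched H₀ F z) := by
  have h1 := resolventOp_vadd hH₀ hH₁ h hz hz
  ext φ
  have h2 := congrArg (fun A : E →L[ℂ] E => A (ContinuousLinearMap.adjoint F φ)) h1
  simp only [sub_self, zero_smul, zero_sub, mul_neg, neg_mul, ← sub_eq_add_neg] at h2
  change _ = resolventOp H₀ z (ContinuousLinearMap.adjoint F φ) -
    resolventOp H₁ z (ContinuousLinearMap.adjoint F (J (sandwiched H₀ F z φ))) at h2
  change resolventOp H₀ z (ContinuousLinearMap.adjoint F φ) =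
    resolventOp H₁ z (ContinuousLinearMap.adjoint F (φ + J (sandwiched H₀ F z φ)))
  rw [map_add, map_add, h2, sub_add_cancel]

theorem sandwiched_eq_comp (hH₀ : IsSelfAdjoint H₀) (hH₁ : IsSelfAdjoint H₁)
    (h : IsPerturbation F J H₁ H₀) {z : ℂ} (hz : z.im ≠ 0) :
    sandwiched H₀ F z = sandwiched H₁ F z ∘L (1 + J ∘L sandwiched H₀ F z) :=
  congrArg (F ∘L ·) (resolventOp_comp_adjoint hH₀ hH₁ h hz)

/-- The boundary values `T_{l±i0}(H)`. -/
def signedBoundaryValue (ε : ℤˣ) (H : E →ₗ.[ℂ] E) (F : E →L[ℂ] K) (l : ℝ) : K →L[ℂ] K :=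
  if ε = 1 then boundaryValue H F l else ContinuousLinearMap.adjoint (boundaryValue H F l)

theorem im_add_sign_mul_I (ε : ℤˣ) (l y : ℝ) :
    ((l : ℂ) + (ε : ℤ) * y * Complex.I).im = (ε : ℤ) * y := by
  simp

theorem sign_mul_ne_zero (ε : ℤˣ) {y : ℝ} (hy : 0 < y) : ((ε : ℤ) : ℝ) * y ≠ 0 :=
  mul_ne_zero (by exact_mod_cast ε.ne_zero) hy.ne'

theorem tendsto_signedBoundaryValue (hH : IsSelfAdjoint H) (hl : l ∈ regularSet H F) (ε : ℤˣ) :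
    Tendsto (fun y : ℝ => sandwiched H F (l + (ε : ℤ) * y * Complex.I)) (𝓝[>] 0)
      (𝓝 (signedBoundaryValue ε H F l)) := by
  rcases Int.units_eq_one_or ε with rfl | rfl
  · simpa [signedBoundaryValue] using tendsto_boundaryValue hl
  · have h := (ContinuousLinearMap.adjoint.continuous.tendsto _).comp (tendsto_boundaryValue hl)
    rw [signedBoundaryValue, if_neg (by decide)]
    refine h.congr' ?_
    filter_upwards [eventually_mem_nhdsWithin] with y hy
    rw [Function.comp_apply, adjoint_sandwiched hH F (by rw [im_add_mul_I]; exact ne_of_gt hy)]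
    congr 1
    simp

theorem sign_smul_imaginaryPart_signedBoundaryValue (ε : ℤˣ) (H : E →ₗ.[ℂ] E) (F : E →L[ℂ] K)
    (l : ℝ) : ((ε : ℤ) : ℂ) • (ℑ (signedBoundaryValue ε H F l) : K →L[ℂ] K) =
      (ℑ (boundaryValue H F l) : K →L[ℂ] K) := by
  rcases Int.units_eq_one_or ε with rfl | rfl
  · simp [signedBoundaryValue]
  · rw [signedBoundaryValue, if_neg (by decide), coe_imaginaryPart_eq, coe_imaginaryPart_eq,
      ContinuousLinearMap.adjoint_adjoint, ← neg_sub (boundaryValue H F l), smul_neg]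
    simp

theorem tendsto_smul_adjoint_comp (hH : IsSelfAdjoint H) (hl : l ∈ regularSet H F) (ε : ℤˣ) :
    Tendsto (fun y : ℝ => (y : ℂ) • (ContinuousLinearMap.adjoint
        (resolventOp H (l + (ε : ℤ) * y * Complex.I) ∘L ContinuousLinearMap.adjoint F) ∘L
        (resolventOp H (l + (ε : ℤ) * y * Complex.I) ∘L ContinuousLinearMap.adjoint F)))
      (𝓝[>] 0) (𝓝 (ℑ (boundaryValue H F l) : K →L[ℂ] K)) := by
  rw [← sign_smul_imaginaryPart_signedBoundaryValue ε]
  have h := ((continuous_coe_imaginaryPart.tendsto _).comp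
    (tendsto_signedBoundaryValue hH hl ε)).const_smul ((ε : ℤ) : ℂ)
  refine h.congr' ?_
  filter_upwards [eventually_mem_nhdsWithin] with y hy
  rw [Function.comp_apply, imaginaryPart_sandwiched hH F
    (by rw [im_add_sign_mul_I]; exact sign_mul_ne_zero ε hy), im_add_sign_mul_I, smul_smul]
  congr 1
  push_cast
  rw [← mul_assoc, ← Int.cast_mul, Int.units_coe_mul_self, Int.cast_one, one_mul]

/-- The operator `1 + J T_{l±i0}(H)`. -/
def transition (ε : ℤˣ) (H : E →ₗ.[ℂ] E) (F : E →L[ℂ] K) (J : K →L[ℂ] K) (l : ℝ) : K →L[ℂ] K :=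
  1 + J ∘L signedBoundaryValue ε H F l

theorem tendsto_transition (hH : IsSelfAdjoint H) (hl : l ∈ regularSet H F) (ε : ℤˣ)
    (J : K →L[ℂ] K) :
    Tendsto (fun y : ℝ => 1 + J ∘L sandwiched H F (l + (ε : ℤ) * y * Complex.I)) (𝓝[>] 0)
      (𝓝 (transition ε H F J l)) :=
  (tendsto_clm_comp tendsto_const_nhds (tendsto_signedBoundaryValue hH hl ε)).const_add 1

theorem transition_comp_transition (hH₀ : IsSelfAdjoint H₀) (hH₁ : IsSelfAdjoint H₁)
    (h : IsPerturbation F J H₁ H₀) (hl₀ : l ∈ regularSet H₀ F) (hl₁ : l ∈ regularSet H₁ F)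
    (ε : ℤˣ) : transition ε H₁ F (-J) l ∘L transition ε H₀ F J l = 1 := by
  refine tendsto_nhds_unique (tendsto_clm_comp (tendsto_transition hH₁ hl₁ ε (-J))
    (tendsto_transition hH₀ hl₀ ε J)) (tendsto_const_nhds.congr' ?_)
  filter_upwards [eventually_mem_nhdsWithin] with y hy
  have h1 := sandwiched_eq_comp hH₀ hH₁ h (z := l + (ε : ℤ) * y * Complex.I)
    (by rw [im_add_sign_mul_I]; exact sign_mul_ne_zero ε hy)
  generalize sandwiched H₀ F (l + (ε : ℤ) * y * Complex.I) = T₀ at h1 ⊢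
  generalize sandwiched H₁ F (l + (ε : ℤ) * y * Complex.I) = T₁ at h1 ⊢
  ext φ
  have h2 := congrArg (fun A : K →L[ℂ] K => A φ) h1
  change T₀ φ = T₁ (φ + J (T₀ φ)) at h2
  change φ = (φ + J (T₀ φ)) + -J (T₁ (φ + J (T₀ φ)))
  rw [← h2]
  abel

theorem imaginaryPart_boundaryValue_eq (hH₀ : IsSelfAdjoint H₀) (hH₁ : IsSelfAdjoint H₁)
    (h : IsPerturbation F J H₁ H₀) (hl₀ : l ∈ regularSet H₀ F) (hl₁ : l ∈ regularSet H₁ F)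
    (ε : ℤˣ) : (ℑ (boundaryValue H₀ F l) : K →L[ℂ] K) =
      ContinuousLinearMap.adjoint (transition ε H₀ F J l) ∘L
        (ℑ (boundaryValue H₁ F l) : K →L[ℂ] K) ∘L transition ε H₀ F J l := by
  have hA := tendsto_transition hH₀ hl₀ ε J
  refine tendsto_nhds_unique (tendsto_smul_adjoint_comp hH₀ hl₀ ε)
    ((tendsto_clm_comp ((ContinuousLinearMap.adjoint.continuous.tendsto _).comp hA)
      (tendsto_clm_comp (tendsto_smul_adjoint_comp hH₁ hl₁ ε) hA)).congr' ?_)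
  filter_upwards [eventually_mem_nhdsWithin] with y hy
  rw [resolventOp_comp_adjoint hH₀ hH₁ h (z := l + (ε : ℤ) * y * Complex.I)
    (by rw [im_add_sign_mul_I]; exact sign_mul_ne_zero ε hy),
    ContinuousLinearMap.adjoint_comp (resolventOp H₁ _ ∘L _) (1 + _)]
  ext φ
  simp only [Function.comp_apply, ContinuousLinearMap.comp_apply, smul_apply, map_smul]

theorem inner_evalAt_transition (hH₀ : IsSelfAdjoint H₀) (hH₁ : IsSelfAdjoint H₁)
    (h : IsPerturbation F J H₁ H₀) (hl₀ : l ∈ regularSet H₀ F) (hl₁ : l ∈ regularSet H₁ F)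
    (ε : ℤˣ) (φ ψ : K) :
    inner ℂ (evalAt H₁ F l (transition ε H₀ F J l φ)) (evalAt H₁ F l (transition ε H₀ F J l ψ)) =
      inner ℂ (evalAt H₀ F l φ) (evalAt H₀ F l ψ) := by
  rw [inner_evalAt hH₁ hl₁, inner_evalAt hH₀ hl₀,
    imaginaryPart_boundaryValue_eq hH₀ hH₁ h hl₀ hl₁ ε, ContinuousLinearMap.comp_apply,
    ContinuousLinearMap.adjoint_inner_right, ContinuousLinearMap.comp_apply]

theorem tendsto_inner_resolventOp (hH₀ : IsSelfAdjoint H₀) (hH₁ : IsSelfAdjoint H₁)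
    (h : IsPerturbation F J H₁ H₀) (hl₀ : l ∈ regularSet H₀ F) (hl₁ : l ∈ regularSet H₁ F)
    (ε : ℤˣ) (φ ψ : K) :
    Tendsto (fun y : ℝ => ((y / Real.pi : ℝ) : ℂ) *
      inner ℂ (resolventOp H₁ (l + (ε : ℤ) * y * Complex.I) (ContinuousLinearMap.adjoint F φ))
        (resolventOp H₀ (l + (ε : ℤ) * y * Complex.I) (ContinuousLinearMap.adjoint F ψ)))
    (𝓝[>] 0) (𝓝 (inner ℂ (evalAt H₁ F l φ) (evalAt H₁ F l (transition ε H₀ F J l ψ)))) := by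
  rw [inner_evalAt hH₁ hl₁]
  have h1 := ((ContinuousLinearMap.apply ℂ K ψ).continuous.tendsto _).comp
    (tendsto_clm_comp (tendsto_smul_adjoint_comp hH₁ hl₁ ε) (tendsto_transition hH₀ hl₀ ε J))
  have h2 := ((tendsto_const_nhds (x := φ)).inner (𝕜 := ℂ) h1).const_mul ((Real.pi⁻¹ : ℝ) : ℂ)
  refine h2.congr' ?_
  filter_upwards [eventually_mem_nhdsWithin] with y hy
  have h3 := congrArg (fun A : K →L[ℂ] E => A ψ) (resolventOp_comp_adjoint hH₀ hH₁ h
    (z := l + (ε : ℤ) * y * Complex.I)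
    (by rw [im_add_sign_mul_I]; exact sign_mul_ne_zero ε hy))
  simp only [ContinuousLinearMap.comp_apply] at h3
  rw [h3]
  simp only [Function.comp_apply, ContinuousLinearMap.apply_apply, ContinuousLinearMap.comp_apply,
    smul_apply, inner_smul_right, ContinuousLinearMap.adjoint_inner_right]
  push_cast
  ring

/-- `φ ↦ ℰ_l(H) F* φ` as a linear map to the fibre. -/
def evalLinear (H : E →ₗ.[ℂ] E) (F : E →L[ℂ] K) (l : ℝ) : K →ₗ[ℂ] fibre H F l where
  toFun := evalAt H F l
  map_add' := evalAt_add H F l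
  map_smul' := evalAt_smul H F l

instance completeSpace_fibre (H : E →ₗ.[ℂ] E) (F : E →L[ℂ] K) (l : ℝ) :
    CompleteSpace (fibre H F l) :=
  (Submodule.isClosed_topologicalClosure _).completeSpace_coe

theorem denseRange_evalAt (H : E →ₗ.[ℂ] E) (F : E →L[ℂ] K) (l : ℝ) :
    DenseRange (evalAt H F l) := by
  have h : (LinearMap.range (evalLinear H F l))ᗮ = ⊥ := by
    rw [Submodule.eq_bot_iff]
    intro v hv
    exact Subtype.ext (eq_zero_of_forall_inner_evalAt v.2 dense_univ fun φ _ => hv _ ⟨φ, rfl⟩)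
  rw [← Submodule.topologicalClosure_eq_top_iff] at h
  exact Submodule.dense_iff_topologicalClosure_eq_top.2 h

theorem exists_isWaveMatrix (hH₀ : IsSelfAdjoint H₀) (hH₁ : IsSelfAdjoint H₁)
    (h : IsPerturbation F J H₁ H₀) (hl₀ : l ∈ regularSet H₀ F) (hl₁ : l ∈ regularSet H₁ F)
    (ε : ℤˣ) : ∃ w, IsWaveMatrix ε H₁ H₀ F l w := by
  let f := evalLinear H₁ F l ∘ₗ (transition ε H₀ F J l).toLinearMap
  have hf : ∀ φ, ‖f φ‖ ≤ 1 * ‖evalLinear H₀ F l φ‖ := fun φ => by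
    rw [one_mul, norm_eq_sqrt_re_inner (𝕜 := ℂ), norm_eq_sqrt_re_inner (𝕜 := ℂ)]
    exact (congrArg (fun c : ℂ => √c.re)
      (inner_evalAt_transition hH₀ hH₁ h hl₀ hl₁ ε φ φ)).le
  refine ⟨f.extendOfNorm (evalLinear H₀ F l), fun φ ψ => ?_⟩
  have h1 : f.extendOfNorm (evalLinear H₀ F l) (evalAt H₀ F l ψ) = f ψ :=
    LinearMap.extendOfNorm_eq (denseRange_evalAt H₀ F l) ⟨1, hf⟩ ψ
  rw [h1]
  exact tendsto_inner_resolventOp hH₀ hH₁ h hl₀ hl₁ ε φ ψ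

theorem isWaveMatrix_waveMatrix (hH₀ : IsSelfAdjoint H₀) (hH₁ : IsSelfAdjoint H₁)
    (h : IsPerturbation F J H₁ H₀) (hl₀ : l ∈ regularSet H₀ F) (hl₁ : l ∈ regularSet H₁ F)
    (ε : ℤˣ) : IsWaveMatrix ε H₁ H₀ F l (waveMatrix ε H₁ H₀ F l) := by
  have hw := exists_isWaveMatrix hH₀ hH₁ h hl₀ hl₁ ε
  rw [waveMatrix, dif_pos hw]
  exact hw.choose_spec

theorem waveMatrix_evalAt (hH₀ : IsSelfAdjoint H₀) (hH₁ : IsSelfAdjoint H₁)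
    (h : IsPerturbation F J H₁ H₀) (hl₀ : l ∈ regularSet H₀ F) (hl₁ : l ∈ regularSet H₁ F)
    (ε : ℤˣ) (ψ : K) : waveMatrix ε H₁ H₀ F l (evalAt H₀ F l ψ) =
      evalAt H₁ F l (transition ε H₀ F J l ψ) := by
  rw [← sub_eq_zero]
  refine Subtype.ext (eq_zero_of_forall_inner_evalAt (Subtype.prop _) dense_univ fun φ _ => ?_)
  rw [← Submodule.coe_inner, inner_sub_right, sub_eq_zero]
  exact tendsto_nhds_unique (isWaveMatrix_waveMatrix hH₀ hH₁ h hl₀ hl₁ ε φ ψ)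
    (tendsto_inner_resolventOp hH₀ hH₁ h hl₀ hl₁ ε φ ψ)

theorem norm_waveMatrix (hH₀ : IsSelfAdjoint H₀) (hH₁ : IsSelfAdjoint H₁)
    (h : IsPerturbation F J H₁ H₀) (hl₀ : l ∈ regularSet H₀ F) (hl₁ : l ∈ regularSet H₁ F)
    (ε : ℤˣ) (v : fibre H₀ F l) : ‖waveMatrix ε H₁ H₀ F l v‖ = ‖v‖ := by
  refine (denseRange_evalAt H₀ F l).induction_on v
    (isClosed_eq (by fun_prop) continuous_norm) fun ψ => ?_
  rw [waveMatrix_evalAt hH₀ hH₁ h hl₀ hl₁, norm_eq_sqrt_re_inner (𝕜 := ℂ),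
    inner_evalAt_transition hH₀ hH₁ h hl₀ hl₁, ← norm_eq_sqrt_re_inner]

theorem waveMatrix_waveMatrix (hH₀ : IsSelfAdjoint H₀) (hH₁ : IsSelfAdjoint H₁)
    (h : IsPerturbation F J H₁ H₀) (hl₀ : l ∈ regularSet H₀ F) (hl₁ : l ∈ regularSet H₁ F)
    (ε : ℤˣ) (v : fibre H₀ F l) :
    waveMatrix ε H₀ H₁ F l (waveMatrix ε H₁ H₀ F l v) = v := by
  refine (denseRange_evalAt H₀ F l).induction_on v
    (isClosed_eq (by fun_prop) continuous_id) fun ψ => ?_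
  rw [waveMatrix_evalAt hH₀ hH₁ h hl₀ hl₁, waveMatrix_evalAt hH₁ hH₀ h.symm hl₁ hl₀,
    ← ContinuousLinearMap.comp_apply (transition ε H₁ F (-J) l),
    transition_comp_transition hH₀ hH₁ h hl₀ hl₁]
  rfl

end WaveMatrix

/-! ### Unitary equivalence of absolutely continuous parts -/

section Intertwining

variable {E : Type*} [NormedAddCommGroup E] [InnerProductSpace ℂ E] [CompleteSpace E]
  {H H₀ H₁ : E →ₗ.[ℂ] E}

omit [CompleteSpace E] in
theorem inner_eq_of_forall_inner_self_eq {V : Type*} [AddCommGroup V] [Module ℂ V]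
    {a b c d : V →ₗ[ℂ] E} (h : ∀ x, inner ℂ (a x) (b x) = inner ℂ (c x) (d x)) (x y : V) :
    inner ℂ (a x) (b y) = inner ℂ (c x) (d y) := by
  have h1 := h (x + y)
  have h2 := h (x + Complex.I • y)
  simp only [map_add, map_smul, inner_add_left, inner_add_right, inner_smul_left, inner_smul_right,
    h x, h y, Complex.conj_I] at h1 h2
  linear_combination (1 / 2 : ℂ) * h1 - (Complex.I / 2) * h2 +
    (1 / 2 * (inner ℂ (a x) (b y) - inner ℂ (c x) (d y)) -
      1 / 2 * (inner ℂ (a y) (b x) - inner ℂ (c y) (d x))) * Complex.I_sq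

theorem mem_graph_acPart_iff {x y : acSubspace H} :
    (x, y) ∈ (acPart H).graph ↔ ∃ h : (x : E) ∈ H.domain, H ⟨x, h⟩ = y := by
  rw [LinearPMap.mem_graph_iff]
  constructor
  · rintro ⟨u, hu, huy⟩
    subst hu
    exact ⟨u.2.choose, congrArg Subtype.val huy⟩
  · rintro ⟨h, hy⟩
    exact ⟨⟨x, h, by rw [hy]; exact y.2⟩, rfl, Subtype.ext hy⟩

theorem apply_mem_acSubspace (hH : IsSelfAdjoint H) {x : E} (hx : x ∈ acSubspace H)
    (hd : x ∈ H.domain) : H ⟨x, hd⟩ ∈ acSubspace H := by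
  intro N hN h0
  rw [← (spectralMeasure_isSpectralMeasureOf hH).apply_proj hH hN hd]
  have h1 : (⟨(spectralMeasure H).proj N x,
      (spectralMeasure_isSpectralMeasureOf hH).proj_mem_domain hN hd⟩ : H.domain) = 0 :=
    Subtype.ext (hx N hN h0)
  rw [h1, LinearPMap.map_zero]

variable [TopologicalSpace.SeparableSpace E]

theorem eq_zero_of_forall_inner_domain (hH : IsSelfAdjoint H) {w : E} (hw : w ∈ acSubspace H)
    (h : ∀ u ∈ acSubspace H, u ∈ H.domain → inner ℂ u w = 0) : w = 0 := by
  obtain ⟨N, hN, h0, hN'⟩ := exists_null_set_proj_compl_mem H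
  have hw' : (spectralMeasure H).proj Nᶜ w = w := by
    have h1 := (spectralMeasure H).proj_add_proj_compl hN w
    rwa [hw N hN h0, zero_add] at h1
  refine hH.dense_domain.eq_zero_of_inner_right ℂ fun d hd => ?_
  rw [← hw', ← (spectralMeasure H).inner_proj_left hN.compl]
  exact h _ (hN' _) ((spectralMeasure_isSpectralMeasureOf hH).proj_mem_domain hN.compl hd)

theorem mem_graph_acPart_of_scalar_eq (hH₀ : IsSelfAdjoint H₀) (hH₁ : IsSelfAdjoint H₁)
    (U : acSubspace H₀ ≃ₗᵢ[ℂ] acSubspace H₁)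
    (hU : ∀ x, (spectralMeasure H₁).scalar (U x : E) = (spectralMeasure H₀).scalar (x : E))
    {x y : acSubspace H₀} (h : (x, y) ∈ (acPart H₀).graph) :
    (U x, U y) ∈ (acPart H₁).graph := by
  have hP₀ := spectralMeasure_isSpectralMeasureOf hH₀
  have hP₁ := spectralMeasure_isSpectralMeasureOf hH₁
  have hd : ∀ x : acSubspace H₀, (x : E) ∈ H₀.domain → (U x : E) ∈ H₁.domain := fun x hx => by
    rw [hP₁.mem_domain, hU, ← hP₀.mem_domain]
    exact hx
  obtain ⟨hx, hy⟩ := mem_graph_acPart_iff.1 h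
  let D := H₀.domain.comap (acSubspace H₀).subtype
  let a₀ : D →ₗ[ℂ] E := (acSubspace H₀).subtype ∘ₗ D.subtype
  let a₁ : D →ₗ[ℂ] E := (acSubspace H₁).subtype ∘ₗ U.toLinearEquiv.toLinearMap ∘ₗ D.subtype
  let b₀ : D →ₗ[ℂ] E := H₀.toFun ∘ₗ a₀.codRestrict H₀.domain fun u => u.2
  let b₁ : D →ₗ[ℂ] E := H₁.toFun ∘ₗ a₁.codRestrict H₁.domain fun u => hd u u.2
  have hab : ∀ u, inner ℂ (a₀ u) (b₀ u) = inner ℂ (a₁ u) (b₁ u) := fun u => by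
    have h1 := hP₀.inner_apply ⟨(u : acSubspace H₀), u.2⟩
    have h2 := hP₁.inner_apply ⟨U u, hd u u.2⟩
    rw [hU] at h2
    exact h1.trans h2.symm
  let v : acSubspace H₁ := ⟨H₁ ⟨U x, hd x hx⟩, apply_mem_acSubspace hH₁ (U x).2 _⟩
  have hv : U.symm v - y = 0 := by
    refine Subtype.ext (eq_zero_of_forall_inner_domain hH₀ (Subtype.prop _) fun u hu hud => ?_)
    have h1 := inner_eq_of_forall_inner_self_eq hab ⟨⟨u, hu⟩, hud⟩ ⟨x, hx⟩
    have h2 : inner ℂ u (y : E) = inner ℂ (U ⟨u, hu⟩) v := by rw [← hy]; exact h1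
    have h3 : inner ℂ u ((U.symm v : acSubspace H₀) : E) = inner ℂ (U ⟨u, hu⟩) v := by
      have h4 := U.inner_map_map ⟨u, hu⟩ (U.symm v)
      rw [U.apply_symm_apply] at h4
      exact h4.symm
    rw [Submodule.coe_sub, inner_sub_right, h2, h3, sub_self]
  refine mem_graph_acPart_iff.2 ⟨hd x hx, ?_⟩
  rw [← sub_eq_zero.1 hv, U.apply_symm_apply]

theorem intertwines_of_scalar_eq (hH₀ : IsSelfAdjoint H₀) (hH₁ : IsSelfAdjoint H₁)
    (U : acSubspace H₀ ≃ₗᵢ[ℂ] acSubspace H₁)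
    (hU : ∀ x, (spectralMeasure H₁).scalar (U x : E) = (spectralMeasure H₀).scalar (x : E)) :
    Intertwines U (acPart H₀) (acPart H₁) := by
  refine fun x y => ⟨mem_graph_acPart_of_scalar_eq hH₀ hH₁ U hU, fun h => ?_⟩
  have h1 := mem_graph_acPart_of_scalar_eq hH₁ hH₀ U.symm (fun x => by
    rw [← hU, U.apply_symm_apply]) h
  rwa [U.symm_apply_apply, U.symm_apply_apply] at h1

end Intertwining

/-! ### Wave operators -/

section WaveOperator

variable {E K : Type*} [NormedAddCommGroup E] [InnerProductSpace ℂ E] [CompleteSpace E]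
  [NormedAddCommGroup K] [InnerProductSpace ℂ K] [CompleteSpace K]
  {H H₀ H₁ : E →ₗ.[ℂ] E} {F : E →L[ℂ] K} {J : K →L[ℂ] K} {ε : ℤˣ}

theorem aestronglyMeasurable_evalAt_transition (hH₀ : IsSelfAdjoint H₀)
    (hH₁ : IsSelfAdjoint H₁) (hL₀ : LimitingAbsorption H₀ F) (hL₁ : LimitingAbsorption H₁ F)
    (ε : ℤˣ) (J : K →L[ℂ] K) (φ : K) :
    AEStronglyMeasurable fun l => (evalAt H₁ F l (transition ε H₀ F J l φ) : K) := by
  have h1 : AEStronglyMeasurable (signedBoundaryValue ε H₀ F) := by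
    have h := aestronglyMeasurable_boundaryValue hH₀ hL₀
    rcases Int.units_eq_one_or ε with rfl | rfl
    · exact h
    · exact ContinuousLinearMap.adjoint.continuous.comp_aestronglyMeasurable h
  have h2 : AEStronglyMeasurable fun l => transition ε H₀ F J l φ :=
    (continuous_const.add (J.continuous.comp
      (ContinuousLinearMap.apply ℂ K φ).continuous)).comp_aestronglyMeasurable h1
  exact ((isBoundedBilinearMap_apply (𝕜 := ℂ)).continuous.comp_aestronglyMeasurable
    ((aestronglyMeasurable_sqrtIm hH₁ hL₁).prodMk h2)).const_smul _

/-- `ℰ(H₁) g` is the image of `ℰ(H₀) f` under the wave matrices. -/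
def IsWavePair (ε : ℤˣ) (H₁ H₀ : E →ₗ.[ℂ] E) (F : E →L[ℂ] K) (f g : E) : Prop :=
  ∀ᵐ l : ℝ, ∃ h : evalSection H₀ F f l ∈ fibre H₀ F l,
    evalSection H₁ F g l = waveMatrix ε H₁ H₀ F l ⟨evalSection H₀ F f l, h⟩

theorem IsWavePair.add (hL₀ : LimitingAbsorption H₀ F) (hL₁ : LimitingAbsorption H₁ F)
    {f g f' g' : E} (h : IsWavePair ε H₁ H₀ F f g) (h' : IsWavePair ε H₁ H₀ F f' g') :
    IsWavePair ε H₁ H₀ F (f + f') (g + g') := by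
  filter_upwards [h, h', evalSection_add hL₀ f f', evalSection_add hL₁ g g']
    with l ⟨h1, h2⟩ ⟨h3, h4⟩ h5 h6
  have h7 : evalSection H₀ F (f + f') l ∈ fibre H₀ F l := by
    rw [h5]; exact Submodule.add_mem _ h1 h3
  have h8 : (⟨_, h7⟩ : fibre H₀ F l) = ⟨_, h1⟩ + ⟨_, h3⟩ := Subtype.ext h5
  exact ⟨h7, by rw [h8, map_add, h6, h2, h4]; rfl⟩

theorem IsWavePair.smul (hL₀ : LimitingAbsorption H₀ F) (hL₁ : LimitingAbsorption H₁ F)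
    {f g : E} (c : ℂ) (h : IsWavePair ε H₁ H₀ F f g) :
    IsWavePair ε H₁ H₀ F (c • f) (c • g) := by
  filter_upwards [h, evalSection_smul hL₀ c f, evalSection_smul hL₁ c g]
    with l ⟨h1, h2⟩ h5 h6
  have h7 : evalSection H₀ F (c • f) l ∈ fibre H₀ F l := by
    rw [h5]; exact Submodule.smul_mem _ _ h1
  have h8 : (⟨_, h7⟩ : fibre H₀ F l) = c • ⟨_, h1⟩ := Subtype.ext h5
  exact ⟨h7, by rw [h8, map_smul, h6, h2]; rfl⟩

theorem IsWavePair.norm_eq (hH₀ : IsSelfAdjoint H₀) (hH₁ : IsSelfAdjoint H₁)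
    (hL₀ : LimitingAbsorption H₀ F) (hL₁ : LimitingAbsorption H₁ F)
    (hJ : IsPerturbation F J H₁ H₀) {f g : E} (h : IsWavePair ε H₁ H₀ F f g) :
    ∀ᵐ l : ℝ, ‖evalSection H₁ F g l‖ = ‖evalSection H₀ F f l‖ := by
  have hL₀' : ∀ᵐ l : ℝ, l ∈ regularSet H₀ F := hL₀
  have hL₁' : ∀ᵐ l : ℝ, l ∈ regularSet H₁ F := hL₁
  filter_upwards [h, hL₀', hL₁'] with l ⟨h1, h2⟩ hl₀ hl₁
  rw [h2]
  exact norm_waveMatrix hH₀ hH₁ hJ hl₀ hl₁ ε _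

theorem IsWavePair.symm (hH₀ : IsSelfAdjoint H₀) (hH₁ : IsSelfAdjoint H₁)
    (hL₀ : LimitingAbsorption H₀ F) (hL₁ : LimitingAbsorption H₁ F)
    (hJ : IsPerturbation F J H₁ H₀) {f g : E} (h : IsWavePair ε H₁ H₀ F f g) :
    IsWavePair ε H₀ H₁ F g f := by
  have hL₀' : ∀ᵐ l : ℝ, l ∈ regularSet H₀ F := hL₀
  have hL₁' : ∀ᵐ l : ℝ, l ∈ regularSet H₁ F := hL₁
  filter_upwards [h, hL₀', hL₁', evalSection_mem_fibre hL₁ g] with l ⟨h1, h2⟩ hl₀ hl₁ h3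
  refine ⟨h3, ?_⟩
  have h4 : (⟨_, h3⟩ : fibre H₁ F l) = waveMatrix ε H₁ H₀ F l ⟨_, h1⟩ := Subtype.ext h2
  rw [h4, waveMatrix_waveMatrix hH₀ hH₁ hJ hl₀ hl₁]

variable [TopologicalSpace.SeparableSpace E]

theorem exists_isWavePair (hF : IsRigging F) (hH₀ : IsSelfAdjoint H₀) (hH₁ : IsSelfAdjoint H₁)
    (hL₀ : LimitingAbsorption H₀ F) (hL₁ : LimitingAbsorption H₁ F)
    (hJ : IsPerturbation F J H₁ H₀) (ε : ℤˣ) (f : E) :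
    ∃ g ∈ acSubspace H₁, IsWavePair ε H₁ H₀ F f g := by
  classical
  have hL₀' : ∀ᵐ l : ℝ, l ∈ regularSet H₀ F := hL₀
  have hL₁' : ∀ᵐ l : ℝ, l ∈ regularSet H₁ F := hL₁
  have hmem := evalSection_mem_fibre (H := H₀) (F := F) hL₀ f
  let G : ℝ → K := fun l => if h : evalSection H₀ F f l ∈ fibre H₀ F l then
    waveMatrix ε H₁ H₀ F l ⟨_, h⟩ else 0
  obtain ⟨φ, hφ⟩ := exists_seq_evalSection_tendsto hH₀ hL₀ hF.1 f
  have hG : AEStronglyMeasurable G := by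
    refine aestronglyMeasurable_of_tendsto_ae atTop
      (fun n => aestronglyMeasurable_evalAt_transition hH₀ hH₁ hL₀ hL₁ ε J (φ n)) ?_
    filter_upwards [hmem, hφ, hL₀', hL₁'] with l h1 h2 hl₀ hl₁
    have h3 : Tendsto (fun n => evalAt H₀ F l (φ n)) atTop (𝓝 ⟨_, h1⟩) :=
      tendsto_subtype_rng.2 h2
    have h4 := ((continuous_subtype_val.comp
      (waveMatrix ε H₁ H₀ F l).continuous).tendsto _).comp h3
    simp only [G, dif_pos h1]
    refine h4.congr fun n => ?_
    simp only [Function.comp_apply, waveMatrix_evalAt hH₀ hH₁ hJ hl₀ hl₁]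
  have hG' : MemLp G 2 volume := by
    refine (memLp_congr_norm hG (memLp_evalSection hL₀ f).1 ?_).2 (memLp_evalSection hL₀ f)
    filter_upwards [hmem, hL₀', hL₁'] with l h1 hl₀ hl₁
    simp only [G, dif_pos h1]
    exact norm_waveMatrix hH₀ hH₁ hJ hl₀ hl₁ ε _
  obtain ⟨g, hg, hgG⟩ := exists_mem_acSubspace_evalSection_eq hH₁ hL₁ hF hG' (by
    filter_upwards [hmem] with l h1
    simp only [G, dif_pos h1]
    exact Subtype.prop _)
  refine ⟨g, hg, ?_⟩
  filter_upwards [hmem, hgG] with l h1 h2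
  refine ⟨h1, ?_⟩
  rw [h2]
  simp only [G, dif_pos h1]

theorem IsWavePair.unique (hH₁ : IsSelfAdjoint H₁) (hL₁ : LimitingAbsorption H₁ F)
    (hF : Function.Injective F) {f g g' : E} (hg : g ∈ acSubspace H₁) (hg' : g' ∈ acSubspace H₁)
    (h : IsWavePair ε H₁ H₀ F f g) (h' : IsWavePair ε H₁ H₀ F f g') : g = g' := by
  refine mem_ext_evalSection hH₁ hL₁ hF hg hg' ?_
  filter_upwards [h, h'] with l ⟨h1, h2⟩ ⟨h3, h4⟩
  rw [h2, h4]

theorem IsWavePair.scalar_eq (hF : Function.Injective F) (hH₀ : IsSelfAdjoint H₀)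
    (hH₁ : IsSelfAdjoint H₁) (hL₀ : LimitingAbsorption H₀ F) (hL₁ : LimitingAbsorption H₁ F)
    (hJ : IsPerturbation F J H₁ H₀) {f g : E} (hf : f ∈ acSubspace H₀) (hg : g ∈ acSubspace H₁)
    (h : IsWavePair ε H₁ H₀ F f g) :
    (spectralMeasure H₁).scalar g = (spectralMeasure H₀).scalar f := by
  ext s hs
  rw [ProjMeasure.scalar_apply _ _ hs, ProjMeasure.scalar_apply _ _ hs,
    ← setLIntegral_evalSection_of_mem hH₁ hL₁ hF hs hg,
    ← setLIntegral_evalSection_of_mem hH₀ hL₀ hF hs hf]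
  refine lintegral_congr_ae (ae_restrict_of_ae ?_)
  filter_upwards [h.norm_eq hH₀ hH₁ hL₀ hL₁ hJ] with l hl
  rw [← ofReal_norm, ← ofReal_norm, hl]

theorem exists_waveOperator (hF : IsRigging F) (hH₀ : IsSelfAdjoint H₀) (hH₁ : IsSelfAdjoint H₁)
    (hL₀ : LimitingAbsorption H₀ F) (hL₁ : LimitingAbsorption H₁ F)
    (hJ : IsPerturbation F J H₁ H₀) (ε : ℤˣ) :
    ∃ W : acSubspace H₀ ≃ₗᵢ[ℂ] acSubspace H₁,
      ∀ f : acSubspace H₀, IsWavePair ε H₁ H₀ F f (W f) := by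
  choose w hw hw' using exists_isWavePair hF hH₀ hH₁ hL₀ hL₁ hJ ε
  let W : acSubspace H₀ →ₗ[ℂ] acSubspace H₁ :=
    { toFun := fun f => ⟨w f, hw f⟩
      map_add' := fun f g => Subtype.ext ((hw' (f + g)).unique hH₁ hL₁ hF.1 (hw _)
        (Submodule.add_mem _ (hw f) (hw g)) ((hw' f).add hL₀ hL₁ (hw' g)))
      map_smul' := fun c f => Subtype.ext ((hw' (c • f)).unique hH₁ hL₁ hF.1 (hw _)
        (Submodule.smul_mem _ c (hw f)) ((hw' f).smul hL₀ hL₁ c)) }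
  have hW : ∀ f, ‖W f‖ = ‖f‖ := fun f => by
    have h1 := congrArg (fun μ : Measure ℝ => μ Set.univ)
      ((hw' f).scalar_eq hF.1 hH₀ hH₁ hL₀ hL₁ hJ f.2 (hw f))
    simp only [ProjMeasure.scalar_univ] at h1
    have h2 := (ENNReal.pow_right_strictMono two_ne_zero).injective h1
    rw [← ofReal_norm, ← ofReal_norm,
      ENNReal.ofReal_eq_ofReal_iff (norm_nonneg _) (norm_nonneg _)] at h2
    exact h2
  refine ⟨LinearIsometryEquiv.ofSurjective ⟨W, hW⟩ fun g => ?_, fun f => hw' f⟩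
  obtain ⟨f, hf, hgf⟩ := exists_isWavePair hF hH₁ hH₀ hL₁ hL₀ hJ.symm ε (g : E)
  exact ⟨⟨f, hf⟩, Subtype.ext ((hw' f).unique hH₁ hL₁ hF.1 (hw f) g.2
    (hgf.symm hH₁ hH₀ hL₁ hL₀ hJ.symm))⟩

end WaveOperator

end Scattering

end

theorem mainTheorem12 {E K : Type*}
    [NormedAddCommGroup E] [InnerProductSpace ℂ E] [CompleteSpace E]
    [TopologicalSpace.SeparableSpace E]
    [NormedAddCommGroup K] [InnerProductSpace ℂ K] [CompleteSpace K]
    (F : E →L[ℂ] K) (hF : Scattering.IsRigging F)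
    (H₀ H₁ : E →ₗ.[ℂ] E) (hH₀ : IsSelfAdjoint H₀) (hH₁ : IsSelfAdjoint H₁)
    (hV : ∃ J : K →L[ℂ] K, IsSelfAdjoint J ∧
      H₁ = ((ContinuousLinearMap.adjoint F ∘L J ∘L F : E →L[ℂ] E) : E →ₗ[ℂ] E) +ᵥ H₀)
    (hL₀ : Scattering.LimitingAbsorption H₀ F) (hL₁ : Scattering.LimitingAbsorption H₁ F) :
    Scattering.IsEvaluation H₀ F (Scattering.evaluation H₀ F) ∧
    Scattering.IsEvaluation H₁ F (Scattering.evaluation H₁ F) ∧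
    ∀ ε : ℤˣ,
      (∀ l ∈ Scattering.regularSet H₀ F ∩ Scattering.regularSet H₁ F,
        Scattering.IsWaveMatrix ε H₁ H₀ F l (Scattering.waveMatrix ε H₁ H₀ F l)) ∧
      ∃ W : Scattering.acSubspace H₀ ≃ₗᵢ[ℂ] Scattering.acSubspace H₁,
        Scattering.IsWaveOperator ε H₁ H₀ F W ∧
        Scattering.Intertwines W (Scattering.acPart H₀) (Scattering.acPart H₁) := by
  obtain ⟨J, -, hJ⟩ := hV
  refine ⟨Scattering.isEvaluation_evaluation hH₀ hL₀ hF.1,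
    Scattering.isEvaluation_evaluation hH₁ hL₁ hF.1, fun ε => ⟨fun l hl =>
      Scattering.isWaveMatrix_waveMatrix hH₀ hH₁ hJ hl.1 hl.2 ε, ?_⟩⟩
  obtain ⟨W, hW⟩ := Scattering.exists_waveOperator hF hH₀ hH₁ hL₀ hL₁ hJ ε
  exact ⟨W, fun f => MeasureTheory.ae_restrict_of_ae (hW f),
    Scattering.intertwines_of_scalar_eq hH₀ hH₁ W fun f =>
      (hW f).scalar_eq hF.1 hH₀ hH₁ hL₀ hL₁ hJ f.2 (W f).2⟩
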